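/- **Conventions.** Let \(X\) be a (Hausdorff) reduced complex space and \(\mathcal O_X[[b]]\) the sheaf \(U\mapsto \mathcal O_X(U)[[b]]\). An \(\mathcal O_X\)-\((a,b)\)-module is a sheaf \(\mathbb E\) of \(\mathcal O_X[[b]]\)-modules, locally free of finite type, with an \(\mathcal O_X\)-linear endomorphism \(a\), continuous for the \(b\)-adic topology, such that \(ab-ba=b^2\). Its fibre at \(x\in X\) is \(E(x)=\mathbb E/\mathcal M_x[[b]]\,\mathbb E\), where \(\mathcal M_x\) is the ideal of functions vanishing at \(x\); it is an \((a,b)\)-module, i.e. a free \(\mathbb C[[b]]\)-module of finite rank with a \(\mathbb C\)-linear \(a\), continuous for the \(b\)-adic topology, such that \(ab-ba=b^2\), equivalently a left module, free of finite rank over \(\mathbb C[[b]]\), over the \(b\)-completion \(\tilde{\mathcal A}\) of \(\mathbb C\langle a,b\rangle/(ab-ba-b^2)\). For a finite set \(\Lambda\subset\,]0,1]\cap\mathbb Q\) put \(\Xi_\Lambda^{(N)}=\bigoplus_{\mu\in\Lambda}\bigoplus_{j=0}^N\mathbb C[[b]]\,e_{\mu,j}\) with \(a\,e_{\mu,0}=\mu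 b\,e_{\mu,0}\) and \(a\,e_{\mu,j}=\mu b\,e_{\mu,j}+b\,e_{\mu,j-1}\) for \(j\ge1\), and let \(\Xi_{X,\Lambda}^{(N)}\) be the analogous sheaf over \(\mathcal O_X[[b]]\), whose sections are the holomorphic maps to \(\Xi_\Lambda^{(N)}\). For \(\lambda\in\,]0,1]\cap\mathbb Q\), a \([\lambda]\)-primitive theme of rank \(k\) is an \((a,b)\)-module of rank \(k\) isomorphic to \(\tilde{\mathcal A}\varphi\subset\Xi_{\{\lambda\}}^{(N)}\) for some \(N\) and some \(\varphi\in\Xi_{\{\lambda\}}^{(N)}\). A submodule \(F\) of \(E\) stable by \(a\) is normal if \(F\cap bE=bF\). A \([\lambda]\)-primitive theme \(E\) of rank \(k\) has for each \(j\in[0,k]\) exactly one normal submodule \(F_j\) of rank \(j\), and \(F_{j-1}\subset F_j\). Its fundamental invariants \(\lambda_1\in\mathbb Q\), \(p_1,\dots,p_{k-1}\in\mathbb N\) are defined by \(F_j/F_{j-1}\simeq E_{\lambda_j}\) for \(1\le j\le k\), where \(\lambda_{j+1}=\lambda_j+p_j-1\) and \(E_\mu=\mathbb C[[b]]e\) with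 \(ae=\mu b e\). If \(k=2\) and \(p_1\ge1\), the parameter of \(E\) is the unique \(\alpha\in\mathbb C^*\) with \(E\simeq\tilde{\mathcal A}/\tilde{\mathcal A}\,(a-\lambda_1b)(1+\alpha b^{p_1})^{-1}(a-(\lambda_1+p_1-1)b)\). A holomorphic map \(\varphi:U\to\Xi_\Lambda^{(N)}\) is \(k\)-thematic if the sheaf \(\mathbb E_\varphi\) of \(\mathcal O_U[[b]]\)-submodules of \(\Xi_{U,\Lambda}^{(N)}\) generated by the \(a^\nu\varphi\), \(\nu\ge0\), is free with basis \(\varphi,a\varphi,\dots,a^{k-1}\varphi\). An \(\mathcal O_X\)-\((a,b)\)-module \(\mathbb E\) is a holomorphic family of rank \(k\) themes if each point of \(X\) has an open neighbourhood \(U\) with a finite set \(\Lambda\subset\,]0,1]\cap\mathbb Q\) and a \(k\)-thematic holomorphic map \(\varphi:U\to\Xi_\Lambda^{(k-1)}\) such that \(\mathbb E|_U\simeq\mathbb E_\varphi\) as sheaves of \(\mathcal O_U\)-\((a,b)\)-modules. **Theorem.** Let \(k\ge2\), let \(\lambda\in\,]0,1]\cap\mathbb Q\), and let \(\mathbb E\)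 be an \(\mathcal O_X\)-\((a,b)\)-module on \(X\) such that all the fibres \(E(x)\), \(x\in X\), are \([\lambda]\)-primitive themes of rank \(k\) with the same fundamental invariants \(\lambda_1,p_1,\dots,p_{k-1}\). Suppose first that \(p_{k-1}\ge1\), and let \(\alpha(x)\in\mathbb C^*\) be the parameter of the rank \(2\) \([\lambda]\)-primitive theme \(E(x)/F_{k-2}(x)\), whose fundamental invariants are \(\lambda_{k-1},p_{k-1}\). (This parameter exists and is unique for each \(x\).) Then \(\mathbb E\) is a holomorphic family of rank \(k\) themes if and only if the following two conditions hold: 1. the family \(F_{k-1}(x)\), \(x\in X\), is holomorphic, i.e. there is an \(\mathcal O_X\)-\((a,b)\)-submodule \(\mathbb F_{k-1}\) of \(\mathbb E\) which is a holomorphic family of rank \(k-1\) themes and takes the value \(F_{k-1}(x)\) at each \(x\in X\) (the natural map from the fibre of \(\mathbb F_{k-1}\) at \(x\) to \(E(x)\) is injective with image \(F_{k-1}(x)\)); 2. the function \(\alpha:X\to\mathbb C^*\) is holomorphic on \(X\). If \(p_{k-1}=0\), where no parameter is defined, \(\mathbb E\) is a holomorphic family of rank \(k\) themes if and only if condition 1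 holds. -/

import Mathlib

open TopologicalSpace PowerSeries

universe u v w

noncomputable section

/-! ### Reduced complex spaces -/

/-- `A` is a (closed) analytic subset of the open set `W ⊆ ℂⁿ`: near each point of `W` it is the
set of common zeros of finitely many holomorphic functions. -/
def IsAnalyticSubset {n : ℕ} (W A : Set (Fin n → ℂ)) : Prop :=
  IsOpen W ∧ A ⊆ W ∧ ∀ z ∈ W, ∃ V : Set (Fin n → ℂ), IsOpen V ∧ z ∈ V ∧ V ⊆ W ∧
    ∃ (m : ℕ) (f : Fin m → (Fin n → ℂ) → ℂ), (∀ i, DifferentiableOn ℂ (f i) V) ∧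
      A ∩ V = {w | w ∈ V ∧ ∀ i, f i w = 0}

/-- The structure of a reduced complex space on a topological space: a sheaf `hol` of
`ℂ`-algebras of complex valued functions (the holomorphic functions) which is locally
isomorphic to an analytic subset `A` of an open set of some `ℂⁿ` with the sheaf of functions
that are locally restrictions of holomorphic functions of the ambient space. -/
class ReducedComplexSpace (X : Type u) [TopologicalSpace X] where
  hol : ∀ U : Opens X, Subalgebra ℂ (U → ℂ)
  hol_res : ∀ {U V : Opens X} (h : V ≤ U) (f : U → ℂ), f ∈ hol U →
    (fun y : V => f ⟨y.1, h y.2⟩) ∈ hol V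
  hol_glue : ∀ (U : Opens X) (f : U → ℂ),
    (∀ x ∈ U, ∃ (V : Opens X) (h : V ≤ U), x ∈ V ∧ (fun y : V => f ⟨y.1, h y.2⟩) ∈ hol V) →
      f ∈ hol U
  local_model : ∀ x : X, ∃ U : Opens X, x ∈ U ∧
    ∃ (n : ℕ) (W A : Set (Fin n → ℂ)), IsAnalyticSubset W A ∧ ∃ e : U ≃ₜ A,
      ∀ (V : Opens X) (h : V ≤ U) (f : V → ℂ), f ∈ hol V ↔
        ∀ y : V, ∃ (B : Set (Fin n → ℂ)) (g : (Fin n → ℂ) → ℂ), IsOpen B ∧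
          (e ⟨y.1, h y.2⟩ : Fin n → ℂ) ∈ B ∧ DifferentiableOn ℂ g B ∧
          ∀ y' : V, (e ⟨y'.1, h y'.2⟩ : Fin n → ℂ) ∈ B → f y' = g (e ⟨y'.1, h y'.2⟩)

section Holomorphic

variable {X : Type u} [TopologicalSpace X] [ReducedComplexSpace X]

/-- The `ℂ`-algebra `𝒪_X(U)` of holomorphic functions on `U`. Since `𝒪_X` is a sheaf, so is
`U ↦ 𝒪_X(U)[[b]]`; the variable `b` is `PowerSeries.X`. -/
abbrev HolFun (U : Opens X) : Type u := ReducedComplexSpace.hol U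

/-- Restriction of holomorphic functions. -/
def HolFun.res {U V : Opens X} (h : V ≤ U) : HolFun U →ₐ[ℂ] HolFun V where
  toFun f := ⟨fun y => f.1 ⟨y.1, h y.2⟩, ReducedComplexSpace.hol_res h f.1 f.2⟩
  map_one' := rfl
  map_mul' _ _ := rfl
  map_zero' := rfl
  map_add' _ _ := rfl
  commutes' _ := rfl

/-- Evaluation of holomorphic functions at a point. -/
def HolFun.eval {U : Opens X} {x : X} (hx : x ∈ U) : HolFun U →ₐ[ℂ] ℂ where
  toFun f := f.1 ⟨x, hx⟩
  map_one' := rfl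
  map_mul' _ _ := rfl
  map_zero' := rfl
  map_add' _ _ := rfl
  commutes' _ := rfl

/-- A function `X → ℂ` is holomorphic on `X`. -/
def IsHolomorphicFun (f : X → ℂ) : Prop :=
  (fun y : (⊤ : Opens X) => f y.1) ∈ ReducedComplexSpace.hol (⊤ : Opens X)

end Holomorphic

/-! ### The operator `a` on `R[[b]]`-modules -/

/-- An additive operator `a` on an `R[[b]]`-module with `a (S m) = S (a m) + b² S' m` for all
`S ∈ R[[b]]`. For an operator which is `R`-linear and continuous for the `b`-adic topology this
is the commutation relation `a b - b a = b²`; conversely the formula contains the `R`-linearity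
(`S` constant), the commutation relation (`S = b`) and the continuity (`S = bⁿ`). -/
class ABAction (R : Type*) [CommRing R] (M : Type*) [AddCommGroup M] [Module R⟦X⟧ M] where
  a : M →+ M
  a_smul : ∀ (S : R⟦X⟧) (m : M), a (S • m) = S • a m + ((X : R⟦X⟧) ^ 2 * derivative R S) • m

/-- The operator `a` of `M`. -/
def aOp (R : Type*) [CommRing R] {M : Type*} [AddCommGroup M] [Module R⟦X⟧ M] [ABAction R M] :
    M →+ M := ABAction.a R

section ABModules

variable {R : Type*} [CommRing R]

theorem aOp_smul {M : Type*} [AddCommGroup M] [Module R⟦X⟧ M] [ABAction R M] (S : R⟦X⟧) (m : M) :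
    aOp R (S • m) = S • aOp R m + ((X : R⟦X⟧) ^ 2 * derivative R S) • m :=
  ABAction.a_smul S m

/-- `R[[b]]`-submodules stable by `a`. -/
structure ABSubmodule (R : Type*) [CommRing R] (M : Type*) [AddCommGroup M] [Module R⟦X⟧ M]
    [ABAction R M] extends Submodule R⟦X⟧ M where
  a_mem : ∀ m ∈ carrier, aOp R m ∈ carrier

variable {M : Type*} [AddCommGroup M] [Module R⟦X⟧ M] [ABAction R M]

instance ABSubmodule.instSub (F : ABSubmodule R M) : ABAction R F.toSubmodule where
  a := { toFun := fun m => ⟨aOp R m.1, F.a_mem m.1 m.2⟩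
         map_zero' := Subtype.ext (map_zero (aOp R))
         map_add' := fun _ _ => Subtype.ext (map_add (aOp R) _ _) }
  a_smul S m := Subtype.ext (aOp_smul S m.1)

instance ABSubmodule.instQuot (F : ABSubmodule R M) : ABAction R (M ⧸ F.toSubmodule) where
  a := QuotientAddGroup.map F.toSubmodule.toAddSubgroup F.toSubmodule.toAddSubgroup (aOp R)
    (fun m hm => F.a_mem m hm)
  a_smul S m := by
    induction m using Submodule.Quotient.induction_on with
    | _ m => exact congrArg (Submodule.Quotient.mk (p := F.toSubmodule)) (aOp_smul S m)

/-- `F ∩ G`, as a submodule of `G`. -/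
def ABSubmodule.inside (F G : ABSubmodule R M) : ABSubmodule R G.toSubmodule where
  toSubmodule := F.toSubmodule.comap G.toSubmodule.subtype
  a_mem m hm := F.a_mem m.1 hm

/-- The submodule generated by `m`, that is the `R[[b]]`-submodule generated by the `aⁿ m`. -/
def ABSubmodule.gen (m : M) : ABSubmodule R M where
  toSubmodule := Submodule.span R⟦X⟧ (Set.range fun n : ℕ => (aOp R)^[n] m)
  a_mem := by
    intro y hy
    change y ∈ Submodule.span R⟦X⟧ _ at hy
    change aOp R y ∈ Submodule.span R⟦X⟧ _
    induction hy using Submodule.span_induction with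
    | mem y hy =>
      obtain ⟨n, rfl⟩ := hy
      refine Submodule.subset_span ⟨n + 1, ?_⟩
      exact Function.iterate_succ_apply' _ _ _
    | zero => rw [map_zero]; exact Submodule.zero_mem _
    | add y z _ _ hy hz => rw [map_add]; exact Submodule.add_mem _ hy hz
    | smul S y hy0 hy =>
      rw [aOp_smul]
      exact Submodule.add_mem _ (Submodule.smul_mem _ _ hy) (Submodule.smul_mem _ _ hy0)

/-- `F` is normal in `M`: `F ∩ b M = b F`, i.e. `M ⧸ F` has no `b`-torsion. -/
def ABSubmodule.IsNormal (F : ABSubmodule R M) : Prop :=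
  ∀ m : M, (X : R⟦X⟧) • m ∈ F.toSubmodule → m ∈ F.toSubmodule

/-- `M` and `M'` are isomorphic: there is an `R[[b]]`-linear bijection which commutes with `a`. -/
def ABIso (R : Type*) [CommRing R] (M M' : Type*) [AddCommGroup M] [Module R⟦X⟧ M] [ABAction R M]
    [AddCommGroup M'] [Module R⟦X⟧ M'] [ABAction R M'] : Prop :=
  ∃ θ : M ≃ₗ[R⟦X⟧] M', ∀ m, θ (aOp R m) = aOp R (θ m)

/-- The rank one (a,b)-module `E_μ = ℂ[[b]] e` with `a e = μ b e`. -/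
def ELam (_μ : ℚ) : Type := ℂ⟦X⟧

instance (μ : ℚ) : AddCommGroup (ELam μ) := inferInstanceAs (AddCommGroup ℂ⟦X⟧)
instance (μ : ℚ) : Module ℂ⟦X⟧ (ELam μ) := inferInstanceAs (Module ℂ⟦X⟧ ℂ⟦X⟧)

/-- `S e ↦ a (S e) = (b² S' + μ b S) e`. -/
def ELam.a (μ : ℚ) : ℂ⟦X⟧ →+ ℂ⟦X⟧ where
  toFun S := (X : ℂ⟦X⟧) ^ 2 * derivative ℂ S + C (μ : ℂ) * X * S
  map_zero' := by simp
  map_add' S T := by rw [map_add]; ring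

theorem ELam.a_mul (μ : ℚ) (S T : ℂ⟦X⟧) :
    ELam.a μ (S * T) = S * ELam.a μ T + ((X : ℂ⟦X⟧) ^ 2 * derivative ℂ S) * T := by
  change (X : ℂ⟦X⟧) ^ 2 * derivative ℂ (S * T) + C (μ : ℂ) * X * (S * T) =
      S * ((X : ℂ⟦X⟧) ^ 2 * derivative ℂ T + C (μ : ℂ) * X * T) +
      ((X : ℂ⟦X⟧) ^ 2 * derivative ℂ S) * T
  rw [Derivation.leibniz, smul_eq_mul, smul_eq_mul]; ring

instance (μ : ℚ) : ABAction ℂ (ELam μ) where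
  a := ELam.a μ
  a_smul S T := ELam.a_mul μ S T

end ABModules

/-! ### The modules `Ξ_Λ^(N)` and themes -/

section Xi

/-- `Ξ_Λ^(N)` with coefficients in `R`: the free `R[[b]]`-module with basis `e_{l,j}`, for `l ∈ Λ`
and `0 ≤ j ≤ N`. -/
def Xi (R : Type w) (Λ : Finset ℚ) (N : ℕ) : Type w := Λ → Fin (N + 1) → R⟦X⟧

variable {R : Type*} [CommRing R] {Λ : Finset ℚ} {N : ℕ}

instance : AddCommGroup (Xi R Λ N) := inferInstanceAs (AddCommGroup (Λ → Fin (N + 1) → R⟦X⟧))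
instance : Module R⟦X⟧ (Xi R Λ N) := inferInstanceAs (Module R⟦X⟧ (Λ → Fin (N + 1) → R⟦X⟧))

/-- The operator `a` of `Ξ_Λ^(N)`: it is determined by `a e_{l,0} = l b e_{l,0}` and
`a e_{l,j} = l b e_{l,j} + b e_{l,j-1}` for `j ≥ 1`. -/
instance [Algebra ℂ R] : ABAction R (Xi R Λ N) where
  a := { toFun := fun s : Λ → Fin (N + 1) → R⟦X⟧ => fun l j =>
           (X : R⟦X⟧) ^ 2 * derivative R (s l j) + C (algebraMap ℂ R ((l : ℚ) : ℂ)) * X * s l j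
            + (if h : j.1 + 1 < N + 1 then X * s l ⟨j.1 + 1, h⟩ else 0)
         map_zero' := by
          funext l j
          change (X : R⟦X⟧) ^ 2 * derivative R (0 : R⟦X⟧) + C (algebraMap ℂ R ((l : ℚ) : ℂ)) * X * 0
            + (if h : j.1 + 1 < N + 1 then X * (0 : R⟦X⟧) else 0) = 0
          simp
         map_add' := fun s t => by
          funext l j
          change (X : R⟦X⟧) ^ 2 * derivative R (s l j + t l j) +
              C (algebraMap ℂ R ((l : ℚ) : ℂ)) * X * (s l j + t l j)
            + (if h : j.1 + 1 < N + 1 then X * (s l ⟨j.1 + 1, h⟩ + t l ⟨j.1 + 1, h⟩) else 0) =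
            ((X : R⟦X⟧) ^ 2 * derivative R (s l j) + C (algebraMap ℂ R ((l : ℚ) : ℂ)) * X * s l j
            + (if h : j.1 + 1 < N + 1 then X * s l ⟨j.1 + 1, h⟩ else 0)) +
            ((X : R⟦X⟧) ^ 2 * derivative R (t l j) + C (algebraMap ℂ R ((l : ℚ) : ℂ)) * X * t l j
            + (if h : j.1 + 1 < N + 1 then X * t l ⟨j.1 + 1, h⟩ else 0))
          rw [map_add]
          split_ifs <;> ring }
  a_smul S s := by
    funext l j
    change (X : R⟦X⟧) ^ 2 * derivative R (S * s l j) +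
        C (algebraMap ℂ R ((l : ℚ) : ℂ)) * X * (S * s l j)
      + (if h : j.1 + 1 < N + 1 then X * (S * s l ⟨j.1 + 1, h⟩) else 0) =
      S * ((X : R⟦X⟧) ^ 2 * derivative R (s l j) + C (algebraMap ℂ R ((l : ℚ) : ℂ)) * X * s l j
      + (if h : j.1 + 1 < N + 1 then X * s l ⟨j.1 + 1, h⟩ else 0)) +
      ((X : R⟦X⟧) ^ 2 * derivative R S) * s l j
    rw [Derivation.leibniz]; simp only [smul_eq_mul]
    split_ifs <;> ring

/-- Extension of scalars in `Ξ_Λ^(N)`. -/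
def Xi.map {R' : Type*} [CommRing R'] [Algebra ℂ R] [Algebra ℂ R'] (f : R →ₐ[ℂ] R')
    (s : Xi R Λ N) : Xi R' Λ N :=
  fun l j => PowerSeries.map f.toRingHom (s l j)

end Xi

section Themes

variable (E : Type*) [AddCommGroup E] [Module ℂ⟦X⟧ E] [ABAction ℂ E]

/-- `E` is a `[lam]`-primitive theme of rank `k`: it has rank `k` and is isomorphic to the
submodule of some `Ξ_lam^(N)` generated by one element. -/
def IsPrimitiveTheme (lam : ℚ) (k : ℕ) : Prop :=
  Module.finrank ℂ⟦X⟧ E = k ∧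
    ∃ (N : ℕ) (φ : Xi ℂ {lam} N), ABIso ℂ E (ABSubmodule.gen (R := ℂ) φ).toSubmodule

/-- `λ_j = λ_1 + (p_1 - 1) + ⋯ + (p_{j-1} - 1)` for `j ≥ 1`, so that
`λ_{j+1} = λ_j + p_j - 1`. -/
def lamInv (lam₁ : ℚ) (p : ℕ → ℕ) (j : ℕ) : ℚ :=
  lam₁ + ∑ i ∈ Finset.Ico 1 j, ((p i : ℚ) - 1)

variable {E} in
/-- `F` is a normal submodule of rank `j` of `E`. (A `[λ]`-primitive theme of rank `k` has exactly
one for each `j ≤ k`; it is denoted by `F_j`.) -/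
def ABSubmodule.IsNormalOfRank (F : ABSubmodule ℂ E) (j : ℕ) : Prop :=
  F.IsNormal ∧ Module.finrank ℂ⟦X⟧ F.toSubmodule = j

/-- `λ_1, p_1, …, p_{k-1}` are the fundamental invariants of the rank `k` `[λ]`-primitive theme
`E`: with the normal submodules `0 = F_0 ⊆ F_1 ⊆ ⋯ ⊆ F_k = E`, `F_j` of rank `j`, the
quotient `F_j / F_{j-1}` is isomorphic to `E_{λ_j}`. -/
def HasInvariants (k : ℕ) (lam₁ : ℚ) (p : ℕ → ℕ) : Prop :=
  ∃ F : ℕ → ABSubmodule ℂ E, (∀ j ≤ k, (F j).IsNormalOfRank j) ∧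
    (F k).toSubmodule = ⊤ ∧
    ∀ j < k, (F j).toSubmodule ≤ (F (j + 1)).toSubmodule ∧
      ABIso ℂ ((F (j + 1)).toSubmodule ⧸ ((F j).inside (F (j + 1))).toSubmodule)
        (ELam (lamInv lam₁ p (j + 1)))

/-- `α ∈ ℂ^*` is the parameter of `E` (for the fundamental invariants `lam₁` and `p ≥ 1`), i.e.
`E` is isomorphic to `𝒜 / 𝒜 P` with `P = (a - λ₁ b) (1 + α b^p)⁻¹ (a - (λ₁ + p - 1) b)` (where `𝒜`
is the `b`-completion of `ℂ⟨a, b⟩ / (a b - b a - b²)`): `E` is free of rank two over `ℂ[[b]]`, as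
`𝒜 / 𝒜 P` is, and has a generator `e` which is annihilated by `P`. -/
def IsParameter (lam₁ : ℚ) (p : ℕ) (α : ℂ) : Prop :=
  α ≠ 0 ∧ Module.Free ℂ⟦X⟧ E ∧ Module.finrank ℂ⟦X⟧ E = 2 ∧
    ∃ e : E, (ABSubmodule.gen (R := ℂ) e).toSubmodule = ⊤ ∧
      ∃ e₁ : E, e₁ = (1 + C α * X ^ p : ℂ⟦X⟧)⁻¹ •
          (aOp ℂ e - (C ((lam₁ + p - 1 : ℚ) : ℂ) * X : ℂ⟦X⟧) • e) ∧
        aOp ℂ e₁ - (C (lam₁ : ℂ) * X : ℂ⟦X⟧) • e₁ = 0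

end Themes

/-! ### Sheaves of `𝒪_X`-(a,b)-modules and their fibres -/

section Sheaves

/-- A sheaf of `𝒪_X`-(a,b)-modules: a sheaf of `𝒪_X[[b]]`-modules with an operator `a`, which is
locally free of finite type over `𝒪_X[[b]]`. -/
structure ABSheaf (X : Type u) [TopologicalSpace X] [ReducedComplexSpace X] where
  /-- the sections over an open set -/
  sec : Opens X → Type v
  [grp : ∀ U, AddCommGroup (sec U)]
  [mod : ∀ U, Module (HolFun U)⟦X⟧ (sec U)]
  [ab : ∀ U, ABAction (HolFun U) (sec U)]
  /-- the restriction maps -/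
  res : ∀ {U V : Opens X}, V ≤ U → sec U →+ sec V
  res_smul : ∀ {U V : Opens X} (h : V ≤ U) (S : (HolFun U)⟦X⟧) (s : sec U),
    res h (S • s) = PowerSeries.map (HolFun.res h).toRingHom S • res h s
  res_a : ∀ {U V : Opens X} (h : V ≤ U) (s : sec U),
    res h (aOp (HolFun U) s) = aOp (HolFun V) (res h s)
  res_self : ∀ {U : Opens X} (s : sec U), res le_rfl s = s
  res_res : ∀ {U V W : Opens X} (h : V ≤ U) (h' : W ≤ V) (s : sec U),
    res h' (res h s) = res (h'.trans h) s
  eq_zero_of_local : ∀ {U : Opens X} (s : sec U),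
    (∀ x ∈ U, ∃ (V : Opens X) (h : V ≤ U), x ∈ V ∧ res h s = 0) → s = 0
  glue : ∀ {ι : Type u} (U : ι → Opens X) (s : ∀ i, sec (U i)),
    (∀ i j, res (inf_le_left : U i ⊓ U j ≤ U i) (s i) = res inf_le_right (s j)) →
      ∃ t : sec (iSup U), ∀ i, res (le_iSup U i) t = s i
  locally_free : ∀ x : X, ∃ U : Opens X, x ∈ U ∧ ∃ (n : ℕ) (e : Fin n → sec U),
    ∀ (V : Opens X) (h : V ≤ U) (s : sec V),
      ∃! c : Fin n → (HolFun V)⟦X⟧, s = ∑ i, c i • res h (e i)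

attribute [instance] ABSheaf.grp ABSheaf.mod ABSheaf.ab

variable {X : Type u} [TopologicalSpace X] [ReducedComplexSpace X]

namespace ABSheaf

variable (E : ABSheaf.{u, v} X)

/-- The constants `ℂ[[b]] → 𝒪_X(U)[[b]]`. -/
def constSeries (U : Opens X) : ℂ⟦X⟧ →+* (HolFun U)⟦X⟧ :=
  PowerSeries.map (algebraMap ℂ (HolFun U))

instance modC (U : Opens X) : Module ℂ⟦X⟧ (E.sec U) := Module.compHom _ (constSeries U)

theorem modC_smul {U : Opens X} (S : ℂ⟦X⟧) (s : E.sec U) : S • s = constSeries U S • s := rfl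

/-- Restriction, as a `ℂ[[b]]`-linear map. -/
def resC {U V : Opens X} (h : V ≤ U) : E.sec U →ₗ[ℂ⟦X⟧] E.sec V where
  toFun := E.res h
  map_add' := map_add _
  map_smul' S s := by
    rw [modC_smul, modC_smul, E.res_smul, RingHom.id_apply]
    congr 1

/-- The open neighbourhoods of `x`, ordered by reverse inclusion. -/
@[ext]
structure Nhd (x : X) where
  U : Opens X
  mem : x ∈ U

instance (x : X) : Preorder (Nhd x) where
  le A B := B.U ≤ A.U
  le_refl A := le_refl A.U
  le_trans _ _ _ h h' := le_trans h' h

instance (x : X) : IsDirectedOrder (Nhd x) :=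
  ⟨fun A B => ⟨⟨A.U ⊓ B.U, A.mem, B.mem⟩, (inf_le_left : A.U ⊓ B.U ≤ A.U),
    (inf_le_right : A.U ⊓ B.U ≤ B.U)⟩⟩

instance (x : X) : Nonempty (Nhd x) := ⟨⟨⊤, trivial⟩⟩

/-- The sections over a neighbourhood of `x`. -/
abbrev nhdSec (x : X) (A : Nhd x) : Type v := E.sec A.U

/-- The transition maps between sections over neighbourhoods of `x`. -/
abbrev nhdRes (x : X) (A B : Nhd x) (h : A ≤ B) : E.nhdSec x A →ₗ[ℂ⟦X⟧] E.nhdSec x B :=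
  E.resC (show B.U ≤ A.U from h)

instance (x : X) : DirectedSystem (E.nhdSec x) (E.nhdRes x · · ·) where
  map_self _ s := E.res_self s
  map_map _ _ _ _ _ s := E.res_res _ _ s

/-- The stalk of `E` at `x`. -/
abbrev Stalk (x : X) : Type (max u v) := DirectLimit (E.nhdSec x) (E.nhdRes x)

/-- The germ at `x` of a section. -/
def germ {x : X} {U : Opens X} (hx : x ∈ U) (s : E.sec U) : E.Stalk x :=
  Quotient.mk _ ⟨⟨U, hx⟩, s⟩

theorem exists_germ {x : X} (z : E.Stalk x) :
    ∃ (U : Opens X) (hx : x ∈ U) (s : E.sec U), z = E.germ hx s := by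
  obtain ⟨i, s, rfl⟩ := DirectLimit.exists_eq_mk _ z
  exact ⟨i.U, i.mem, s, rfl⟩

theorem germ_add {x : X} {U : Opens X} (hx : x ∈ U) (s t : E.sec U) :
    E.germ hx (s + t) = E.germ hx s + E.germ hx t := by
  have h := DirectLimit.add_def (G := E.nhdSec x) (f := E.nhdRes x) (⟨U, hx⟩ : Nhd x) s t
  exact h.symm

theorem germ_smul {x : X} {U : Opens X} (hx : x ∈ U) (S : ℂ⟦X⟧) (s : E.sec U) :
    E.germ hx (S • s) = S • E.germ hx s := rfl

theorem constSeries_derivative (U : Opens X) (S : ℂ⟦X⟧) :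
    constSeries U ((PowerSeries.X : ℂ⟦X⟧) ^ 2 * derivative ℂ S) =
      (PowerSeries.X : (HolFun U)⟦X⟧) ^ 2 * derivative (HolFun U) (constSeries U S) := by
  have hX : constSeries U (PowerSeries.X : ℂ⟦X⟧) = PowerSeries.X := PowerSeries.map_X _
  have hd : constSeries U (derivative ℂ S) = derivative (HolFun U) (constSeries U S) := by
    refine PowerSeries.ext fun n => ?_
    rw [constSeries, coeff_map, coeff_derivative, coeff_derivative, coeff_map, map_mul, map_add,
      map_natCast, map_one]
  rw [map_mul, map_pow, hX, hd]

theorem aOp_const_smul {U : Opens X} (S : ℂ⟦X⟧) (s : E.sec U) :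
    aOp (HolFun U) (S • s) =
      S • aOp (HolFun U) s + ((PowerSeries.X : ℂ⟦X⟧) ^ 2 * derivative ℂ S) • s := by
  rw [modC_smul, aOp_smul, modC_smul, modC_smul, constSeries_derivative]

/-- The operator `a` on the stalk: `a` of a germ is the germ of `a`. -/
def stalkA (x : X) : E.Stalk x → E.Stalk x :=
  DirectLimit.map (E.nhdRes x) (E.nhdRes x) (fun A => aOp (HolFun A.U))
    (fun _ _ _ s => E.res_a _ s)

theorem stalkA_germ {x : X} {U : Opens X} (hx : x ∈ U) (s : E.sec U) :
    E.stalkA x (E.germ hx s) = E.germ hx (aOp (HolFun U) s) := rfl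

theorem exists_germ₂ {x : X} (z z' : E.Stalk x) :
    ∃ (U : Opens X) (hx : x ∈ U) (s s' : E.sec U), z = E.germ hx s ∧ z' = E.germ hx s' := by
  obtain ⟨i, s, s', rfl, rfl⟩ := DirectLimit.exists_eq_mk₂ _ z z'
  exact ⟨i.U, i.mem, s, s', rfl, rfl⟩

theorem stalkA_add {x : X} (z z' : E.Stalk x) :
    E.stalkA x (z + z') = E.stalkA x z + E.stalkA x z' := by
  obtain ⟨U, hx, s, s', rfl, rfl⟩ := E.exists_germ₂ z z'
  rw [← germ_add, stalkA_germ, stalkA_germ, stalkA_germ, map_add, germ_add]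

theorem stalkA_smul {x : X} (S : ℂ⟦X⟧) (z : E.Stalk x) :
    E.stalkA x (S • z) =
      S • E.stalkA x z + ((PowerSeries.X : ℂ⟦X⟧) ^ 2 * derivative ℂ S) • z := by
  obtain ⟨U, hx, s, rfl⟩ := E.exists_germ z
  rw [← germ_smul, stalkA_germ, stalkA_germ, aOp_const_smul, germ_add, germ_smul, germ_smul]

instance stalkAB (x : X) : ABAction ℂ (E.Stalk x) where
  a := AddMonoidHom.mk' (E.stalkA x) E.stalkA_add
  a_smul S z := E.stalkA_smul S z

theorem aOp_germ {x : X} {U : Opens X} (hx : x ∈ U) (s : E.sec U) :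
    aOp ℂ (E.germ hx s) = E.germ hx (aOp (HolFun U) s) := rfl

/-- The submodule `ℳ_x[[b]] E` of the stalk of `E` at `x`, generated by the products `S s` where
all coefficients of the power series `S` vanish at `x`. -/
def maxIdealMul (x : X) : ABSubmodule ℂ (E.Stalk x) where
  toSubmodule := Submodule.span ℂ⟦X⟧ {z | ∃ (U : Opens X) (hx : x ∈ U) (S : (HolFun U)⟦X⟧)
    (s : E.sec U), (∀ n, HolFun.eval hx (coeff n S) = 0) ∧ z = E.germ hx (S • s)}
  a_mem := by
    intro z hz
    change z ∈ Submodule.span ℂ⟦X⟧ _ at hz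
    change aOp ℂ z ∈ Submodule.span ℂ⟦X⟧ _
    induction hz using Submodule.span_induction with
    | mem z hz =>
      obtain ⟨U, hx, S, s, hS, rfl⟩ := hz
      rw [aOp_germ, aOp_smul, germ_add]
      refine Submodule.add_mem _ (Submodule.subset_span ⟨U, hx, S, _, hS, rfl⟩)
        (Submodule.subset_span ⟨U, hx, _, s, fun n => ?_, rfl⟩)
      rw [coeff_X_pow_mul']
      split_ifs
      · rw [coeff_derivative, map_mul, hS, zero_mul]
      · exact map_zero _
    | zero => rw [map_zero]; exact Submodule.zero_mem _
    | add y z _ _ hy hz => rw [map_add]; exact Submodule.add_mem _ hy hz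
    | smul S y hy0 hy =>
      rw [aOp_smul]
      exact Submodule.add_mem _ (Submodule.smul_mem _ _ hy) (Submodule.smul_mem _ _ hy0)

/-- The fibre `E(x) = E / ℳ_x[[b]] E`. -/
abbrev Fibre (x : X) : Type (max u v) := E.Stalk x ⧸ (E.maxIdealMul x).toSubmodule

/-- The value at `x` of a section. -/
def value {x : X} {U : Opens X} (hx : x ∈ U) (s : E.sec U) : E.Fibre x :=
  Submodule.Quotient.mk (E.germ hx s)

/-- An `𝒪_X`-(a,b)-submodule of `E`: a subsheaf of `𝒪_X[[b]]`-submodules which is stable by `a`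
and locally free of finite type. -/
structure Sub where
  carrier : ∀ U : Opens X, ABSubmodule (HolFun U) (E.sec U)
  res_mem : ∀ {U V : Opens X} (h : V ≤ U) (s : E.sec U), s ∈ (carrier U).toSubmodule →
    E.res h s ∈ (carrier V).toSubmodule
  mem_of_local : ∀ {U : Opens X} (s : E.sec U),
    (∀ x ∈ U, ∃ (V : Opens X) (h : V ≤ U), x ∈ V ∧ E.res h s ∈ (carrier V).toSubmodule) →
      s ∈ (carrier U).toSubmodule
  locally_free : ∀ x : X, ∃ U : Opens X, x ∈ U ∧
    ∃ (n : ℕ) (e : Fin n → (carrier U).toSubmodule),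
      ∀ (V : Opens X) (h : V ≤ U), ∀ s ∈ (carrier V).toSubmodule,
        ∃! c : Fin n → (HolFun V)⟦X⟧, s = ∑ i, c i • E.res h (e i)

variable {E}

/-- An `𝒪_X`-(a,b)-submodule, as a sheaf of `𝒪_X`-(a,b)-modules. -/
def Sub.toABSheaf (F : E.Sub) : ABSheaf.{u, v} X where
  sec U := (F.carrier U).toSubmodule
  res {U V} h :=
    { toFun := fun s => ⟨E.res h s.1, F.res_mem h s.1 s.2⟩
      map_zero' := Subtype.ext (map_zero (E.res h))
      map_add' := fun _ _ => Subtype.ext (map_add (E.res h) _ _) }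
  res_smul h S s := Subtype.ext (E.res_smul h S s.1)
  res_a h s := Subtype.ext (E.res_a h s.1)
  res_self s := Subtype.ext (E.res_self s.1)
  res_res h h' s := Subtype.ext (E.res_res h h' s.1)
  eq_zero_of_local s hs := Subtype.ext <| E.eq_zero_of_local s.1 fun x hx => by
    obtain ⟨V, h, hxV, hV⟩ := hs x hx
    exact ⟨V, h, hxV, congrArg Subtype.val hV⟩
  glue U s hs := by
    obtain ⟨t, ht⟩ := E.glue U (fun i => (s i).1) fun i j => congrArg Subtype.val (hs i j)
    refine ⟨⟨t, F.mem_of_local t fun x hx => ?_⟩, fun i => Subtype.ext (ht i)⟩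
    obtain ⟨i, hi⟩ := Opens.mem_iSup.1 hx
    exact ⟨U i, le_iSup U i, hi, by rw [ht i]; exact (s i).2⟩
  locally_free x := by
    obtain ⟨U, hx, n, e, he⟩ := F.locally_free x
    refine ⟨U, hx, n, e, fun V h s => ?_⟩
    obtain ⟨c, hc, huniq⟩ := he V h s.1 s.2
    have key : ∀ c : Fin n → (HolFun V)⟦X⟧,
        ((∑ i, c i • (⟨E.res h (e i).1, F.res_mem h _ (e i).2⟩ : (F.carrier V).toSubmodule) :
          (F.carrier V).toSubmodule) : E.sec V) = ∑ i, c i • E.res h (e i).1 := by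
      intro c
      simp
    exact ⟨c, Subtype.ext (hc.trans (key c).symm),
      fun c' hc' => huniq c' ((congrArg Subtype.val hc').trans (key c'))⟩

/-- The submodule sheaf `F` of `E` takes the value `G ⊆ E(x)` at `x`: the natural map
`F(x) → E(x)` is injective and its image is `G`. -/
def Sub.TakesValue (F : E.Sub) (x : X) (G : ABSubmodule ℂ (E.Fibre x)) : Prop :=
  (∀ (U : Opens X) (hx : x ∈ U) (s : F.toABSheaf.sec U),
    E.value hx s.1 = 0 → F.toABSheaf.value hx s = 0) ∧
  ∀ z : E.Fibre x, z ∈ G.toSubmodule ↔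
    ∃ (U : Opens X) (hx : x ∈ U) (s : F.toABSheaf.sec U), E.value hx s.1 = z

end ABSheaf

/-! ### Thematic maps and holomorphic families -/

variable {Λ : Finset ℚ} {N : ℕ}

/-- Restriction of holomorphic maps with values in `Ξ_Λ^(N)`, i.e. of sections of the sheaf
`Ξ_{X,Λ}^(N)`. -/
def Xi.res {U V : Opens X} (h : V ≤ U) (s : Xi (HolFun U) Λ N) : Xi (HolFun V) Λ N :=
  Xi.map (HolFun.res h) s

theorem Xi.res_add {U V : Opens X} (h : V ≤ U) (s t : Xi (HolFun U) Λ N) :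
    Xi.res h (s + t) = Xi.res h s + Xi.res h t := by
  funext l j
  exact map_add (PowerSeries.map (HolFun.res h).toRingHom) (s l j) (t l j)

theorem Xi.res_zero {U V : Opens X} (h : V ≤ U) :
    Xi.res h (0 : Xi (HolFun U) Λ N) = 0 := by
  funext l j
  exact map_zero (PowerSeries.map (HolFun.res h).toRingHom)

theorem Xi.res_smul {U V : Opens X} (h : V ≤ U) (S : (HolFun U)⟦X⟧) (s : Xi (HolFun U) Λ N) :
    Xi.res h (S • s) = PowerSeries.map (HolFun.res h).toRingHom S • Xi.res h s := by
  funext l j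
  exact map_mul (PowerSeries.map (HolFun.res h).toRingHom) S (s l j)

theorem map_derivative' {R R' : Type*} [CommRing R] [CommRing R'] (f : R →+* R') (S : R⟦X⟧) :
    PowerSeries.map f (derivative R S) = derivative R' (PowerSeries.map f S) := by
  refine PowerSeries.ext fun n => ?_
  rw [coeff_map, coeff_derivative, coeff_derivative, coeff_map, map_mul, map_add,
    map_natCast, map_one]

theorem Xi.res_a {U V : Opens X} (h : V ≤ U) (s : Xi (HolFun U) Λ N) :
    Xi.res h (aOp (HolFun U) s) = aOp (HolFun V) (Xi.res h s) := by
  funext l j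
  change PowerSeries.map (HolFun.res h).toRingHom
      ((PowerSeries.X : (HolFun U)⟦X⟧) ^ 2 * derivative (HolFun U) (s l j)
        + C (algebraMap ℂ (HolFun U) ((l : ℚ) : ℂ)) * PowerSeries.X * s l j
        + (if h : j.1 + 1 < N + 1 then PowerSeries.X * s l ⟨j.1 + 1, h⟩ else 0)) =
    (PowerSeries.X : (HolFun V)⟦X⟧) ^ 2 *
        derivative (HolFun V) (PowerSeries.map (HolFun.res h).toRingHom (s l j))
      + C (algebraMap ℂ (HolFun V) ((l : ℚ) : ℂ)) * PowerSeries.X *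
        PowerSeries.map (HolFun.res h).toRingHom (s l j)
      + (if h' : j.1 + 1 < N + 1 then
          PowerSeries.X * PowerSeries.map (HolFun.res h).toRingHom (s l ⟨j.1 + 1, h'⟩) else 0)
  rw [map_add, map_add, map_mul, map_mul, map_mul, map_pow, map_X, map_C, map_derivative']
  congr 1
  split_ifs
  · rw [map_mul, map_X]
  · exact map_zero _

theorem Xi.res_gen {U V : Opens X} (h : V ≤ U) (φ s : Xi (HolFun U) Λ N)
    (hs : s ∈ (ABSubmodule.gen (R := HolFun U) φ).toSubmodule) :
    Xi.res h s ∈ (ABSubmodule.gen (R := HolFun V) (Xi.res h φ)).toSubmodule := by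
  change s ∈ Submodule.span (HolFun U)⟦X⟧ _ at hs
  change Xi.res h s ∈ Submodule.span (HolFun V)⟦X⟧ _
  induction hs using Submodule.span_induction with
  | mem s hs =>
    obtain ⟨n, rfl⟩ := hs
    refine Submodule.subset_span ⟨n, ?_⟩
    have hcomm : Function.Semiconj (Xi.res (Λ := Λ) (N := N) h)
        (aOp (HolFun U)) (aOp (HolFun V)) := Xi.res_a h
    exact ((hcomm.iterate_right n) φ).symm
  | zero => rw [Xi.res_zero]; exact Submodule.zero_mem _
  | add s t _ _ hs ht => rw [Xi.res_add]; exact Submodule.add_mem _ hs ht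
  | smul S s _ hs => rw [Xi.res_smul]; exact Submodule.smul_mem _ _ hs

theorem Xi.res_res {U V W : Opens X} (h : V ≤ U) (h' : W ≤ V) (s : Xi (HolFun U) Λ N) :
    Xi.res h' (Xi.res h s) = Xi.res (h'.trans h) s := by
  funext l j
  change PowerSeries.map _ (PowerSeries.map _ (s l j)) = PowerSeries.map _ (s l j)
  ext n
  simp only [coeff_map]
  rfl

/-- The sections over `V ≤ U` of the sheaf `𝔼_φ`, the sheaf of `𝒪[[b]]`-submodules of `Ξ_Λ^(N)`
generated on `U` by the `a^ν φ`. -/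
def sheafGen {U : Opens X} (φ : Xi (HolFun U) Λ N) {V : Opens X} (hV : V ≤ U) :
    Submodule (HolFun V)⟦X⟧ (Xi (HolFun V) Λ N) where
  carrier := {s | ∀ x ∈ V, ∃ (W : Opens X) (h : W ≤ V), x ∈ W ∧
    Xi.res h s ∈ (ABSubmodule.gen (R := HolFun W) (Xi.res (h.trans hV) φ)).toSubmodule}
  zero_mem' x hx := ⟨V, le_rfl, hx, by rw [Xi.res_zero]; exact Submodule.zero_mem _⟩
  add_mem' {s t} hs ht x hx := by
    obtain ⟨W₁, h₁, hx₁, hs⟩ := hs x hx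
    obtain ⟨W₂, h₂, hx₂, ht⟩ := ht x hx
    refine ⟨W₁ ⊓ W₂, inf_le_left.trans h₁, ⟨hx₁, hx₂⟩, ?_⟩
    rw [Xi.res_add]
    refine Submodule.add_mem _ ?_ ?_
    · have := Xi.res_gen (inf_le_left : W₁ ⊓ W₂ ≤ W₁) _ _ hs
      rwa [Xi.res_res, Xi.res_res] at this
    · have := Xi.res_gen (inf_le_right : W₁ ⊓ W₂ ≤ W₂) _ _ ht
      rwa [Xi.res_res, Xi.res_res] at this
  smul_mem' S s hs x hx := by
    obtain ⟨W, h, hxW, hs⟩ := hs x hx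
    refine ⟨W, h, hxW, ?_⟩
    rw [Xi.res_smul]
    exact Submodule.smul_mem _ _ hs

/-- The holomorphic map `φ : U → Ξ_Λ^(N)` is `k`-thematic: `𝔼_φ` is free over `𝒪[[b]]` with basis
`φ, a φ, …, a^(k-1) φ`. -/
def IsThematic (k : ℕ) {U : Opens X} (φ : Xi (HolFun U) Λ N) : Prop :=
  ∀ (V : Opens X) (hV : V ≤ U),
    LinearIndependent (HolFun V)⟦X⟧ (fun j : Fin k => (aOp (HolFun V))^[j.1] (Xi.res hV φ)) ∧
    Submodule.span (HolFun V)⟦X⟧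
      (Set.range fun j : Fin k => (aOp (HolFun V))^[j.1] (Xi.res hV φ)) = sheafGen φ hV

/-- The restriction of `E` to `U` is isomorphic to `𝔼_φ` as a sheaf of `𝒪_U`-(a,b)-modules. -/
def IsoSheafGen (E : ABSheaf.{u, v} X) {U : Opens X} (φ : Xi (HolFun U) Λ N) : Prop :=
  ∃ θ : ∀ (V : Opens X) (hV : V ≤ U), E.sec V ≃ₗ[(HolFun V)⟦X⟧] sheafGen φ hV,
    (∀ (V : Opens X) (hV : V ≤ U) (s : E.sec V),
      (θ V hV (aOp (HolFun V) s) : Xi (HolFun V) Λ N) = aOp (HolFun V) (θ V hV s).1) ∧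
    ∀ (V W : Opens X) (hV : V ≤ U) (h : W ≤ V) (s : E.sec V),
      (θ W (h.trans hV) (E.res h s) : Xi (HolFun W) Λ N) = Xi.res h (θ V hV s).1

/-- `E` is a holomorphic family of rank `k` themes (`k ≥ 1`). -/
def IsHolomorphicFamily (E : ABSheaf.{u, v} X) (k : ℕ) : Prop :=
  ∀ x : X, ∃ U : Opens X, x ∈ U ∧ ∃ Λ : Finset ℚ, (∀ l ∈ Λ, 0 < l ∧ l ≤ 1) ∧
    ∃ φ : Xi (HolFun U) Λ (k - 1), IsThematic k φ ∧ IsoSheafGen E φ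

/-- The family of the normal submodules `F_j(x) ⊆ E(x)` of rank `j` is holomorphic: there is an
`𝒪_X`-(a,b)-submodule `F` of `E` which is a holomorphic family of rank `j` themes and takes for
every `x` the value `F_j(x)`. -/
def HolomorphicNormalSub (E : ABSheaf.{u, v} X) (j : ℕ) : Prop :=
  ∃ F : E.Sub, IsHolomorphicFamily F.toABSheaf j ∧
    ∀ x : X, ∃ G : ABSubmodule ℂ (E.Fibre x), G.IsNormalOfRank j ∧ F.TakesValue x G

end Sheaves

end

/-!
In a theme with invariants `λ_1, p_1, …, p_{k-1}` and generator `g`, the quotient by the normal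
submodule of rank `k - 1` is `E_{λ_k}` and sends `g` to a unit `w`; with `e_k = w⁻¹ g`, the vector
`(a - λ_k b) e_k` generates that submodule. Iterating gives a basis `e_1, …, e_k` with
`a e_{j+1} = λ_{j+1} b e_{j+1} + S_j e_j`, where `S_j` is a unit and, because the theme is
primitive, its coefficient at `b ^ p_j` is not zero.

Let `g` now be a section which generates the fibres. Then `a^k g = ∑ d_l a^l g` with holomorphic
`d_l`, and with `D = b ^ 2 (d / db) + λ_k b` the unit `w` at each point solves
`D^k w = ∑ d_l D^l w`. Comparing coefficients gives a recursion for `w` whose leading factors are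
not zero, because the `λ_j + j` differ by sums of the nonnegative integers `p_i`. So `w`,
normalised by `w(0) = 1`, depends holomorphically on the point, and so do the whole basis and the
`S_j`. Hence `e_1, …, e_j` span a holomorphic family with the normal submodules of rank `j` as
values, solving `k` differential equations embeds the family into `Ξ`, and the parameter is the
quotient of two coefficients of `S_{k-1}`.
-/

noncomputable section

section Euler

variable {R : Type*} [CommRing R]

/-- The operator `T ↦ b² T' + c b T` of `R[[b]]`, that is the operator `a` of the rank one module
`R[[b]] e` with `a e = c b e`, read on the coordinate along `e`. -/
def euler (c : R) : R⟦X⟧ →ₗ[R] R⟦X⟧ where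
  toFun T := (X : R⟦X⟧) ^ 2 * derivative R T + C c * X * T
  map_add' S T := by rw [map_add]; ring
  map_smul' r T := by
    rw [(derivative R).map_smul, RingHom.id_apply, smul_eq_C_mul, smul_eq_C_mul, smul_eq_C_mul]
    ring

theorem euler_apply (c : R) (T : R⟦X⟧) :
    euler c T = (X : R⟦X⟧) ^ 2 * derivative R T + C c * X * T := rfl

theorem coeff_zero_euler (c : R) (T : R⟦X⟧) : coeff 0 (euler c T) = 0 := by
  simp [euler_apply]

theorem coeff_succ_euler (c : R) (T : R⟦X⟧) (n : ℕ) :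
    coeff (n + 1) (euler c T) = (n + c) * coeff n T := by
  have h : euler c T = X * (X * derivative R T + C c * T) := by rw [euler_apply]; ring
  rw [h, coeff_succ_X_mul, map_add, coeff_C_mul]
  cases n with
  | zero => simp
  | succ n => rw [coeff_succ_X_mul, coeff_derivative]; push_cast; ring

theorem euler_mul (c : R) (S T : R⟦X⟧) :
    euler c (S * T) = S * euler c T + ((X : R⟦X⟧) ^ 2 * derivative R S) * T := by
  simp only [euler_apply]
  rw [Derivation.leibniz, smul_eq_mul, smul_eq_mul]; ring

theorem euler_sub (c d : R) (T : R⟦X⟧) : euler (c - d) T = euler c T - C d * X * T := by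
  simp only [euler_apply, map_sub]; ring

theorem euler_C (c r : R) : euler c (C r) = C (c * r) * X := by
  simp only [euler_apply, derivative_C, map_mul]; ring

theorem euler_X_pow (c : R) (n : ℕ) : euler c (X ^ n) = C (n + c) * X ^ (n + 1) := by
  ext l
  rw [coeff_C_mul]
  cases l with
  | zero => rw [coeff_zero_euler, coeff_X_pow, if_neg (by omega), mul_zero]
  | succ l =>
    rw [coeff_succ_euler, coeff_X_pow, coeff_X_pow]
    by_cases h : l = n
    · rw [if_pos h, if_pos (by omega), h]
    · rw [if_neg h, if_neg (by omega), mul_zero, mul_zero]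

theorem map_euler {R' : Type*} [CommRing R'] (f : R →+* R') (c : R) (T : R⟦X⟧) :
    PowerSeries.map f (euler c T) = euler (f c) (PowerSeries.map f T) := by
  simp only [euler_apply, map_add, map_mul, map_pow, map_X, map_C, map_derivative']

theorem X_pow_dvd_euler (c : R) {n : ℕ} {T : R⟦X⟧} (h : X ^ n ∣ T) : X ^ (n + 1) ∣ euler c T := by
  rw [X_pow_dvd_iff] at h ⊢
  intro m hm
  cases m with
  | zero => exact coeff_zero_euler c T
  | succ m => rw [coeff_succ_euler, h m (by omega), mul_zero]

theorem isUnit_iff_isUnit_coeff_zero {T : R⟦X⟧} : IsUnit T ↔ IsUnit (coeff 0 T) := by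
  rw [PowerSeries.isUnit_iff_constantCoeff, coeff_zero_eq_constantCoeff_apply]

end Euler

/-! ### Flags and cyclic vectors -/

section Flag

variable {A M : Type*} [Ring A] [AddCommGroup M] [Module A M] {e : ℕ → M} {i j k : ℕ} {m : M}

variable (A) in
/-- The submodule spanned by `e 1, …, e j`. Vectors are numbered from `1`, as the normal
submodules `F_j` are; `e 0` plays no role here. -/
def flag (e : ℕ → M) (j : ℕ) : Submodule A M :=
  Submodule.span A (Set.range fun i : Fin j => e (i + 1))

theorem flag_zero : flag A e 0 = ⊥ := by simp [flag]

theorem mem_flag (hi : 1 ≤ i) (hij : i ≤ j) : e i ∈ flag A e j :=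
  Submodule.subset_span ⟨⟨i - 1, by omega⟩, congrArg e (Nat.sub_add_cancel hi)⟩

theorem flag_le_iff {P : Submodule A M} : flag A e j ≤ P ↔ ∀ i, 1 ≤ i → i ≤ j → e i ∈ P := by
  refine ⟨fun h i hi hij => h (mem_flag hi hij), fun h => Submodule.span_le.2 ?_⟩
  rintro _ ⟨i, rfl⟩
  exact h _ (by omega) i.2

theorem flag_mono (h : i ≤ j) : flag A e i ≤ flag A e j :=
  flag_le_iff.2 fun _ hl hli => mem_flag hl (hli.trans h)

theorem mem_flag_iff_exists_sum : m ∈ flag A e j ↔ ∃ c : Fin j → A, ∑ i, c i • e (i + 1) = m :=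
  Submodule.mem_span_range_iff_exists_fun A

theorem mem_flag_succ :
    m ∈ flag A e (j + 1) ↔ ∃ T : A, ∃ v ∈ flag A e j, m = T • e (j + 1) + v := by
  constructor
  · intro h
    obtain ⟨c, rfl⟩ := mem_flag_iff_exists_sum.1 h
    refine ⟨c (Fin.last j), ∑ i : Fin j, c i.castSucc • e (i + 1),
      mem_flag_iff_exists_sum.2 ⟨_, rfl⟩, ?_⟩
    rw [Fin.sum_univ_castSucc, add_comm]
    rfl
  · rintro ⟨T, v, hv, rfl⟩
    exact add_mem (Submodule.smul_mem _ _ (mem_flag (by omega) le_rfl))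
      (flag_mono (Nat.le_succ j) hv)

theorem finrank_flag {A : Type*} [CommRing A] [Nontrivial A] [Module A M]
    (he : LinearIndependent A fun i : Fin k => e (i + 1)) (hj : j ≤ k) :
    Module.finrank A (flag A e j) = j := by
  have := finrank_span_eq_card (he.comp _ (Fin.castLE_injective hj))
  rwa [Fintype.card_fin] at this

theorem eq_zero_of_smul_mem_flag (he : LinearIndependent A fun i : Fin k => e (i + 1))
    (hj : j < k) {T : A} (hT : T • e (j + 1) ∈ flag A e j) : T = 0 := by
  refine he.eq_zero_of_smul_mem_span ⟨j, hj⟩ T (Submodule.span_mono ?_ hT)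
  rintro _ ⟨i, rfl⟩
  exact ⟨⟨i, i.2.trans hj⟩, ⟨trivial, fun h => i.2.ne (congrArg Fin.val h)⟩, rfl⟩

end Flag

theorem linearIndependent_of_span_eq {A M ι : Type*} [CommRing A] [AddCommGroup M] [Module A M]
    [Finite ι] {f g : ι → M} (hf : LinearIndependent A f)
    (h : Submodule.span A (Set.range g) = Submodule.span A (Set.range f)) :
    LinearIndependent A g := by
  have := Fintype.ofFinite ι
  rcases subsingleton_or_nontrivial A with _ | _
  · exact Function.injective_of_subsingleton _
  rw [linearIndependent_iff_card_eq_finrank_span, Set.finrank, h]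
  exact (finrank_span_eq_card hf).symm

section Orbit

variable {R : Type*} [CommRing R] {M : Type*} [AddCommGroup M] [Module R⟦X⟧ M] [ABAction R M]
  {P : Submodule R⟦X⟧ M} {m u : M} {n l : ℕ}

theorem aOp_smul_of_eq {c : R} (h : aOp R m = (C c * X : R⟦X⟧) • m + u) (T : R⟦X⟧) :
    aOp R (T • m) = euler c T • m + T • u := by
  rw [aOp_smul, h, smul_add, smul_smul, add_right_comm, ← add_smul, euler_apply]
  congr 2
  ring

theorem ABSubmodule.self_mem_gen (u : M) : u ∈ (ABSubmodule.gen (R := R) u).toSubmodule :=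
  Submodule.subset_span ⟨0, rfl⟩

theorem ABSubmodule.gen_le (hP : ∀ m ∈ P, aOp R m ∈ P) (hu : u ∈ P) :
    (ABSubmodule.gen (R := R) u).toSubmodule ≤ P := by
  refine Submodule.span_le.2 ?_
  rintro _ ⟨l, rfl⟩
  have h : Set.MapsTo (aOp R) (P : Set M) P := fun m hm => hP m hm
  exact h.iterate l hu

theorem ABSubmodule.map_gen {M' : Type*} [AddCommGroup M'] [Module R⟦X⟧ M'] [ABAction R M']
    {f : M →ₗ[R⟦X⟧] M'} (hf : ∀ m, f (aOp R m) = aOp R (f m)) (u : M) :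
    (ABSubmodule.gen (R := R) u).toSubmodule.map f =
      (ABSubmodule.gen (R := R) (f u)).toSubmodule := by
  have h : Function.Semiconj f (aOp R) (aOp R) := hf
  refine (Submodule.map_span _ _).trans (congrArg (Submodule.span R⟦X⟧) ?_)
  rw [← Set.range_comp]
  exact congrArg Set.range (funext fun n => h.iterate_right n u)

theorem aOp_mem_of_mem_span {s : Set M} (hs : s ⊆ P) (ha : ∀ m ∈ s, aOp R m ∈ P)
    (hm : m ∈ Submodule.span R⟦X⟧ s) : aOp R m ∈ P := by
  induction hm using Submodule.span_induction with
  | mem m hm => exact ha m hm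
  | zero => rw [map_zero]; exact P.zero_mem
  | add x y _ _ hx hy => rw [map_add]; exact P.add_mem hx hy
  | smul T x hxs hx =>
    rw [aOp_smul]
    exact P.add_mem (P.smul_mem _ hx) (P.smul_mem _ (Submodule.span_le.2 hs hxs))

variable (R) in
/-- The submodule spanned by `u, a u, …, a^(n-1) u`. -/
def orbitSpan (u : M) (n : ℕ) : Submodule R⟦X⟧ M :=
  Submodule.span R⟦X⟧ (Set.range fun i : Fin n => (aOp R)^[i] u)

theorem iterate_mem_orbitSpan (h : l < n) : (aOp R)^[l] u ∈ orbitSpan R u n :=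
  Submodule.subset_span ⟨⟨l, h⟩, rfl⟩

theorem orbitSpan_le_iff : orbitSpan R u n ≤ P ↔ ∀ l < n, (aOp R)^[l] u ∈ P := by
  refine ⟨fun h l hl => h (iterate_mem_orbitSpan hl), fun h => Submodule.span_le.2 ?_⟩
  rintro _ ⟨i, rfl⟩
  exact h i i.2

theorem orbitSpan_mono (h : l ≤ n) : orbitSpan R u l ≤ orbitSpan R u n :=
  orbitSpan_le_iff.2 fun _ hi => iterate_mem_orbitSpan (hi.trans_le h)

theorem aOp_mem_orbitSpan_succ (hm : m ∈ orbitSpan R u n) : aOp R m ∈ orbitSpan R u (n + 1) := by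
  refine aOp_mem_of_mem_span ?_ ?_ hm
  · rintro _ ⟨i, rfl⟩
    exact iterate_mem_orbitSpan (by omega)
  · rintro _ ⟨i, rfl⟩
    rw [← Function.iterate_succ_apply' (aOp R)]
    exact iterate_mem_orbitSpan (by omega)

theorem orbitSpan_le_gen : orbitSpan R u n ≤ (ABSubmodule.gen (R := R) u).toSubmodule :=
  orbitSpan_le_iff.2 fun l _ => Submodule.subset_span ⟨l, rfl⟩

theorem aOp_mem_orbitSpan (ha : (aOp R)^[n] u ∈ orbitSpan R u n) (hm : m ∈ orbitSpan R u n) :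
    aOp R m ∈ orbitSpan R u n := by
  refine aOp_mem_of_mem_span Submodule.subset_span ?_ hm
  rintro _ ⟨i, rfl⟩
  rw [← Function.iterate_succ_apply' (aOp R)]
  rcases Nat.lt_or_eq_of_le (Nat.succ_le_of_lt i.2) with hi | hi
  · exact iterate_mem_orbitSpan hi
  · rwa [hi]

theorem exists_iterate_sub_smul_mem_orbitSpan {c : R⟦X⟧} {e : M} (h : aOp R e = c • e + u)
    (T : R⟦X⟧) (l : ℕ) : ∃ s : R⟦X⟧, (aOp R)^[l] (T • e) - s • e ∈ orbitSpan R u l := by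
  induction l with
  | zero => exact ⟨T, by rw [Function.iterate_zero_apply, sub_self]; exact zero_mem _⟩
  | succ l ih =>
    obtain ⟨s, hs⟩ := ih
    set v := (aOp R)^[l] (T • e) - s • e with hv
    refine ⟨s * c + X ^ 2 * derivative R s, ?_⟩
    have heq : (aOp R)^[l + 1] (T • e) - (s * c + X ^ 2 * derivative R s) • e =
        aOp R v + s • u := by
      rw [hv, map_sub, Function.iterate_succ_apply', aOp_smul, h, smul_add, add_smul, mul_smul]
      abel
    rw [heq]
    exact add_mem (aOp_mem_orbitSpan_succ hs)
      (Submodule.smul_mem _ _ (iterate_mem_orbitSpan (l := 0) l.succ_pos))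

end Orbit

section Frames

variable {R : Type*} [CommRing R] [Algebra ℂ R]
  {M : Type*} [AddCommGroup M] [Module R⟦X⟧ M] [ABAction R M]

/-- The vectors `e 1, …, e k` satisfy `a e_{j+1} = λ_{j+1} b e_{j+1} + S_j e_j`: they are adapted
to a flag of submodules with successive quotients `E_{λ_j}`. The convention `e 0 = 0` makes the
case `j = 0` say `a e_1 = λ_1 b e_1`. -/
structure IsFrame (lam : ℕ → ℂ) (S : ℕ → R⟦X⟧) (k : ℕ) (e : ℕ → M) : Prop where
  zero : e 0 = 0
  step : ∀ i < k, aOp R (e (i + 1)) =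
    (C (algebraMap ℂ R (lam (i + 1))) * X : R⟦X⟧) • e (i + 1) + S i • e i

variable {lam : ℕ → ℂ} {S : ℕ → R⟦X⟧} {k : ℕ} {e : ℕ → M}

theorem IsFrame.mono (h : IsFrame lam S k e) {j : ℕ} (hj : j ≤ k) : IsFrame lam S j e :=
  ⟨h.zero, fun i hi => h.step i (hi.trans_le hj)⟩

theorem IsFrame.update (h : IsFrame lam S k e) {w : R⟦X⟧} {f : M}
    (ha : aOp R f = (C (algebraMap ℂ R (lam (k + 1))) * X : R⟦X⟧) • f + w • e k) :
    IsFrame lam (Function.update S k w) (k + 1) (Function.update e (k + 1) f) where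
  zero := by rw [Function.update_of_ne (by omega), h.zero]
  step i hi := by
    rcases Nat.lt_succ_iff_lt_or_eq.1 hi with hi | rfl
    · rw [Function.update_of_ne (by omega), Function.update_of_ne (by omega),
        Function.update_of_ne (by omega)]
      exact h.step i hi
    · rw [Function.update_self, Function.update_self, Function.update_of_ne (by omega)]
      exact ha

theorem IsFrame.aOp_smul (h : IsFrame lam S k e) {i : ℕ} (hi : i < k) (T : R⟦X⟧) :
    aOp R (T • e (i + 1)) =
      euler (algebraMap ℂ R (lam (i + 1))) T • e (i + 1) + (T * S i) • e i := by
  rw [aOp_smul_of_eq (h.step i hi), smul_smul]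

theorem IsFrame.aOp_mem_flag (h : IsFrame lam S k e) {m : M} (hm : m ∈ flag R⟦X⟧ e k) :
    aOp R m ∈ flag R⟦X⟧ e k := by
  refine aOp_mem_of_mem_span Submodule.subset_span ?_ hm
  rintro _ ⟨i, rfl⟩
  rw [h.step i i.2]
  have hei : e i ∈ flag R⟦X⟧ e k := by
    rcases Nat.eq_zero_or_pos i with hi | hi
    · rw [hi, h.zero]; exact zero_mem _
    · exact mem_flag hi i.2.le
  exact add_mem (Submodule.smul_mem _ _ (mem_flag (by omega) i.2)) (Submodule.smul_mem _ _ hei)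

theorem IsFrame.exists_smul_sub_mem_orbitSpan (h : IsFrame lam S k e)
    (hS : ∀ i, 1 ≤ i → i < k → IsUnit (S i)) {w : R⟦X⟧} (hw : IsUnit w) {i l : ℕ} (hi : 1 ≤ i)
    (hil : i + l = k) :
    ∃ s : R⟦X⟧, IsUnit s ∧ s • e i - (aOp R)^[l] (w • e k) ∈ orbitSpan R (w • e k) l := by
  induction l generalizing i with
  | zero => exact ⟨w, hw, by rw [← hil]; simp⟩
  | succ l ih =>
    obtain ⟨s, hs, hv⟩ := ih (i := i + 1) (by omega) (by omega)
    set u := w • e k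
    set v := s • e (i + 1) - (aOp R)^[l] u with hv_def
    have hse : s • e (i + 1) ∈ orbitSpan R u (l + 1) := by
      rw [← sub_add_cancel (s • e (i + 1)) ((aOp R)^[l] u)]
      exact add_mem (orbitSpan_mono (Nat.le_succ l) hv) (iterate_mem_orbitSpan (Nat.lt_succ_self l))
    have he : e (i + 1) ∈ orbitSpan R u (l + 1) := by
      obtain ⟨s, rfl⟩ := hs
      simpa [smul_smul] using Submodule.smul_mem _ ↑s⁻¹ hse
    refine ⟨s * S i, hs.mul (hS i hi (by omega)), ?_⟩
    have hav : (s * S i) • e i - (aOp R)^[l + 1] u =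
        aOp R v - euler (algebraMap ℂ R (lam (i + 1))) s • e (i + 1) := by
      rw [hv_def, map_sub, h.aOp_smul (by omega), Function.iterate_succ_apply']
      abel
    rw [hav]
    exact sub_mem (aOp_mem_orbitSpan_succ hv) (Submodule.smul_mem _ _ he)

theorem IsFrame.mem_orbitSpan (h : IsFrame lam S k e) (hS : ∀ i, 1 ≤ i → i < k → IsUnit (S i))
    {w : R⟦X⟧} (hw : IsUnit w) {i l : ℕ} (hi : 1 ≤ i) (hik : i ≤ k) (hl : k < i + l) :
    e i ∈ orbitSpan R (w • e k) l := by
  obtain ⟨_, ⟨s, rfl⟩, hs⟩ := h.exists_smul_sub_mem_orbitSpan hS hw hi (Nat.add_sub_cancel' hik)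
  have hse : s • e i ∈ orbitSpan R (w • e k) l := by
    rw [Units.smul_def, ← sub_add_cancel ((s : R⟦X⟧) • e i) ((aOp R)^[k - i] (w • e k))]
    exact add_mem (orbitSpan_mono (by omega) hs) (iterate_mem_orbitSpan (by omega))
  simpa [Units.smul_def, smul_smul] using Submodule.smul_mem _ ↑s⁻¹ hse

theorem IsFrame.gen_le_flag (h : IsFrame lam S k e) (w : R⟦X⟧) :
    (ABSubmodule.gen (R := R) (w • e k)).toSubmodule ≤ flag R⟦X⟧ e k := by
  refine ABSubmodule.gen_le (fun m hm => h.aOp_mem_flag hm) (Submodule.smul_mem _ _ ?_)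
  rcases Nat.eq_zero_or_pos k with hk | hk
  · rw [hk, h.zero]; exact zero_mem _
  · exact mem_flag hk le_rfl

theorem IsFrame.orbitSpan_eq_flag (h : IsFrame lam S k e)
    (hS : ∀ i, 1 ≤ i → i < k → IsUnit (S i)) {w : R⟦X⟧} (hw : IsUnit w) :
    orbitSpan R (w • e k) k = flag R⟦X⟧ e k :=
  le_antisymm (orbitSpan_le_gen.trans (h.gen_le_flag w))
    (flag_le_iff.2 fun _ hi hik => h.mem_orbitSpan hS hw hi hik (by omega))

theorem IsFrame.gen_eq_flag (h : IsFrame lam S k e)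
    (hS : ∀ i, 1 ≤ i → i < k → IsUnit (S i)) {w : R⟦X⟧} (hw : IsUnit w) :
    (ABSubmodule.gen (R := R) (w • e k)).toSubmodule = flag R⟦X⟧ e k :=
  le_antisymm (h.gen_le_flag w) ((h.orbitSpan_eq_flag hS hw).symm.le.trans orbitSpan_le_gen)

theorem IsFrame.linearIndependent_iterate (h : IsFrame lam S k e)
    (hS : ∀ i, 1 ≤ i → i < k → IsUnit (S i)) {w : R⟦X⟧} (hw : IsUnit w)
    (he : LinearIndependent R⟦X⟧ fun i : Fin k => e (i + 1)) :
    LinearIndependent R⟦X⟧ fun i : Fin k => (aOp R)^[i] (w • e k) :=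
  linearIndependent_of_span_eq he (h.orbitSpan_eq_flag hS hw)

theorem IsFrame.map {R' M' : Type*} [CommRing R'] [Algebra ℂ R'] [AddCommGroup M']
    [Module R'⟦X⟧ M'] [ABAction R' M'] (h : IsFrame lam S k e) (f : R →ₐ[ℂ] R') (g : M →+ M')
    (hg : ∀ (T : R⟦X⟧) m, g (T • m) = PowerSeries.map f.toRingHom T • g m)
    (ha : ∀ m, g (aOp R m) = aOp R' (g m)) :
    IsFrame lam (fun i => PowerSeries.map f.toRingHom (S i)) k fun i => g (e i) where
  zero := by rw [h.zero, map_zero]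
  step i hi := by
    have hf : f.toRingHom (algebraMap ℂ R (lam (i + 1))) = algebraMap ℂ R' (lam (i + 1)) :=
      f.commutes _
    rw [← ha, h.step i hi, map_add, hg, hg, map_mul, map_X, map_C, hf]

theorem IsFrame.map_aOp {M' : Type*} [AddCommGroup M'] [Module R⟦X⟧ M'] [ABAction R M']
    {v : ℕ → M'} (h : IsFrame lam S k e) (hv : IsFrame lam S k v) (htop : flag R⟦X⟧ e k = ⊤)
    (θ : M →ₗ[R⟦X⟧] M') (hθ : ∀ i < k, θ (e (i + 1)) = v (i + 1)) (m : M) :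
    θ (aOp R m) = aOp R (θ m) := by
  have hθ_le : ∀ i ≤ k, θ (e i) = v i := by
    rintro (_ | i) hi
    · rw [h.zero, hv.zero, map_zero]
    · exact hθ i hi
  have hm : m ∈ flag R⟦X⟧ e k := htop ▸ Submodule.mem_top
  rw [flag] at hm
  induction hm using Submodule.span_induction with
  | mem m hm =>
    obtain ⟨i, rfl⟩ := hm
    rw [h.step i i.2, θ.map_add, θ.map_smul, θ.map_smul, hθ_le _ i.2, hθ_le _ i.2.le,
      hv.step i i.2]
  | zero => simp only [map_zero]
  | add x y _ _ hx hy => rw [map_add, θ.map_add, hx, hy, θ.map_add, map_add]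
  | smul T y _ hy =>
    rw [_root_.aOp_smul, θ.map_add, θ.map_smul, θ.map_smul, θ.map_smul, hy, _root_.aOp_smul]

end Frames

section Chain

variable {E : Type*} [AddCommGroup E] [Module ℂ⟦X⟧ E] [ABAction ℂ E]

theorem isUnit_of_gen_eq_top {c : ℂ} {π : E →ₗ[ℂ⟦X⟧] ℂ⟦X⟧} (hsurj : Function.Surjective π)
    (ha : ∀ m, π (aOp ℂ m) = euler c (π m)) {g : E}
    (hg : (ABSubmodule.gen (R := ℂ) g).toSubmodule = ⊤) : IsUnit (π g) := by
  by_contra hu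
  have hmem : ∀ m, m ∈ Submodule.comap π (Ideal.span {(X : ℂ⟦X⟧)}) ↔ coeff 0 (π m) = 0 :=
    fun m => by
      rw [Submodule.mem_comap, Ideal.mem_span_singleton, X_dvd_iff,
        coeff_zero_eq_constantCoeff_apply]
  rw [isUnit_iff_isUnit_coeff_zero, isUnit_iff_ne_zero, not_not] at hu
  have htop : ⊤ ≤ Submodule.comap π (Ideal.span {(X : ℂ⟦X⟧)}) := by
    rw [← hg]
    refine ABSubmodule.gen_le (fun m _ => ?_) ((hmem g).2 hu)
    rw [hmem, ha, coeff_zero_euler]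
  obtain ⟨m, hm⟩ := hsurj 1
  have := (hmem m).1 (htop trivial)
  simp [hm] at this

theorem exists_gen_eq_ker {c : ℂ} {π : E →ₗ[ℂ⟦X⟧] ℂ⟦X⟧} (hsurj : Function.Surjective π)
    (ha : ∀ m, π (aOp ℂ m) = euler c (π m)) {g : E}
    (hg : (ABSubmodule.gen (R := ℂ) g).toSubmodule = ⊤) :
    ∃ w : ℂ⟦X⟧, IsUnit w ∧ ∃ f : E, g = w • f ∧
      (ABSubmodule.gen (R := ℂ) (aOp ℂ f - (C c * X : ℂ⟦X⟧) • f)).toSubmodule =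
        LinearMap.ker π := by
  obtain ⟨w, hw⟩ := isUnit_of_gen_eq_top hsurj ha hg
  obtain ⟨f, hf⟩ : ∃ f : E, f = (↑w⁻¹ : ℂ⟦X⟧) • g := ⟨_, rfl⟩
  have hgf : g = (w : ℂ⟦X⟧) • f := by simp [hf, smul_smul]
  have hπf : π f = 1 := by rw [hf, map_smul, ← hw, smul_eq_mul, Units.inv_mul]
  refine ⟨w, w.isUnit, f, hgf, ?_⟩
  set u := aOp ℂ f - (C c * X : ℂ⟦X⟧) • f with hu
  have hle : (ABSubmodule.gen (R := ℂ) u).toSubmodule ≤ LinearMap.ker π := by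
    refine ABSubmodule.gen_le (fun m hm => ?_) ?_
    · rw [LinearMap.mem_ker, ha, LinearMap.mem_ker.1 hm, map_zero]
    · rw [LinearMap.mem_ker, hu, map_sub, ha, map_smul, hπf, ← map_one C, euler_C, mul_one, map_one,
        smul_eq_mul, mul_one, sub_self]
  have htop : ⊤ ≤ Submodule.span ℂ⟦X⟧ {f} ⊔ (ABSubmodule.gen (R := ℂ) u).toSubmodule := by
    rw [← hg, hgf]
    have hf : f ∈ Submodule.span ℂ⟦X⟧ {f} ⊔ (ABSubmodule.gen (R := ℂ) u).toSubmodule :=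
      Submodule.mem_sup_left (Submodule.mem_span_singleton_self f)
    refine ABSubmodule.gen_le (fun m hm => ?_) (Submodule.smul_mem _ _ hf)
    obtain ⟨y, hy, z, hz, rfl⟩ := Submodule.mem_sup.1 hm
    obtain ⟨T, rfl⟩ := Submodule.mem_span_singleton.1 hy
    have haf : aOp ℂ f = (C c * X : ℂ⟦X⟧) • f + u := by rw [hu]; abel
    rw [map_add, aOp_smul_of_eq haf]
    exact add_mem (add_mem (Submodule.smul_mem _ _ hf) (Submodule.smul_mem _ _
      (Submodule.mem_sup_right (ABSubmodule.self_mem_gen u))))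
      (Submodule.mem_sup_right ((ABSubmodule.gen (R := ℂ) u).a_mem _ hz))
  refine le_antisymm hle fun m hm => ?_
  obtain ⟨y, hy, z, hz, rfl⟩ := Submodule.mem_sup.1 (htop (Submodule.mem_top (x := m)))
  obtain ⟨T, rfl⟩ := Submodule.mem_span_singleton.1 hy
  have hT : T = 0 := by
    rw [LinearMap.mem_ker, map_add, LinearMap.mem_ker.1 (hle hz), map_smul, hπf] at hm
    simpa using hm
  rwa [hT, zero_smul, zero_add]

theorem exists_linearMap_of_abIso {mu : ℚ} {P Q : ABSubmodule ℂ E}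
    (h : ABIso ℂ (Q.toSubmodule ⧸ (P.inside Q).toSubmodule) (ELam mu)) :
    ∃ π : Q.toSubmodule →ₗ[ℂ⟦X⟧] ℂ⟦X⟧, Function.Surjective π ∧
      LinearMap.ker π = (P.inside Q).toSubmodule ∧ ∀ m, π (aOp ℂ m) = euler (mu : ℂ) (π m) := by
  obtain ⟨θ, hθ⟩ := h
  let θ' : (Q.toSubmodule ⧸ (P.inside Q).toSubmodule) →ₗ[ℂ⟦X⟧] ℂ⟦X⟧ := θ.toLinearMap
  refine ⟨θ'.comp (Submodule.mkQ _), θ.surjective.comp (Submodule.mkQ_surjective _), ?_,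
    fun m => hθ (Submodule.Quotient.mk m)⟩
  rw [LinearMap.ker_comp, show LinearMap.ker θ' = ⊥ from θ.ker, Submodule.comap_bot,
    Submodule.ker_mkQ]

theorem exists_generator_of_abIso {mu : ℚ} {P Q : ABSubmodule ℂ E}
    (hle : P.toSubmodule ≤ Q.toSubmodule)
    (hiso : ABIso ℂ (Q.toSubmodule ⧸ (P.inside Q).toSubmodule) (ELam mu)) {g : E}
    (hg : (ABSubmodule.gen (R := ℂ) g).toSubmodule = Q.toSubmodule) :
    ∃ w : ℂ⟦X⟧, IsUnit w ∧ ∃ f u : E, g = w • f ∧ aOp ℂ f = (C (mu : ℂ) * X : ℂ⟦X⟧) • f + u ∧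
      (ABSubmodule.gen (R := ℂ) u).toSubmodule = P.toSubmodule := by
  obtain ⟨π, hsurj, hker, ha⟩ := exists_linearMap_of_abIso hiso
  let g' : Q.toSubmodule := ⟨g, hg ▸ ABSubmodule.self_mem_gen g⟩
  have hg' : (ABSubmodule.gen (R := ℂ) g').toSubmodule = ⊤ := by
    apply Submodule.map_injective_of_injective Q.toSubmodule.injective_subtype
    rw [ABSubmodule.map_gen fun _ => rfl, Submodule.map_top, Submodule.range_subtype]
    exact hg
  obtain ⟨w, hw, f, hgf, hu⟩ := exists_gen_eq_ker hsurj ha hg'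
  refine ⟨w, hw, f, aOp ℂ f.1 - (C (mu : ℂ) * X : ℂ⟦X⟧) • f.1, congrArg Subtype.val hgf,
    by abel, ?_⟩
  have hmap := ABSubmodule.map_gen (f := Q.toSubmodule.subtype) (fun _ => rfl)
    (aOp ℂ f - (C (mu : ℂ) * X : ℂ⟦X⟧) • f)
  rw [hu, hker] at hmap
  exact hmap.symm.trans ((Submodule.map_comap_subtype _ _).trans (inf_eq_right.2 hle))

theorem exists_frame_of_chain {lam : ℕ → ℚ} {F : ℕ → ABSubmodule ℂ E} {k : ℕ}
    (hF : ∀ j < k, (F j).toSubmodule ≤ (F (j + 1)).toSubmodule ∧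
      ABIso ℂ ((F (j + 1)).toSubmodule ⧸ ((F j).inside (F (j + 1))).toSubmodule)
        (ELam (lam (j + 1))))
    (h0 : (F 0).toSubmodule = ⊥) {g : E}
    (hg : (ABSubmodule.gen (R := ℂ) g).toSubmodule = (F k).toSubmodule) :
    ∃ (S : ℕ → ℂ⟦X⟧) (e : ℕ → E), IsFrame (fun j => (lam j : ℂ)) S k e ∧
      (∀ i, 1 ≤ i → i < k → IsUnit (S i)) ∧ ∃ w : ℂ⟦X⟧, IsUnit w ∧ g = w • e k := by
  induction k generalizing g with
  | zero =>
    have hg0 : g = 0 := by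
      rw [← Submodule.mem_bot (R := ℂ⟦X⟧), ← h0, ← hg]; exact ABSubmodule.self_mem_gen g
    exact ⟨0, 0, ⟨rfl, by simp⟩, by omega, 1, isUnit_one, by simp [hg0]⟩
  | succ k ih =>
    obtain ⟨hle, hiso⟩ := hF k (Nat.lt_succ_self k)
    obtain ⟨w, hw, f, u, hgf, ha, hu⟩ := exists_generator_of_abIso hle hiso hg
    obtain ⟨S, e, he, hS, w', hw', rfl⟩ := ih (fun j hj => hF j (by omega)) hu
    refine ⟨_, _, he.update ha, fun i hi hik => ?_, w, hw, by rw [Function.update_self, hgf]⟩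
    rcases Nat.lt_succ_iff_lt_or_eq.1 hik with hik | rfl
    · rw [Function.update_of_ne (by omega)]
      exact hS i hi hik
    · rwa [Function.update_self]

end Chain

section LogEmbedding

variable {E : Type*} [AddCommGroup E] [Module ℂ⟦X⟧ E] [ABAction ℂ E]

/-- The components `ψ i` of an embedding of `E` into a module `⊕_i ℂ[[b]] ε_i` with
`a ε_i = λ b ε_i + b ε_{i-1}`, such as `Ξ_λ^(N)`; they are indexed by all of `ℕ` and vanish for
large `i`. -/
structure LogEmbedding (lam : ℂ) (ψ : ℕ → E →ₗ[ℂ⟦X⟧] ℂ⟦X⟧) : Prop where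
  finite : ∃ N, ∀ i ≥ N, ψ i = 0
  map_a : ∀ i m, ψ i (aOp ℂ m) = euler lam (ψ i m) + X * ψ (i + 1) m
  inj : ∀ m, (∀ i, ψ i m = 0) → m = 0

/-- The component along `e_{lam,i}` of an element of `Ξ_lam^(N)`, zero for `i > N`. -/
def Xi.comp {R : Type*} [CommRing R] {lam : ℚ} {N : ℕ} (i : ℕ) : Xi R {lam} N →ₗ[R⟦X⟧] R⟦X⟧ where
  toFun s := if h : i < N + 1 then s ⟨lam, Finset.mem_singleton_self lam⟩ ⟨i, h⟩ else 0
  map_add' s t := by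
    split_ifs
    · rfl
    · rw [add_zero]
  map_smul' S s := by
    split_ifs
    · rfl
    · rw [smul_zero]

theorem Xi.comp_of_lt {R : Type*} [CommRing R] {lam : ℚ} {N i : ℕ} (h : i < N + 1)
    (s : Xi R {lam} N) : Xi.comp i s = s ⟨lam, Finset.mem_singleton_self lam⟩ ⟨i, h⟩ := dif_pos h

theorem Xi.comp_ext {R : Type*} [CommRing R] {lam : ℚ} {N : ℕ} {s t : Xi R {lam} N}
    (h : ∀ i, i < N + 1 → Xi.comp i s = Xi.comp i t) : s = t := by
  funext ⟨l, hl⟩ i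
  obtain rfl := Finset.mem_singleton.1 hl
  simpa only [Xi.comp_of_lt i.2] using h i i.2

theorem Xi.comp_eq_zero {R : Type*} [CommRing R] {lam : ℚ} {N : ℕ} (s : Xi R {lam} N) {i : ℕ}
    (h : N + 1 ≤ i) : Xi.comp i s = 0 := dif_neg (by omega)

theorem Xi.comp_aOp {R : Type*} [CommRing R] [Algebra ℂ R] {lam : ℚ} {N : ℕ} (s : Xi R {lam} N)
    (i : ℕ) : Xi.comp i (aOp R s) =
      euler (algebraMap ℂ R ((lam : ℚ) : ℂ)) (Xi.comp i s) + X * Xi.comp (i + 1) s := by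
  by_cases h : i < N + 1
  · have h_succ : X * Xi.comp (i + 1) s = if h : i + 1 < N + 1 then
        X * s ⟨lam, Finset.mem_singleton_self lam⟩ ⟨i + 1, h⟩ else 0 := by
      simp only [Xi.comp, LinearMap.coe_mk, AddHom.coe_mk, mul_dite, mul_zero]
    rw [Xi.comp_of_lt h, Xi.comp_of_lt h, euler_apply, h_succ]
    rfl
  · rw [Xi.comp_eq_zero _ (by omega), Xi.comp_eq_zero _ (by omega), Xi.comp_eq_zero _ (by omega),
      map_zero, mul_zero, add_zero]

theorem IsPrimitiveTheme.exists_linearMap {lam : ℚ} {k : ℕ} (h : IsPrimitiveTheme E lam k) :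
    ∃ (N : ℕ) (f : E →ₗ[ℂ⟦X⟧] Xi ℂ {lam} N) (φ : Xi ℂ {lam} N), Function.Injective f ∧
      (∀ m, f (aOp ℂ m) = aOp ℂ (f m)) ∧
      LinearMap.range f = (ABSubmodule.gen (R := ℂ) φ).toSubmodule := by
  obtain ⟨-, N, φ, θ, hθ⟩ := h
  refine ⟨N, (Submodule.subtype _).comp θ.toLinearMap, φ,
    Subtype.val_injective.comp θ.injective, fun m => congrArg Subtype.val (hθ m), ?_⟩
  rw [LinearMap.range_comp_of_range_eq_top _ θ.range, Submodule.range_subtype]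

theorem IsPrimitiveTheme.exists_generator {lam : ℚ} {k : ℕ} (h : IsPrimitiveTheme E lam k) :
    ∃ g : E, (ABSubmodule.gen (R := ℂ) g).toSubmodule = ⊤ := by
  obtain ⟨N, f, φ, hf, hfa, hrange⟩ := h.exists_linearMap
  obtain ⟨g, rfl⟩ : φ ∈ LinearMap.range f := hrange ▸ ABSubmodule.self_mem_gen φ
  refine ⟨g, Submodule.map_injective_of_injective hf ?_⟩
  rw [ABSubmodule.map_gen hfa, Submodule.map_top, hrange]

theorem IsPrimitiveTheme.finite {lam : ℚ} {k : ℕ} (h : IsPrimitiveTheme E lam k) :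
    Module.Finite ℂ⟦X⟧ E := by
  obtain ⟨N, f, -, hf, -⟩ := h.exists_linearMap
  have : Module.Finite ℂ⟦X⟧ (Xi ℂ {lam} N) :=
    inferInstanceAs (Module.Finite ℂ⟦X⟧ (({lam} : Finset ℚ) → Fin (N + 1) → ℂ⟦X⟧))
  exact Module.Finite.of_injective f hf

theorem IsPrimitiveTheme.isTorsionFree {lam : ℚ} {k : ℕ} (h : IsPrimitiveTheme E lam k) :
    Module.IsTorsionFree ℂ⟦X⟧ E := by
  obtain ⟨N, f, -, hf, -⟩ := h.exists_linearMap
  have : Module.IsTorsionFree ℂ⟦X⟧ (Xi ℂ {lam} N) :=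
    inferInstanceAs (Module.IsTorsionFree ℂ⟦X⟧ (({lam} : Finset ℚ) → Fin (N + 1) → ℂ⟦X⟧))
  exact hf.moduleIsTorsionFree f (map_smul f)

theorem IsPrimitiveTheme.exists_logEmbedding {lam : ℚ} {k : ℕ} (h : IsPrimitiveTheme E lam k) :
    ∃ ψ : ℕ → E →ₗ[ℂ⟦X⟧] ℂ⟦X⟧, LogEmbedding (lam : ℂ) ψ := by
  obtain ⟨N, f, -, hf, hfa, -⟩ := h.exists_linearMap
  refine ⟨fun i => (Xi.comp i).comp f, ⟨N + 1, fun i hi => ?_⟩, fun i m => ?_, fun m hm => ?_⟩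
  · exact LinearMap.ext fun m => Xi.comp_eq_zero _ hi
  · exact (congrArg (Xi.comp i) (hfa m)).trans (Xi.comp_aOp _ i)
  · exact (map_eq_zero_iff f hf).1 (Xi.comp_ext fun i _ => by rw [map_zero]; exact hm i)

theorem eq_zero_of_euler {c : ℂ} {w w' : ℂ⟦X⟧} (h : euler c w = 0) (h' : euler c w' + X * w = 0) :
    w = 0 := by
  ext n
  have h_coeff := congrArg (coeff (n + 1)) h
  have h_coeff' := congrArg (coeff (n + 1)) h'
  rw [coeff_succ_euler, map_zero] at h_coeff
  rw [map_add, coeff_succ_euler, coeff_succ_X_mul, map_zero] at h_coeff'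
  by_cases hn : (n + c : ℂ) = 0
  · simpa [hn] using h_coeff'
  · simpa [hn] using h_coeff

theorem eq_monomial_of_euler {c : ℂ} {w : ℂ⟦X⟧} (h : euler c w = 0) (hw : w ≠ 0) :
    ∃ (m : ℕ) (d : ℂ), d ≠ 0 ∧ (m + c : ℂ) = 0 ∧ w = C d * X ^ m := by
  obtain ⟨m, hm⟩ := exists_coeff_ne_zero_iff_ne_zero.2 hw
  have h0 : ∀ n : ℕ, (n + c : ℂ) * coeff n w = 0 := fun n => by
    rw [← coeff_succ_euler, h, map_zero]
  have hmc : (m + c : ℂ) = 0 := (mul_eq_zero.1 (h0 m)).resolve_right hm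
  refine ⟨m, coeff m w, hm, hmc, PowerSeries.ext fun n => ?_⟩
  rw [coeff_C_mul, coeff_X_pow]
  split_ifs with hn
  · rw [hn, mul_one]
  · rw [mul_zero]
    refine (mul_eq_zero.1 (h0 n)).resolve_left fun hnc => hn ?_
    have : (n : ℂ) = m := by linear_combination hnc - hmc
    exact_mod_cast this

variable {lam : ℂ} {ψ : ℕ → E →ₗ[ℂ⟦X⟧] ℂ⟦X⟧} {mu : ℕ → ℂ} {S : ℕ → ℂ⟦X⟧} {k : ℕ} {e : ℕ → E}

theorem LogEmbedding.euler_eq (hψ : LogEmbedding lam ψ) (h : IsFrame mu S k e) {j : ℕ} (hj : j < k)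
    (i : ℕ) : euler (lam - mu (j + 1)) (ψ i (e (j + 1))) + X * ψ (i + 1) (e (j + 1)) =
      S j * ψ i (e j) := by
  have ha := hψ.map_a i (e (j + 1))
  rw [h.step j hj, map_add, map_smul, map_smul, smul_eq_mul, smul_eq_mul] at ha
  rw [euler_sub]
  simp only [Algebra.algebraMap_self, RingHom.id_apply] at ha
  linear_combination -ha

theorem LogEmbedding.apply_eq_zero (hψ : LogEmbedding lam ψ) (h : IsFrame mu S k e) {j : ℕ}
    (hj : j ≤ k) : ∀ i ≥ j, ψ i (e j) = 0 := by
  induction j with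
  | zero => intro i _; rw [h.zero, map_zero]
  | succ j ih =>
    have ih := ih (by omega)
    obtain ⟨N, hN⟩ := hψ.finite
    have descent : ∀ l i, i + l ≥ N → i ≥ j + 1 → ψ i (e (j + 1)) = 0 := by
      intro l
      induction l with
      | zero => intro i hi _; rw [hN i hi]; rfl
      | succ l ihl =>
        intro i hi hij
        have h_eq := hψ.euler_eq h hj i
        rw [ihl (i + 1) (by omega) (by omega), ih i (by omega), mul_zero, mul_zero, add_zero]
          at h_eq
        obtain ⟨i, rfl⟩ : ∃ i', i = i' + 1 := ⟨i - 1, by omega⟩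
        have h_eq' := hψ.euler_eq h hj i
        rw [ih i (by omega), mul_zero] at h_eq'
        exact eq_zero_of_euler h_eq h_eq'
    exact fun i hi => descent N i (by omega) hi

/-- Otherwise the `j` components `ψ 0, …, ψ (j - 1)` would embed `flag e (j + 1)`. -/
theorem LogEmbedding.apply_ne_zero (hψ : LogEmbedding lam ψ) (h : IsFrame mu S k e)
    (he : LinearIndependent ℂ⟦X⟧ fun i : Fin k => e (i + 1)) {j : ℕ} (hj : j < k) :
    ψ j (e (j + 1)) ≠ 0 := by
  intro hw
  have hzero : ∀ i ≥ j, flag ℂ⟦X⟧ e (j + 1) ≤ LinearMap.ker (ψ i) := fun i hi =>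
    flag_le_iff.2 fun l _ hl => by
      rw [LinearMap.mem_ker]
      rcases (show l ≤ i ∨ l = j + 1 ∧ i = j by omega) with hli | ⟨rfl, rfl⟩
      · exact hψ.apply_eq_zero h (by omega) i hli
      · exact hw
  let f : flag ℂ⟦X⟧ e (j + 1) →ₗ[ℂ⟦X⟧] (Fin j → ℂ⟦X⟧) :=
    LinearMap.pi fun i => (ψ i).comp (Submodule.subtype _)
  have hf : Function.Injective f := (injective_iff_map_eq_zero f).2 fun m hm =>
    Subtype.ext <| hψ.inj m fun i => by
      rcases lt_or_ge i j with hi | hi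
      · exact congrFun hm ⟨i, hi⟩
      · exact hzero i hi m.2
  have := LinearMap.finrank_le_finrank_of_injective hf
  rw [finrank_flag he hj, Module.finrank_fin_fun] at this
  omega

theorem LogEmbedding.exists_apply_eq_monomial (hψ : LogEmbedding lam ψ) (h : IsFrame mu S k e)
    (he : LinearIndependent ℂ⟦X⟧ fun i : Fin k => e (i + 1)) {j : ℕ} (hj : j < k) :
    ∃ (m : ℕ) (d : ℂ), d ≠ 0 ∧ mu (j + 1) = lam + m ∧ ψ j (e (j + 1)) = C d * X ^ m := by
  have h_eq := hψ.euler_eq h hj j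
  rw [hψ.apply_eq_zero h hj (j + 1) le_rfl, hψ.apply_eq_zero h hj.le j le_rfl, mul_zero,
    mul_zero, add_zero] at h_eq
  obtain ⟨m, d, hd, hm, hmd⟩ := eq_monomial_of_euler h_eq (hψ.apply_ne_zero h he hj)
  exact ⟨m, d, hd, by linear_combination -hm, hmd⟩

theorem LogEmbedding.coeff_ne_zero (hψ : LogEmbedding lam ψ) (h : IsFrame mu S k e)
    (he : LinearIndependent ℂ⟦X⟧ fun i : Fin k => e (i + 1)) {j p : ℕ} (hj1 : 1 ≤ j) (hj : j < k)
    (hmu : mu (j + 1) = mu j + p - 1) : coeff p (S j) ≠ 0 := by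
  obtain ⟨i, rfl⟩ : ∃ i, j = i + 1 := ⟨j - 1, by omega⟩
  obtain ⟨m, d, -, hm, hmd⟩ := hψ.exists_apply_eq_monomial h he (j := i) (by omega)
  obtain ⟨m', d', hd', hm', hmd'⟩ := hψ.exists_apply_eq_monomial h he hj
  have hmm : m' + 1 = p + m := by
    rw [hm, hm'] at hmu
    have : (m' + 1 : ℂ) = p + m := by linear_combination hmu
    exact_mod_cast this
  have h_coeff : d' = d * coeff p (S (i + 1)) := by
    have := congrArg (coeff (m' + 1)) (hψ.euler_eq h hj i)
    rwa [map_add, coeff_succ_euler, coeff_succ_X_mul, hmd, hmd', hm', sub_add_cancel_left,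
      add_neg_cancel, zero_mul, zero_add, coeff_C_mul, coeff_X_pow_self, mul_one, mul_left_comm,
      coeff_C_mul, hmm, coeff_mul_X_pow] at this
  intro h0
  exact hd' (by rw [h_coeff, h0, mul_zero])

theorem LogEmbedding.X_pow_dvd (hψ : LogEmbedding lam ψ) (h : IsFrame mu S k e)
    (hS : ∀ i, 1 ≤ i → i < k → IsUnit (S i)) {j l : ℕ} (hj : 1 ≤ j) (hjl : j + l = k) (i : ℕ) :
    X ^ l ∣ ψ i (e j) := by
  induction l generalizing j i with
  | zero => simp
  | succ l ih =>
    have ih := ih (j := j + 1) (by omega) (by omega)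
    rw [← (hS j hj (by omega)).dvd_mul_left, ← hψ.euler_eq h (by omega) i]
    refine dvd_add (X_pow_dvd_euler _ (ih i)) ?_
    rw [pow_succ']
    exact mul_dvd_mul_left _ (ih (i + 1))

theorem LogEmbedding.exists_shift (hψ : LogEmbedding lam ψ) (h : IsFrame mu S k e)
    (he : LinearIndependent ℂ⟦X⟧ fun i : Fin k => e (i + 1))
    (hS : ∀ i, 1 ≤ i → i < k → IsUnit (S i)) (hk : 1 ≤ k) :
    ∃ m : ℕ, mu 1 = lam + m ∧ k - 1 ≤ m := by
  obtain ⟨m, d, hd, hm, hmd⟩ := hψ.exists_apply_eq_monomial h he hk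
  refine ⟨m, hm, ?_⟩
  have hdvd := hψ.X_pow_dvd h hS (l := k - 1) le_rfl (by omega) 0
  by_contra! hlt
  have := X_pow_dvd_iff.1 hdvd m hlt
  rw [zero_add] at hmd
  rw [hmd, coeff_C_mul, coeff_X_pow_self, mul_one] at this
  exact hd this

end LogEmbedding

/-! ### Normal submodules of a theme -/

section Normal

variable {E : Type*} [AddCommGroup E] [Module ℂ⟦X⟧ E] [ABAction ℂ E]
  {mu : ℕ → ℂ} {S : ℕ → ℂ⟦X⟧} {k : ℕ} {e : ℕ → E} {G : ABSubmodule ℂ E}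

theorem exists_unit_mul_X_pow {T : ℂ⟦X⟧} (hT : T ≠ 0) :
    ∃ (n : ℕ) (s : ℂ⟦X⟧ˣ), T = (s : ℂ⟦X⟧) * X ^ n :=
  IsDiscreteValuationRing.eq_unit_mul_pow_irreducible hT PowerSeries.X_prime.irreducible

theorem ABSubmodule.IsNormal.mem_of_smul_mem (hG : G.IsNormal) {T : ℂ⟦X⟧} (hT : T ≠ 0) {m : E}
    (hm : T • m ∈ G.toSubmodule) : m ∈ G.toSubmodule := by
  obtain ⟨n, s, rfl⟩ := exists_unit_mul_X_pow hT
  have hXm : (X ^ n : ℂ⟦X⟧) • m ∈ G.toSubmodule := by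
    simpa [smul_smul, ← mul_assoc] using Submodule.smul_mem _ (↑s⁻¹ : ℂ⟦X⟧) hm
  induction n with
  | zero => simpa using hXm
  | succ n ih =>
    have hXn : (X ^ n : ℂ⟦X⟧) • m ∈ G.toSubmodule := hG _ (by rwa [smul_smul, ← pow_succ'])
    exact ih (mul_ne_zero s.ne_zero (pow_ne_zero _ X_ne_zero))
      (by rw [mul_smul]; exact Submodule.smul_mem _ _ hXn) hXn

theorem ABSubmodule.IsNormal.flag_le (hG : G.IsNormal) {i : ℕ}
    (h : ∀ l < i, ∃ T : ℂ⟦X⟧, T ≠ 0 ∧ ∃ v ∈ flag ℂ⟦X⟧ e l, T • e (l + 1) + v ∈ G.toSubmodule) :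
    flag ℂ⟦X⟧ e i ≤ G.toSubmodule := by
  induction i with
  | zero => rw [flag_zero]; exact bot_le
  | succ i ih =>
    have ih := ih fun l hl => h l (hl.trans i.lt_succ_self)
    obtain ⟨T, hT, v, hv, hg⟩ := h i i.lt_succ_self
    have hei : e (i + 1) ∈ G.toSubmodule :=
      hG.mem_of_smul_mem hT ((Submodule.add_mem_iff_left _ (ih hv)).1 hg)
    intro m hm
    obtain ⟨T', v', hv', rfl⟩ := mem_flag_succ.1 hm
    exact add_mem (Submodule.smul_mem _ _ hei) (ih hv')

theorem IsFrame.mem_flag_self (h : IsFrame mu S k e) (l : ℕ) : e l ∈ flag ℂ⟦X⟧ e l := by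
  rcases Nat.eq_zero_or_pos l with rfl | hl
  · rw [h.zero]; exact zero_mem _
  · exact mem_flag hl le_rfl

theorem IsFrame.aOp_sub_smul (h : IsFrame mu S k e) {l n : ℕ} (hl : l + 1 < k) (T : ℂ⟦X⟧)
    {v : E} (hv : v ∈ flag ℂ⟦X⟧ e l) :
    ∃ v' ∈ flag ℂ⟦X⟧ e l,
      aOp ℂ ((X ^ n : ℂ⟦X⟧) • e (l + 2) + (T • e (l + 1) + v)) -
          (C (n + mu (l + 2)) * X : ℂ⟦X⟧) • ((X ^ n : ℂ⟦X⟧) • e (l + 2) + (T • e (l + 1) + v)) =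
        (X ^ n * S (l + 1) + euler (mu (l + 1) - (n + mu (l + 2))) T) • e (l + 1) + v' := by
  refine ⟨(T * S l) • e l + aOp ℂ v - (C (n + mu (l + 2)) * X : ℂ⟦X⟧) • v,
    sub_mem (add_mem (Submodule.smul_mem _ _ (h.mem_flag_self l))
      ((h.mono (by omega : l ≤ k)).aOp_mem_flag hv)) (Submodule.smul_mem _ _ hv), ?_⟩
  rw [map_add, map_add, h.aOp_smul hl, h.aOp_smul (by omega : l < k)]
  simp only [Algebra.algebraMap_self, RingHom.id_apply, euler_X_pow, euler_sub, smul_add,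
    smul_smul, mul_assoc, ← pow_succ', add_smul, sub_smul]
  abel

/-- Applying `a - (λ_{l+2} + n) b`, which kills `b^n e_{l+2}` modulo `e_{l+1}`. The coefficient of
`b^(n+p)` along `e_{l+1}` is then that of `b^n S_{l+1}`, because `a - (λ_{l+2} + n) b` kills
`b^(n+p-1) e_{l+1}` modulo `e_l`. -/
theorem IsFrame.exists_smul_add_mem_of_succ (h : IsFrame mu S k e) {l p : ℕ} (hl : l + 1 < k)
    (hmu : mu (l + 2) = mu (l + 1) + p - 1) (hp : coeff p (S (l + 1)) ≠ 0)
    (hG : ∃ T : ℂ⟦X⟧, T ≠ 0 ∧ ∃ v ∈ flag ℂ⟦X⟧ e (l + 1), T • e (l + 2) + v ∈ G.toSubmodule) :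
    ∃ T : ℂ⟦X⟧, T ≠ 0 ∧ ∃ v ∈ flag ℂ⟦X⟧ e l, T • e (l + 1) + v ∈ G.toSubmodule := by
  obtain ⟨_, hT, v, hv, hg⟩ := hG
  obtain ⟨n, s, rfl⟩ := exists_unit_mul_X_pow hT
  obtain ⟨T, v₁, hv₁, hv_eq⟩ := mem_flag_succ.1 (Submodule.smul_mem _ (↑s⁻¹ : ℂ⟦X⟧) hv)
  have hg' : (X ^ n : ℂ⟦X⟧) • e (l + 2) + (T • e (l + 1) + v₁) ∈ G.toSubmodule := by
    simpa [← hv_eq, smul_smul, ← mul_assoc] using Submodule.smul_mem _ (↑s⁻¹ : ℂ⟦X⟧) hg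
  obtain ⟨v', hv', h_eq⟩ := h.aOp_sub_smul (n := n) hl T hv₁
  refine ⟨_, fun h0 => hp ?_, v', hv',
    h_eq ▸ sub_mem (G.a_mem _ hg') (Submodule.smul_mem _ _ hg')⟩
  have h_euler : coeff (p + n) (euler (mu (l + 1) - (n + mu (l + 2))) T) = 0 := by
    cases hc : p + n with
    | zero => exact coeff_zero_euler _ _
    | succ c =>
      have hc' : (p + n : ℂ) = c + 1 := by exact_mod_cast hc
      rw [coeff_succ_euler, show (c + (mu (l + 1) - (n + mu (l + 2))) : ℂ) = 0 by
        linear_combination -hmu - hc', zero_mul]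
  have h_coeff := congrArg (coeff (p + n)) h0
  rwa [map_add, h_euler, add_zero, mul_comm, coeff_mul_X_pow, map_zero] at h_coeff

theorem IsFrame.exists_eq_flag_of_isNormal (h : IsFrame mu S k e) (htop : flag ℂ⟦X⟧ e k = ⊤)
    {p : ℕ → ℕ} (hmu : ∀ j, 1 ≤ j → j < k → mu (j + 1) = mu j + p j - 1)
    (hp : ∀ j, 1 ≤ j → j < k → coeff (p j) (S j) ≠ 0) (hG : G.IsNormal) :
    ∃ i ≤ k, G.toSubmodule = flag ℂ⟦X⟧ e i := by
  classical
  have hex : ∃ i, G.toSubmodule ≤ flag ℂ⟦X⟧ e i := ⟨k, htop ▸ le_top⟩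
  have hle := Nat.find_spec hex
  have hfind : Nat.find hex ≤ k := Nat.find_min' hex (htop ▸ le_top)
  refine ⟨Nat.find hex, hfind, le_antisymm hle (hG.flag_le fun l hl => ?_)⟩
  obtain ⟨i, hi⟩ : ∃ i, Nat.find hex = i + 1 := Nat.exists_eq_succ_of_ne_zero (by omega)
  have hli : l ≤ i := by omega
  rw [hi] at hle hfind
  induction hli using Nat.decreasingInduction with
  | of_succ l hl ih =>
    exact h.exists_smul_add_mem_of_succ (by omega) (hmu _ (by omega) (by omega))
      (hp _ (by omega) (by omega)) (ih (by omega))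
  | self =>
    obtain ⟨g, hg, hgi⟩ := SetLike.not_le_iff_exists.1 (Nat.find_min hex hl)
    obtain ⟨T, v, hv, rfl⟩ := mem_flag_succ.1 (hle hg)
    refine ⟨T, ?_, v, hv, hg⟩
    rintro rfl
    exact hgi (by rwa [zero_smul, zero_add])

end Normal

section ThemeFrame

theorem lamInv_succ (lam₁ : ℚ) (p : ℕ → ℕ) {j : ℕ} (hj : 1 ≤ j) :
    lamInv lam₁ p (j + 1) = lamInv lam₁ p j + p j - 1 := by
  rw [lamInv, lamInv, Finset.sum_Ico_succ_top hj]; ring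

theorem lamInv_one (lam₁ : ℚ) (p : ℕ → ℕ) : lamInv lam₁ p 1 = lam₁ := by
  simp [lamInv]

theorem lamInv_succ_cast (lam₁ : ℚ) (p : ℕ → ℕ) {j : ℕ} (hj : 1 ≤ j) :
    ((lamInv lam₁ p (j + 1) : ℚ) : ℂ) = (lamInv lam₁ p j : ℚ) + p j - 1 := by
  rw [lamInv_succ lam₁ p hj]; push_cast; ring

/-- A frame which is a basis of a theme, or of a family of themes, with fundamental invariants
`lam₁` and `p`. That `b^(p_i)` occurs in `S_i` is what makes a theme primitive. -/
structure IsThemeFrame {R : Type*} [CommRing R] [Algebra ℂ R] {M : Type*} [AddCommGroup M]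
    [Module R⟦X⟧ M] [ABAction R M] (lam₁ : ℚ) (p : ℕ → ℕ) (k : ℕ) (S : ℕ → R⟦X⟧) (e : ℕ → M) :
    Prop where
  frame : IsFrame (fun j => (lamInv lam₁ p j : ℂ)) S k e
  isUnit : ∀ i, 1 ≤ i → i < k → IsUnit (S i)
  isUnit_coeff : ∀ i, 1 ≤ i → i < k → IsUnit (coeff (p i) (S i))
  span : flag R⟦X⟧ e k = ⊤
  ind : LinearIndependent R⟦X⟧ fun i : Fin k => e (i + 1)

variable {E : Type*} [AddCommGroup E] [Module ℂ⟦X⟧ E] [ABAction ℂ E] {lam lam₁ : ℚ} {p : ℕ → ℕ}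
  {k : ℕ}

theorem exists_themeFrame (hk : 1 ≤ k) (h : IsPrimitiveTheme E lam k)
    (hinv : HasInvariants E k lam₁ p) {g : E}
    (hg : (ABSubmodule.gen (R := ℂ) g).toSubmodule = ⊤) :
    (∃ m : ℕ, lam₁ = lam + m ∧ k - 1 ≤ m) ∧
    ∃ (S : ℕ → ℂ⟦X⟧) (e : ℕ → E), IsThemeFrame lam₁ p k S e ∧
      ∃ w : ℂ⟦X⟧, IsUnit w ∧ g = w • e k := by
  have := h.finite
  have := h.isTorsionFree
  obtain ⟨ψ, hψ⟩ := h.exists_logEmbedding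
  obtain ⟨F, hF, hFk, hstep⟩ := hinv
  have h0 : (F 0).toSubmodule = ⊥ := Submodule.finrank_eq_zero.1 (hF 0 (by omega)).2
  obtain ⟨S, e, hfr, hS, w, hw, rfl⟩ := exists_frame_of_chain hstep h0 (hg.trans hFk.symm)
  have hspan : flag ℂ⟦X⟧ e k = ⊤ := (hfr.gen_eq_flag hS hw).symm.trans hg
  have hind : LinearIndependent ℂ⟦X⟧ fun i : Fin k => e (i + 1) :=
    linearIndependent_of_top_le_span_of_card_eq_finrank hspan.ge (by rw [Fintype.card_fin, h.1])
  obtain ⟨m, hm, hkm⟩ := hψ.exists_shift hfr hind hS hk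
  refine ⟨⟨m, ?_, hkm⟩, S, e, ⟨hfr, hS, fun i hi hik => ?_, hspan, hind⟩, w, hw, rfl⟩
  · rw [lamInv_one] at hm
    exact_mod_cast hm
  · exact isUnit_iff_ne_zero.2 (hψ.coeff_ne_zero hfr hind hi hik (lamInv_succ_cast lam₁ p hi))

theorem IsThemeFrame.eq_flag {S : ℕ → ℂ⟦X⟧} {e : ℕ → E} (h : IsThemeFrame lam₁ p k S e)
    {G : ABSubmodule ℂ E} {j : ℕ} (hG : G.IsNormalOfRank j) :
    G.toSubmodule = flag ℂ⟦X⟧ e j := by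
  obtain ⟨i, hi, hGi⟩ := h.frame.exists_eq_flag_of_isNormal h.span
    (fun j hj _ => lamInv_succ_cast lam₁ p hj)
    (fun j hj1 hj => (h.isUnit_coeff j hj1 hj).ne_zero) hG.1
  have hij : i = j := by rw [← finrank_flag h.ind hi, ← hGi, hG.2]
  rw [hGi, hij]

end ThemeFrame

/-! ### The parameter of a rank two theme -/

section Parameter

theorem eq_C_of_euler_zero {T : ℂ⟦X⟧} (h : euler 0 T = 0) : T = C (coeff 0 T) := by
  ext n
  rcases eq_or_ne n 0 with rfl | hn
  · rw [coeff_C, if_pos rfl]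
  · have hn' := congrArg (coeff (n + 1)) h
    rw [coeff_succ_euler, add_zero, map_zero] at hn'
    rw [coeff_C, if_neg hn, (mul_eq_zero.1 hn').resolve_left (Nat.cast_ne_zero.2 hn)]

theorem eq_zero_of_euler_pred {p : ℕ} (hp : 1 ≤ p) {T : ℂ⟦X⟧} (hT : coeff 0 T = 0)
    (h : euler (p - 1 : ℂ) T = 0) : T = 0 := by
  ext n
  cases n with
  | zero => exact hT
  | succ n =>
    have hn := congrArg (coeff (n + 2)) h
    rw [coeff_succ_euler, map_zero, Nat.cast_succ, add_add_sub_cancel, ← Nat.cast_add] at hn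
    exact (mul_eq_zero.1 hn).resolve_left (Nat.cast_ne_zero.2 (by omega))

variable {p : ℕ} {β : ℂ}

theorem constantCoeff_one_add_C_mul_X_pow (hp : 1 ≤ p) :
    constantCoeff (1 + C β * X ^ p : ℂ⟦X⟧) = 1 := by
  simp [show p ≠ 0 by omega]

theorem coeff_eq_of_add_euler_eq (hp : 1 ≤ p) {S T : ℂ⟦X⟧} {d : ℂ}
    (h : S + euler (1 - p : ℂ) T = (1 + C β * X ^ p : ℂ⟦X⟧) * C d) :
    coeff 0 S = d ∧ coeff p S = β * d := by
  obtain ⟨q, rfl⟩ := Nat.exists_eq_add_of_le' hp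
  have h0 := congrArg (coeff 0) h
  have hq := congrArg (coeff (q + 1)) h
  rw [map_add, coeff_zero_euler, coeff_mul_C, coeff_zero_eq_constantCoeff_apply (1 + _),
    constantCoeff_one_add_C_mul_X_pow hp, add_zero, one_mul] at h0
  rw [map_add, coeff_succ_euler, coeff_mul_C, map_add, coeff_C_mul, coeff_X_pow_self, coeff_one,
    if_neg q.succ_ne_zero, Nat.cast_succ, show (q + (1 - (q + 1)) : ℂ) = 0 by ring] at hq
  exact ⟨h0, by linear_combination hq⟩

theorem exists_add_euler_eq (hp : 1 ≤ p) {S : ℂ⟦X⟧} (hS : coeff p S = β * coeff 0 S) :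
    ∃ T, S + euler (1 - p : ℂ) T = (1 + C β * X ^ p : ℂ⟦X⟧) * C (coeff 0 S) := by
  refine ⟨PowerSeries.mk fun n => - coeff (n + 1) S / (n + (1 - p)), ?_⟩
  ext n
  rw [map_add, coeff_mul_C, map_add, coeff_C_mul, coeff_X_pow, coeff_one]
  cases n with
  | zero => rw [coeff_zero_euler, if_pos rfl, if_neg (by omega)]; ring
  | succ n =>
    rw [coeff_succ_euler, if_neg n.succ_ne_zero, coeff_mk]
    by_cases hn : n + 1 = p
    · rw [if_pos hn, ← hn, Nat.cast_succ, show (n + (1 - (n + 1)) : ℂ) = 0 by ring, hn, hS]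
      ring
    · have h0 : (n + (1 - p) : ℂ) ≠ 0 := fun h0 =>
        hn (Nat.cast_injective (R := ℂ) (by push_cast; linear_combination h0))
      rw [if_neg hn]
      field_simp
      ring

variable {E : Type*} [AddCommGroup E] [Module ℂ⟦X⟧ E] [ABAction ℂ E]

theorem IsFrame.aOp_sub_smul_two {mu : ℕ → ℂ} {S : ℕ → ℂ⟦X⟧} {e : ℕ → E} (h : IsFrame mu S 2 e)
    (c : ℂ) (A T : ℂ⟦X⟧) :
    aOp ℂ (A • e 2 + T • e 1) - (C c * X : ℂ⟦X⟧) • (A • e 2 + T • e 1) =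
      euler (mu 2 - c) A • e 2 + (A * S 1 + euler (mu 1 - c) T) • e 1 := by
  rw [map_add, h.aOp_smul (by omega), h.aOp_smul (by omega), h.zero, smul_zero, euler_sub,
    euler_sub]
  simp only [smul_add, add_smul, sub_smul, smul_smul, Algebra.algebraMap_self, RingHom.id_apply]
  abel

variable {lam₁ : ℚ} {q : ℕ → ℕ} {S : ℕ → ℂ⟦X⟧} {e : ℕ → E}

theorem lamInv_two (lam₁ : ℚ) (q : ℕ → ℕ) : lamInv lam₁ q 2 = lam₁ + q 1 - 1 := by
  rw [lamInv_succ lam₁ q le_rfl, lamInv_one]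

theorem IsThemeFrame.aOp_sub_smul_second (h : IsThemeFrame lam₁ q 2 S e) (A T : ℂ⟦X⟧) :
    aOp ℂ (A • e 2 + T • e 1) - (C ((lam₁ + q 1 - 1 : ℚ) : ℂ) * X : ℂ⟦X⟧) • (A • e 2 + T • e 1) =
      euler 0 A • e 2 + (A * S 1 + euler (1 - q 1 : ℂ) T) • e 1 := by
  rw [← lamInv_two, h.frame.aOp_sub_smul_two, sub_self, lamInv_two, lamInv_one,
    show (lam₁ - (lam₁ + q 1 - 1 : ℚ) : ℂ) = 1 - q 1 by push_cast; ring]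

theorem IsThemeFrame.aOp_sub_smul_first (h : IsThemeFrame lam₁ q 2 S e) (A T : ℂ⟦X⟧) :
    aOp ℂ (A • e 2 + T • e 1) - (C (lam₁ : ℂ) * X : ℂ⟦X⟧) • (A • e 2 + T • e 1) =
      euler (q 1 - 1 : ℂ) A • e 2 + (A * S 1 + euler 0 T) • e 1 := by
  rw [h.frame.aOp_sub_smul_two, lamInv_two, lamInv_one, sub_self,
    show ((lam₁ + q 1 - 1 : ℚ) - lam₁ : ℂ) = q 1 - 1 by push_cast; ring]

theorem IsThemeFrame.eq_zero_of_smul_add_smul (h : IsThemeFrame lam₁ q 2 S e) {A B : ℂ⟦X⟧}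
    (hAB : A • e 2 + B • e 1 = 0) : A = 0 ∧ B = 0 := by
  have hind := Fintype.linearIndependent_iff.1 h.ind ![B, A]
    (by rw [Fin.sum_univ_two]; exact (add_comm _ _).trans hAB)
  exact ⟨hind 1, hind 0⟩

theorem IsThemeFrame.exists_eq_smul_add_smul (h : IsThemeFrame lam₁ q 2 S e) (m : E) :
    ∃ A B : ℂ⟦X⟧, m = A • e 2 + B • e 1 := by
  have hm : m ∈ flag ℂ⟦X⟧ e 2 := h.span ▸ Submodule.mem_top
  obtain ⟨c, rfl⟩ := mem_flag_iff_exists_sum.1 hm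
  exact ⟨c 1, c 0, by rw [Fin.sum_univ_two]; exact add_comm _ _⟩

theorem IsThemeFrame.ne_zero_of_gen_eq_top (h : IsThemeFrame lam₁ q 2 S e) {A T : ℂ⟦X⟧}
    (hgen : (ABSubmodule.gen (R := ℂ) (A • e 2 + T • e 1)).toSubmodule = ⊤) : A ≠ 0 := by
  rintro rfl
  have hfr : IsFrame _ S 1 e := h.frame.mono (by omega)
  have he : e 2 ∈ flag ℂ⟦X⟧ e 1 := by
    have hle := hfr.gen_le_flag T
    rw [zero_smul, zero_add] at hgen
    exact hle (hgen ▸ Submodule.mem_top)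
  obtain ⟨s, v, hv, hs⟩ := mem_flag_succ.1 he
  rw [flag_zero, Submodule.mem_bot] at hv
  refine one_ne_zero (α := ℂ⟦X⟧) (h.eq_zero_of_smul_add_smul (B := - s) ?_).1
  rw [hs, hv, one_smul, zero_add, add_zero, neg_smul, add_neg_cancel]

/-- The hypotheses say that `A e₂ + T e₁` is annihilated by
`(a - λ₁ b) (1 + β b^p)⁻¹ (a - (λ₁ + p - 1) b)`. -/
theorem IsThemeFrame.exists_add_euler_eq_of_annihilated (h : IsThemeFrame lam₁ q 2 S e)
    (hq : 1 ≤ q 1) {A T : ℂ⟦X⟧} {e₁ : E}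
    (he₁ : e₁ = (1 + C β * X ^ q 1 : ℂ⟦X⟧)⁻¹ • (aOp ℂ (A • e 2 + T • e 1) -
      (C ((lam₁ + q 1 - 1 : ℚ) : ℂ) * X : ℂ⟦X⟧) • (A • e 2 + T • e 1)))
    (hae₁ : aOp ℂ e₁ - (C (lam₁ : ℂ) * X : ℂ⟦X⟧) • e₁ = 0) :
    ∃ c d : ℂ, A = C c ∧
      C c * S 1 + euler (1 - q 1 : ℂ) T = (1 + C β * X ^ q 1 : ℂ⟦X⟧) * C d := by
  set Q : ℂ⟦X⟧ := 1 + C β * X ^ q 1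
  have hQ : Q * Q⁻¹ = 1 := PowerSeries.mul_inv_cancel _
    (by rw [constantCoeff_one_add_C_mul_X_pow hq]; exact one_ne_zero)
  rw [h.aOp_sub_smul_second, smul_add, smul_smul, smul_smul] at he₁
  rw [he₁, h.aOp_sub_smul_first] at hae₁
  obtain ⟨hA, hB⟩ := h.eq_zero_of_smul_add_smul hae₁
  have hQA : Q⁻¹ * euler 0 A = 0 := eq_zero_of_euler_pred hq
    (by rw [coeff_zero_eq_constantCoeff_apply, map_mul,
      ← coeff_zero_eq_constantCoeff_apply (euler 0 A), coeff_zero_euler, mul_zero]) hA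
  rw [hQA, zero_mul, zero_add] at hB
  obtain ⟨c, rfl⟩ : ∃ c, A = C c :=
    ⟨_, eq_C_of_euler_zero (by rw [← one_mul (euler 0 A), ← hQ, mul_assoc, hQA, mul_zero])⟩
  refine ⟨c, coeff 0 (Q⁻¹ * (C c * S 1 + euler (1 - q 1 : ℂ) T)), rfl, ?_⟩
  rw [← eq_C_of_euler_zero hB, ← mul_assoc, hQ, one_mul]

theorem IsThemeFrame.eq_div_of_isParameter (h : IsThemeFrame lam₁ q 2 S e) (hq : 1 ≤ q 1)
    (hβ : IsParameter E lam₁ (q 1) β) : β = coeff (q 1) (S 1) / coeff 0 (S 1) := by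
  obtain ⟨-, -, -, g, hgen, e₁, he₁, hae₁⟩ := hβ
  obtain ⟨A, T, rfl⟩ := h.exists_eq_smul_add_smul g
  obtain ⟨c, d, rfl, hcd⟩ := h.exists_add_euler_eq_of_annihilated hq he₁ hae₁
  have hc : c ≠ 0 := fun hc => h.ne_zero_of_gen_eq_top hgen (by rw [hc, map_zero])
  have hS : coeff 0 (S 1) ≠ 0 :=
    (isUnit_iff_isUnit_coeff_zero.1 (h.isUnit 1 le_rfl (by omega))).ne_zero
  obtain ⟨h0, hp⟩ := coeff_eq_of_add_euler_eq hq hcd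
  rw [coeff_C_mul] at h0 hp
  rw [eq_div_iff hS]
  exact mul_left_cancel₀ hc (by rw [hp, ← h0]; ring)

theorem IsThemeFrame.gen_add_smul_eq_top (h : IsThemeFrame lam₁ q 2 S e) {c T U : ℂ⟦X⟧}
    (hU : IsUnit U) (hc : aOp ℂ (e 2 + T • e 1) - c • (e 2 + T • e 1) = U • e 1) :
    (ABSubmodule.gen (R := ℂ) (e 2 + T • e 1)).toSubmodule = ⊤ := by
  set G := ABSubmodule.gen (R := ℂ) (e 2 + T • e 1)
  have hG : e 2 + T • e 1 ∈ G.toSubmodule := ABSubmodule.self_mem_gen _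
  have h₁ : e 1 ∈ G.toSubmodule := by
    rw [← Submodule.smul_mem_iff_of_isUnit _ hU, ← hc]
    exact sub_mem (G.a_mem _ hG) (Submodule.smul_mem _ _ hG)
  have h₂ : e 2 ∈ G.toSubmodule := (add_mem_cancel_right (Submodule.smul_mem _ T h₁)).1 hG
  rw [eq_top_iff, ← h.span, flag_le_iff]
  intro i hi hi2
  interval_cases i <;> assumption

theorem IsThemeFrame.isParameter_div (h : IsThemeFrame lam₁ q 2 S e) (hq : 1 ≤ q 1) :
    IsParameter E lam₁ (q 1) (coeff (q 1) (S 1) / coeff 0 (S 1)) := by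
  have hS : coeff 0 (S 1) ≠ 0 :=
    (isUnit_iff_isUnit_coeff_zero.1 (h.isUnit 1 le_rfl (by omega))).ne_zero
  set β := coeff (q 1) (S 1) / coeff 0 (S 1) with hβ
  obtain ⟨T, hT⟩ := exists_add_euler_eq (β := β) hq (S := S 1)
    (by rw [hβ, div_mul_cancel₀ _ hS])
  set Q : ℂ⟦X⟧ := 1 + C β * X ^ q 1
  have hQ : Q⁻¹ * Q = 1 := PowerSeries.inv_mul_cancel _
    (by rw [constantCoeff_one_add_C_mul_X_pow hq]; exact one_ne_zero)
  have hg : aOp ℂ (e 2 + T • e 1) -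
      (C ((lam₁ + q 1 - 1 : ℚ) : ℂ) * X : ℂ⟦X⟧) • (e 2 + T • e 1) =
        (Q * C (coeff 0 (S 1))) • e 1 := by
    have := h.aOp_sub_smul_second (C 1) T
    rwa [euler_C, zero_mul, map_zero, zero_mul, zero_smul, zero_add, map_one, one_smul, one_mul,
      hT] at this
  have he₁ : aOp ℂ (C (coeff 0 (S 1)) • e 1) -
      (C (lam₁ : ℂ) * X : ℂ⟦X⟧) • (C (coeff 0 (S 1)) • e 1) = 0 := by
    have := h.aOp_sub_smul_first 0 (C (coeff 0 (S 1)))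
    rwa [euler_C, zero_mul, map_zero, zero_mul, map_zero, zero_mul, zero_add, zero_smul, zero_smul,
      zero_add, zero_add] at this
  have hfree := Module.Free.of_basis (Module.Basis.mk h.ind h.span.ge)
  have hrank : Module.finrank ℂ⟦X⟧ E = 2 := by
    rw [← finrank_top, ← h.span, finrank_flag h.ind le_rfl]
  refine ⟨div_ne_zero (h.isUnit_coeff 1 le_rfl (by omega)).ne_zero hS, hfree, hrank, e 2 + T • e 1,
    ?_, _, ?_, he₁⟩
  · exact h.gen_add_smul_eq_top
      ((IsUnit.of_mul_eq_one_right _ hQ).mul (hS.isUnit.map C)) hg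
  · rw [hg, smul_smul, ← mul_assoc, hQ, one_mul]

theorem IsThemeFrame.isParameter_iff (h : IsThemeFrame lam₁ q 2 S e) (hq : 1 ≤ q 1) (β : ℂ) :
    IsParameter E lam₁ (q 1) β ↔ β = coeff (q 1) (S 1) / coeff 0 (S 1) :=
  ⟨h.eq_div_of_isParameter hq, fun hβ => hβ ▸ h.isParameter_div hq⟩

end Parameter

section Quotient

theorem linearIndependent_mkQ_flag {A M : Type*} [CommRing A] [AddCommGroup M] [Module A M]
    {e : ℕ → M} {k n : ℕ} (he : LinearIndependent A fun i : Fin (k + n) => e (i + 1)) :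
    LinearIndependent A fun i : Fin n => (flag A e k).mkQ (e (k + (i + 1))) := by
  have hn : LinearIndependent A fun i : Fin n => e (k + (i + 1)) :=
    he.comp (Fin.natAdd k) (Fin.natAdd_injective n k)
  refine hn.map ?_
  rw [Submodule.ker_mkQ]
  have hdisj := he.disjoint_span_image (s := Set.range (Fin.natAdd k))
    (t := Set.range (Fin.castAdd n)) ?_
  · rwa [← Set.range_comp, ← Set.range_comp] at hdisj
  · rw [Set.disjoint_left]
    rintro _ ⟨i, rfl⟩ ⟨j, hj⟩
    have := congrArg Fin.val hj
    simp only [Fin.val_castAdd, Fin.val_natAdd] at this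
    omega

theorem lamInv_lamInv (lam₁ : ℚ) (p : ℕ → ℕ) (k : ℕ) {j : ℕ} (hj : 1 ≤ j) :
    lamInv (lamInv lam₁ p (k + 1)) (fun i => p (k + i)) j = lamInv lam₁ p (k + j) := by
  induction j, hj using Nat.le_induction with
  | base => exact lamInv_one _ _
  | succ j hj ih => rw [lamInv_succ _ _ hj, ih, ← add_assoc, lamInv_succ _ _ (by omega)]

variable {E : Type*} [AddCommGroup E] [Module ℂ⟦X⟧ E] [ABAction ℂ E]
  {lam₁ : ℚ} {p : ℕ → ℕ} {k n : ℕ} {S : ℕ → ℂ⟦X⟧} {e : ℕ → E}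

theorem IsThemeFrame.quotient (h : IsThemeFrame lam₁ p (k + n) S e) {F : ABSubmodule ℂ E}
    (hF : F.toSubmodule = flag ℂ⟦X⟧ e k) :
    IsThemeFrame (M := E ⧸ F.toSubmodule) (lamInv lam₁ p (k + 1)) (fun i => p (k + i)) n
      (fun i => S (k + i)) (fun i => F.toSubmodule.mkQ (e (k + i))) where
  frame := by
    refine ⟨?_, fun i hi => ?_⟩
    · rw [add_zero, Submodule.mkQ_apply, Submodule.Quotient.mk_eq_zero, hF]
      exact h.frame.mem_flag_self k
    · have hstep := congrArg F.toSubmodule.mkQ (h.frame.step (k + i) (by omega))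
      rw [map_add, map_smul, map_smul] at hstep
      rw [lamInv_lamInv _ _ _ (by omega)]
      exact hstep
  isUnit i hi hin := h.isUnit _ (by omega) (by omega)
  isUnit_coeff i hi hin := h.isUnit_coeff _ (by omega) (by omega)
  span := by
    rw [eq_top_iff, ← Submodule.range_mkQ, LinearMap.range_eq_map, ← h.span,
      Submodule.map_le_iff_le_comap, flag_le_iff]
    intro i hi hik
    rw [Submodule.mem_comap]
    rcases le_or_gt i k with hi' | hi'
    · rw [Submodule.mkQ_apply, (Submodule.Quotient.mk_eq_zero _).2 (hF ▸ mem_flag hi hi')]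
      exact zero_mem _
    · obtain ⟨l, rfl⟩ := Nat.exists_eq_add_of_le hi'.le
      exact mem_flag (e := fun i => F.toSubmodule.mkQ (e (k + i))) (by omega) (by omega)
  ind := hF ▸ linearIndependent_mkQ_flag h.ind

end Quotient

/-! ### The recursion satisfied by a generator -/

section Recursion

variable {R : Type*} [CommRing R]

theorem coeff_mul_of_X_pow_dvd {n : ℕ} {T : R⟦X⟧} (h : X ^ n ∣ T) (U : R⟦X⟧) :
    coeff n (U * T) = coeff 0 U * coeff n T := by
  obtain ⟨T, rfl⟩ := h
  rw [mul_left_comm]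
  have hU := coeff_X_pow_mul (U * T) n 0
  have hT := coeff_X_pow_mul T n 0
  rw [zero_add] at hU hT
  rw [hU, hT]
  simp

/-- The operator `T ↦ A^j T - ∑ d_i A^i T` with `A = euler c`. If `a^j u = ∑ d_i a^i u` then its
kernel consists of the possible values at `u` of the linear forms `π` with `π ∘ a = A ∘ π`. -/
def recOp (c : R) {j : ℕ} (d : Fin j → R⟦X⟧) : R⟦X⟧ →ₗ[R] R⟦X⟧ :=
  (euler c) ^ j - ∑ i, (LinearMap.mulLeft R (d i)) ∘ₗ (euler c) ^ (i : ℕ)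

theorem recOp_apply (c : R) {j : ℕ} (d : Fin j → R⟦X⟧) (T : R⟦X⟧) :
    recOp c d T = (euler c)^[j] T - ∑ i, d i * (euler c)^[i] T := by
  simp [recOp, Module.End.pow_apply]

theorem map_recOp {R' : Type*} [CommRing R'] (f : R →+* R') (c : R) {j : ℕ} (d : Fin j → R⟦X⟧)
    (T : R⟦X⟧) : PowerSeries.map f (recOp c d T) =
      recOp (f c) (fun i => PowerSeries.map f (d i)) (PowerSeries.map f T) := by
  have h : Function.Semiconj (PowerSeries.map f) (euler c) (euler (f c)) := map_euler f c
  simp only [recOp_apply, map_sub, map_sum, map_mul, (h.iterate_right _).eq]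

end Recursion

section Descent

/-- If `π` is a linear form with `π e_j = t` and `π ∘ a = euler μ_j ∘ π` on `e_2, …, e_j`, where
`e` is a frame with exponents `μ` and structure series `S`, then `π e_{j-l} = descent μ S j t l`. -/
def descent (mu : ℕ → ℂ) (S : ℕ → ℂ⟦X⟧) (j : ℕ) (t : ℂ⟦X⟧) : ℕ → ℂ⟦X⟧
  | 0 => t
  | l + 1 => (S (j - (l + 1)))⁻¹ * euler (mu j - mu (j - l)) (descent mu S j t l)

variable {mu : ℕ → ℂ} {S : ℕ → ℂ⟦X⟧} {j n : ℕ} {t : ℂ⟦X⟧}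

theorem euler_descent_one (l : ℕ) : euler (mu j - mu (j - l)) (descent mu S j 1 l) = 0 := by
  induction l with
  | zero => rw [descent, Nat.sub_zero, sub_self, ← map_one C, euler_C, zero_mul, map_zero, zero_mul]
  | succ l ih => rw [descent, ih, mul_zero, map_zero]

theorem X_pow_dvd_descent (ht : X ^ n ∣ t) (l : ℕ) : X ^ (n + l) ∣ descent mu S j t l := by
  induction l with
  | zero => exact ht
  | succ l ih => exact (X_pow_dvd_euler _ ih).mul_left _

theorem exists_nat_of_step {p : ℕ → ℕ} (hmu : ∀ i, 1 ≤ i → i < j → mu (i + 1) = mu i + p i - 1)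
    {l : ℕ} (hl : l < j) : ∃ m : ℕ, mu j + l = mu (j - l) + m := by
  induction l with
  | zero => exact ⟨0, rfl⟩
  | succ l ih =>
    obtain ⟨m, hm⟩ := ih (by omega)
    have hstep := hmu (j - (l + 1)) (by omega) (by omega)
    rw [show j - (l + 1) + 1 = j - l by omega] at hstep
    refine ⟨m + p (j - (l + 1)), ?_⟩
    push_cast
    linear_combination hm + hstep

/-- The `p i` are nonnegative, so no indicial factor `n + l + μ_j - μ_{j-l}` vanishes. -/
theorem add_sub_ne_zero_of_step {p : ℕ → ℕ}
    (hmu : ∀ i, 1 ≤ i → i < j → mu (i + 1) = mu i + p i - 1) (hn : 1 ≤ n) {l : ℕ} (hl : l < j) :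
    ((n + l : ℕ) : ℂ) + (mu j - mu (j - l)) ≠ 0 := by
  obtain ⟨m, hm⟩ := exists_nat_of_step hmu hl
  have h : ((n + l : ℕ) : ℂ) + (mu j - mu (j - l)) = (n + m : ℕ) := by
    push_cast
    linear_combination hm
  rw [h]
  exact Nat.cast_ne_zero.2 (by omega)

theorem coeff_descent_ne_zero {p : ℕ → ℕ}
    (hmu : ∀ i, 1 ≤ i → i < j → mu (i + 1) = mu i + p i - 1)
    (hS : ∀ i, 1 ≤ i → i < j → IsUnit (S i)) (hn : 1 ≤ n) (ht : X ^ n ∣ t) (htn : coeff n t ≠ 0)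
    {l : ℕ} (hl : l < j) : coeff (n + l) (descent mu S j t l) ≠ 0 := by
  induction l with
  | zero => exact htn
  | succ l ih =>
    rw [descent, ← add_assoc, coeff_mul_of_X_pow_dvd (X_pow_dvd_euler _ (X_pow_dvd_descent ht l)),
      coeff_succ_euler]
    have hunit := isUnit_iff_isUnit_coeff_zero.1 (hS (j - (l + 1)) (by omega) (by omega))
    refine mul_ne_zero ?_
      (mul_ne_zero (add_sub_ne_zero_of_step hmu hn (Nat.lt_of_succ_lt hl)) (ih (by omega)))
    rw [coeff_zero_eq_constantCoeff_apply] at hunit ⊢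
    rw [constantCoeff_inv]
    exact inv_ne_zero hunit.ne_zero

end Descent

section Defect

variable {N : Type*} [AddCommGroup N] [Module ℂ⟦X⟧ N] [ABAction ℂ N] {mu : ℕ → ℂ}
  {S : ℕ → ℂ⟦X⟧} {e : ℕ → N} {j : ℕ} {w : ℂ⟦X⟧} {π : N →ₗ[ℂ⟦X⟧] ℂ⟦X⟧}

/-- The defect of compatibility with `a` of a linear form `π`; although `a` is not linear over
`ℂ[[b]]`, the defect is. -/
def aDefect (c : ℂ) (π : N →ₗ[ℂ⟦X⟧] ℂ⟦X⟧) : N →ₗ[ℂ⟦X⟧] ℂ⟦X⟧ where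
  toFun m := euler c (π m) - π (aOp ℂ m)
  map_add' m n := by simp only [map_add]; ring
  map_smul' T m := by
    rw [aOp_smul, map_add, π.map_smul, π.map_smul, π.map_smul]
    simp only [smul_eq_mul, euler_mul, RingHom.id_apply]
    ring

theorem aDefect_apply (c : ℂ) (π : N →ₗ[ℂ⟦X⟧] ℂ⟦X⟧) (m : N) :
    aDefect c π m = euler c (π m) - π (aOp ℂ m) := rfl

theorem IsFrame.aDefect_succ (h : IsFrame mu S j e) {i : ℕ} (hi : i < j) (c : ℂ) :
    aDefect c π (e (i + 1)) = euler (c - mu (i + 1)) (π (e (i + 1))) - S i * π (e i) := by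
  rw [aDefect_apply, h.step i hi, map_add, map_smul, map_smul, euler_sub]
  simp only [smul_eq_mul, Algebra.algebraMap_self, RingHom.id_apply]
  ring

theorem IsFrame.aDefect_eq_zero_of_descent (h : IsFrame mu S j e)
    (hS : ∀ i, 1 ≤ i → i < j → IsUnit (S i)) {t : ℂ⟦X⟧}
    (hπ : ∀ l < j, π (e (j - l)) = descent mu S j t l) {l : ℕ} (hl : l + 1 < j) :
    aDefect (mu j) π (e (j - l)) = 0 := by
  have hunit := hS (j - (l + 1)) (by omega) (by omega)
  have hi := h.aDefect_succ (π := π) (i := j - (l + 1)) (by omega) (mu j)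
  rw [show j - (l + 1) + 1 = j - l by omega, hπ l (by omega), hπ (l + 1) hl, descent,
    ← mul_assoc, PowerSeries.mul_inv_cancel _ (isUnit_iff_constantCoeff.1 hunit).ne_zero, one_mul,
    sub_self] at hi
  exact hi

theorem IsFrame.iterate_smul_mem_span (h : IsFrame mu S j e) (w : ℂ⟦X⟧) {l : ℕ} (hl : l < j) :
    (aOp ℂ)^[l] (w • e j) ∈ Submodule.span ℂ⟦X⟧ (e '' Set.Icc (j - l) j) := by
  induction l with
  | zero => exact Submodule.smul_mem _ _ (Submodule.subset_span ⟨j, by simp, rfl⟩)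
  | succ l ih =>
    rw [Function.iterate_succ_apply']
    have hmem {i : ℕ} (hi : j - (l + 1) ≤ i) (hij : i ≤ j) :
        e i ∈ Submodule.span ℂ⟦X⟧ (e '' Set.Icc (j - (l + 1)) j) :=
      Submodule.subset_span ⟨i, ⟨hi, hij⟩, rfl⟩
    refine aOp_mem_of_mem_span ?_ ?_ (ih (by omega))
    · rintro _ ⟨i, hi, rfl⟩
      exact hmem (by have := hi.1; omega) hi.2
    · rintro _ ⟨i, ⟨hi, hij⟩, rfl⟩
      obtain ⟨i, rfl⟩ : ∃ i', i = i' + 1 := ⟨i - 1, by omega⟩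
      rw [h.step i hij]
      exact add_mem (Submodule.smul_mem _ _ (hmem (by omega) hij))
        (Submodule.smul_mem _ _ (hmem (by omega) (by omega)))

theorem IsFrame.aDefect_iterate_eq_zero (h : IsFrame mu S j e)
    (hS : ∀ i, 1 ≤ i → i < j → IsUnit (S i)) {t : ℂ⟦X⟧}
    (hπ : ∀ l < j, π (e (j - l)) = descent mu S j t l) {l : ℕ} (hl : l + 1 < j) :
    aDefect (mu j) π ((aOp ℂ)^[l] (w • e j)) = 0 := by
  have hker : Submodule.span ℂ⟦X⟧ (e '' Set.Icc (j - l) j) ≤ LinearMap.ker (aDefect (mu j) π) := by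
    refine Submodule.span_le.2 ?_
    rintro _ ⟨i, ⟨hi, hij⟩, rfl⟩
    have := h.aDefect_eq_zero_of_descent hS hπ (l := j - i) (by omega)
    rwa [Nat.sub_sub_self hij] at this
  exact hker (h.iterate_smul_mem_span w (by omega))

theorem IsFrame.apply_iterate_eq (h : IsFrame mu S j e) (hj : 1 ≤ j)
    (hS : ∀ i, 1 ≤ i → i < j → IsUnit (S i)) {t : ℂ⟦X⟧}
    (hπ : ∀ l < j, π (e (j - l)) = descent mu S j t l) {l : ℕ} (hl : l < j) :
    π ((aOp ℂ)^[l] (w • e j)) = (euler (mu j))^[l] (w * t) := by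
  induction l with
  | zero =>
    rw [Function.iterate_zero_apply, Function.iterate_zero_apply, map_smul, smul_eq_mul]
    exact congrArg _ (hπ 0 hj)
  | succ l ih =>
    have := h.aDefect_iterate_eq_zero (w := w) hS hπ hl
    rw [aDefect_apply, sub_eq_zero, ih (by omega)] at this
    rw [Function.iterate_succ_apply', Function.iterate_succ_apply', this]

/-- Evaluating the defect of `π` at `a^(j-1) (w e_j)`, which is a unit multiple of `e_1` modulo
`e_2, …, e_j`. -/
theorem IsFrame.exists_recOp_eq (h : IsFrame mu S j e) (hj : 1 ≤ j)
    (hS : ∀ i, 1 ≤ i → i < j → IsUnit (S i)) (hw : IsUnit w) {d : Fin j → ℂ⟦X⟧}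
    (hd : ∑ i, d i • (aOp ℂ)^[i] (w • e j) = (aOp ℂ)^[j] (w • e j)) {t : ℂ⟦X⟧}
    (hπ : ∀ l < j, π (e (j - l)) = descent mu S j t l) :
    ∃ s : ℂ⟦X⟧, IsUnit s ∧
      recOp (mu j) d (w * t) = s * euler (mu j - mu 1) (descent mu S j t (j - 1)) := by
  obtain ⟨s, hs, hv⟩ := h.exists_smul_sub_mem_orbitSpan hS hw le_rfl (Nat.add_sub_cancel' hj)
  refine ⟨s, hs, ?_⟩
  set u := w • e j
  have hker : orbitSpan ℂ u (j - 1) ≤ LinearMap.ker (aDefect (mu j) π) :=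
    orbitSpan_le_iff.2 fun l hl => h.aDefect_iterate_eq_zero hS hπ (by omega)
  have hlast : aDefect (mu j) π ((aOp ℂ)^[j - 1] u) = recOp (mu j) d (w * t) := by
    rw [aDefect_apply, h.apply_iterate_eq hj hS hπ (Nat.sub_one_lt_of_lt hj),
      ← Function.iterate_succ_apply' (aOp ℂ), ← Function.iterate_succ_apply' (euler (mu j)),
      show (j - 1).succ = j by omega, ← hd, map_sum, recOp_apply]
    congr 1
    exact Finset.sum_congr rfl fun i _ => by
      rw [map_smul, h.apply_iterate_eq hj hS hπ i.2, smul_eq_mul]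
  have hfirst := h.aDefect_succ (π := π) (i := 0) hj (mu j)
  have hπ1 := hπ (j - 1) (by omega)
  rw [Nat.sub_sub_self hj] at hπ1
  rw [h.zero, map_zero, mul_zero, sub_zero, zero_add, hπ1] at hfirst
  have hdiff := LinearMap.mem_ker.1 (hker hv)
  rwa [map_sub, sub_eq_zero, map_smul, smul_eq_mul, hfirst, hlast, eq_comm] at hdiff

end Defect

section ThemeRecursion

variable {N : Type*} [AddCommGroup N] [Module ℂ⟦X⟧ N] [ABAction ℂ N] {lam₁ : ℚ} {p : ℕ → ℕ}
  {k j : ℕ} {S : ℕ → ℂ⟦X⟧} {e : ℕ → N} {w : ℂ⟦X⟧} {d : Fin j → ℂ⟦X⟧}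

theorem IsThemeFrame.exists_linearMap {R M : Type*} [CommRing R] [Algebra ℂ R] [AddCommGroup M]
    [Module R⟦X⟧ M] [ABAction R M] {S : ℕ → R⟦X⟧} {e : ℕ → M} (h : IsThemeFrame lam₁ p k S e)
    (q : ℕ → R⟦X⟧) : ∃ π : M →ₗ[R⟦X⟧] R⟦X⟧, ∀ i, 1 ≤ i → i ≤ k → π (e i) = q i := by
  let b := Module.Basis.mk h.ind h.span.ge
  refine ⟨b.constr R⟦X⟧ fun i => q (i + 1), fun i hi hik => ?_⟩
  have := b.constr_basis R⟦X⟧ (fun i => q (i + 1)) ⟨i - 1, by omega⟩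
  rwa [show b _ = _ from Module.Basis.mk_apply h.ind h.span.ge _, Nat.sub_add_cancel hi] at this

theorem IsThemeFrame.exists_recOp_eq (h : IsThemeFrame lam₁ p k S e) (hj : 1 ≤ j) (hjk : j ≤ k)
    (hw : IsUnit w) (hd : ∑ i, d i • (aOp ℂ)^[i] (w • e j) = (aOp ℂ)^[j] (w • e j)) (t : ℂ⟦X⟧) :
    ∃ s : ℂ⟦X⟧, IsUnit s ∧ recOp (lamInv lam₁ p j : ℂ) d (w * t) =
      s * euler ((lamInv lam₁ p j : ℂ) - (lamInv lam₁ p 1 : ℂ))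
        (descent (fun i => (lamInv lam₁ p i : ℂ)) S j t (j - 1)) := by
  obtain ⟨π, hπ⟩ := h.exists_linearMap fun i =>
    descent (fun i => (lamInv lam₁ p i : ℂ)) S j t (j - i)
  refine (h.frame.mono hjk).exists_recOp_eq hj (fun i hi hij => h.isUnit i hi (hij.trans_le hjk))
    hw hd (π := π) fun l hl => ?_
  rw [hπ _ (by omega) (by omega), Nat.sub_sub_self hl.le]

theorem IsThemeFrame.recOp_self (h : IsThemeFrame lam₁ p k S e) (hj : 1 ≤ j) (hjk : j ≤ k)
    (hw : IsUnit w) (hd : ∑ i, d i • (aOp ℂ)^[i] (w • e j) = (aOp ℂ)^[j] (w • e j)) :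
    recOp (lamInv lam₁ p j : ℂ) d w = 0 := by
  obtain ⟨s, -, hs⟩ := h.exists_recOp_eq hj hjk hw hd 1
  have h1 := euler_descent_one (mu := fun i => (lamInv lam₁ p i : ℂ)) (S := S) (j := j) (j - 1)
  rw [Nat.sub_sub_self hj] at h1
  rwa [mul_one, h1, mul_zero] at hs

theorem IsThemeFrame.X_pow_dvd_recOp (h : IsThemeFrame lam₁ p k S e) (hj : 1 ≤ j) (hjk : j ≤ k)
    (hw : IsUnit w) (hd : ∑ i, d i • (aOp ℂ)^[i] (w • e j) = (aOp ℂ)^[j] (w • e j)) {n : ℕ}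
    {T : ℂ⟦X⟧} (hT : X ^ n ∣ T) : X ^ (n + j) ∣ recOp (lamInv lam₁ p j : ℂ) d T := by
  obtain ⟨t, rfl⟩ := hw.dvd (a := T)
  obtain ⟨s, -, hs⟩ := h.exists_recOp_eq hj hjk hw hd t
  have hdvd := X_pow_dvd_euler ((lamInv lam₁ p j : ℂ) - (lamInv lam₁ p 1 : ℂ))
    (X_pow_dvd_descent (mu := fun i => (lamInv lam₁ p i : ℂ)) (S := S) (j := j)
      (hw.dvd_mul_left.1 hT) (j - 1))
  rw [add_assoc, Nat.sub_add_cancel hj] at hdvd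
  rw [hs]
  exact hdvd.mul_left s

theorem IsThemeFrame.coeff_recOp_X_pow_ne_zero (h : IsThemeFrame lam₁ p k S e) (hj : 1 ≤ j)
    (hjk : j ≤ k) (hw : IsUnit w)
    (hd : ∑ i, d i • (aOp ℂ)^[i] (w • e j) = (aOp ℂ)^[j] (w • e j)) {n : ℕ} (hn : 1 ≤ n) :
    coeff (n + j) (recOp (lamInv lam₁ p j : ℂ) d (X ^ n)) ≠ 0 := by
  obtain ⟨t, ht⟩ := hw.dvd (a := (X : ℂ⟦X⟧) ^ n)
  have hdvd : X ^ n ∣ t := hw.dvd_mul_left.1 (Dvd.intro 1 (by rw [mul_one, ht]))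
  have htn : coeff n t ≠ 0 := fun h0 => one_ne_zero (α := ℂ) <| by
    rw [← coeff_X_pow_self (R := ℂ) n, ht, coeff_mul_of_X_pow_dvd hdvd, h0, mul_zero]
  obtain ⟨s, hs, heq⟩ := h.exists_recOp_eq hj hjk hw hd t
  have hmu : ∀ i, 1 ≤ i → i < j →
      (lamInv lam₁ p (i + 1) : ℂ) = lamInv lam₁ p i + p i - 1 :=
    fun i hi _ => lamInv_succ_cast lam₁ p hi
  have hX := X_pow_dvd_descent (mu := fun i => (lamInv lam₁ p i : ℂ)) (S := S) (j := j) hdvd (j - 1)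
  have hind := add_sub_ne_zero_of_step (mu := fun i => (lamInv lam₁ p i : ℂ)) hmu hn
    (Nat.sub_one_lt_of_lt hj)
  rw [Nat.sub_sub_self hj] at hind
  rw [ht, heq, show n + j = n + (j - 1) + 1 by omega,
    coeff_mul_of_X_pow_dvd (X_pow_dvd_euler _ hX), coeff_succ_euler]
  exact mul_ne_zero (isUnit_iff_isUnit_coeff_zero.1 hs).ne_zero (mul_ne_zero hind
    (coeff_descent_ne_zero hmu (fun i hi hij => h.isUnit i hi (hij.trans_le hjk)) hn hdvd htn
      (Nat.sub_one_lt_of_lt hj)))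

end ThemeRecursion

/-! ### Families of themes -/

section Recursion

theorem coeff_apply_of_X_pow_dvd {K : Type*} [CommRing K] {L : K⟦X⟧ →ₗ[K] K⟦X⟧} {j : ℕ}
    (hL : ∀ (n : ℕ) (T : K⟦X⟧), X ^ n ∣ T → X ^ (n + j) ∣ L T) {n : ℕ} {T : K⟦X⟧}
    (hT : X ^ n ∣ T) : coeff (n + j) (L T) = coeff n T * coeff (n + j) (L (X ^ n)) := by
  have hdvd : X ^ (n + 1) ∣ T - coeff n T • X ^ n := by
    rw [X_pow_dvd_iff] at hT ⊢
    intro i hi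
    rcases Nat.lt_succ_iff_lt_or_eq.1 hi with hi | rfl
    · rw [map_sub, hT i hi, coeff_smul, coeff_X_pow, if_neg hi.ne, smul_zero, sub_zero]
    · rw [map_sub, coeff_smul, coeff_X_pow_self, smul_eq_mul, mul_one, sub_self]
  have hzero := X_pow_dvd_iff.1 (hL _ _ hdvd) (n + j) (by omega)
  rwa [map_sub, map_smul, map_sub, coeff_smul, smul_eq_mul, sub_eq_zero] at hzero

variable {R K Pt : Type*} [CommRing R] [CommRing K] [IsDomain K] {ev : Pt → R →+* K}
  {L : R⟦X⟧ →ₗ[R] R⟦X⟧} {Lx : Pt → K⟦X⟧ →ₗ[K] K⟦X⟧} {j : ℕ} {T : Pt → K⟦X⟧}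

theorem exists_X_pow_succ_dvd_sub_map {m : ℕ}
    (hmap : ∀ x T, PowerSeries.map (ev x) (L T) = Lx x (PowerSeries.map (ev x) T))
    (hdvd : ∀ x (n : ℕ) (T : K⟦X⟧), X ^ n ∣ T → X ^ (n + j) ∣ Lx x T)
    (hunit : IsUnit (coeff (m + j) (L (X ^ m)))) (hT : ∀ x, Lx x (T x) = 0) {P : R⟦X⟧}
    (hP : ∀ x, X ^ m ∣ T x - PowerSeries.map (ev x) P) :
    ∃ Q : R⟦X⟧, ∀ x, X ^ (m + 1) ∣ T x - PowerSeries.map (ev x) Q := by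
  obtain ⟨c, hc⟩ := hunit
  set r : R := -(↑c⁻¹ * coeff (m + j) (L P))
  have hPr : coeff (m + j) (L (P + r • X ^ m)) = 0 := by
    rw [map_add, map_add, map_smul, coeff_smul, smul_eq_mul, ← hc, neg_mul, mul_right_comm,
      Units.inv_mul, one_mul, add_neg_cancel]
  refine ⟨P + r • X ^ m, fun x => ?_⟩
  have hmapX : PowerSeries.map (ev x) (X ^ m) = X ^ m := by rw [map_pow, map_X]
  set D := T x - PowerSeries.map (ev x) (P + r • X ^ m) with hD
  have hDm : X ^ m ∣ D := by
    rw [hD, map_add, ← sub_sub, smul_eq_C_mul, map_mul, hmapX]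
    exact dvd_sub (hP x) (dvd_mul_left _ _)
  have hDL : coeff (m + j) (Lx x D) = 0 := by
    rw [hD, map_sub, hT, ← hmap, zero_sub, map_neg, coeff_map, hPr, map_zero, neg_zero]
  rw [coeff_apply_of_X_pow_dvd (hdvd x) hDm, ← hmapX, ← hmap, coeff_map, ← hc] at hDL
  have hcoeff := (mul_eq_zero.1 hDL).resolve_right (c.isUnit.map (ev x)).ne_zero
  refine X_pow_dvd_iff.2 fun i hi => ?_
  rcases Nat.lt_succ_iff_lt_or_eq.1 hi with hi | rfl
  · exact X_pow_dvd_iff.1 hDm i hi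
  · exact hcoeff

/-- Each coefficient is found from the previous ones by solving a linear equation whose leading
coefficient is an invertible function. -/
theorem exists_map_eq_of_recursion
    (hmap : ∀ x T, PowerSeries.map (ev x) (L T) = Lx x (PowerSeries.map (ev x) T))
    (hdvd : ∀ x (n : ℕ) (T : K⟦X⟧), X ^ n ∣ T → X ^ (n + j) ∣ Lx x T)
    (hunit : ∀ n, 1 ≤ n → IsUnit (coeff (n + j) (L (X ^ n))))
    (hT : ∀ x, Lx x (T x) = 0) (hT0 : ∀ x, coeff 0 (T x) = 1) :
    ∃ T' : R⟦X⟧, ∀ x, PowerSeries.map (ev x) T' = T x := by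
  have happrox (n : ℕ) : ∃ P : R⟦X⟧, ∀ x, X ^ (n + 1) ∣ T x - PowerSeries.map (ev x) P := by
    induction n with
    | zero => exact ⟨1, fun x => by simpa [X_dvd_iff, sub_eq_zero] using hT0 x⟩
    | succ n ih =>
      obtain ⟨P, hP⟩ := ih
      exact exists_X_pow_succ_dvd_sub_map hmap hdvd (hunit _ n.succ_pos) hT hP
  choose P hP using happrox
  refine ⟨PowerSeries.mk fun n => coeff n (P n), fun x => PowerSeries.ext fun n => ?_⟩
  have hcoeff := X_pow_dvd_iff.1 (hP n x) n (Nat.lt_succ_self n)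
  rw [map_sub, sub_eq_zero, coeff_map] at hcoeff
  rw [coeff_map, coeff_mk, hcoeff]

end Recursion

section Rescaling

variable {N : Type*} [AddCommGroup N] [Module ℂ⟦X⟧ N] [ABAction ℂ N] {lam₁ : ℚ} {p : ℕ → ℕ}
  {k : ℕ} {S S' : ℕ → ℂ⟦X⟧} {e e' : ℕ → N} {c : ℕ → ℂ}

theorem IsThemeFrame.mul_C_eq_of_eq_C_smul (h : IsThemeFrame lam₁ p k S e)
    (h' : IsFrame (fun i => (lamInv lam₁ p i : ℂ)) S' k e') (hc : ∀ i ≤ k, e' i = C (c i) • e i)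
    {i : ℕ} (hi : 1 ≤ i) (hik : i < k) : S' i * C (c i) = C (c (i + 1)) * S i := by
  have hstep := h'.step i hik
  rw [hc _ hik, hc _ hik.le, h.frame.aOp_smul hik, euler_C, smul_smul, smul_smul, map_mul,
    mul_right_comm (C _) X, Algebra.algebraMap_self_apply, add_right_inj] at hstep
  obtain ⟨i, rfl⟩ := Nat.exists_eq_add_of_le' hi
  exact (h.ind.smul_left_injective ⟨i, by omega⟩ hstep).symm

theorem IsThemeFrame.of_eq_C_smul (h : IsThemeFrame lam₁ p k S e)
    (h' : IsFrame (fun i => (lamInv lam₁ p i : ℂ)) S' k e')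
    (hc : ∀ i ≤ k, c i ≠ 0 ∧ e' i = C (c i) • e i) : IsThemeFrame lam₁ p k S' e' := by
  have hunit (i : ℕ) (hi : i ≤ k) : IsUnit (C (c i) : ℂ⟦X⟧) := (IsUnit.mk0 _ (hc i hi).1).map C
  have hmul (i : ℕ) (hi : 1 ≤ i) (hik : i < k) :=
    h.mul_C_eq_of_eq_C_smul h' (fun i hi => (hc i hi).2) hi hik
  have hspan : flag ℂ⟦X⟧ e' k = ⊤ := by
    refine top_le_iff.1 (h.span.symm.le.trans (flag_le_iff.2 fun i hi hik => ?_))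
    rw [← Submodule.smul_mem_iff_of_isUnit _ (hunit i hik), ← (hc i hik).2]
    exact mem_flag hi hik
  refine ⟨h', fun i hi hik => ?_, fun i hi hik => ?_, hspan,
    linearIndependent_of_span_eq h.ind (hspan.trans h.span.symm)⟩
  · exact isUnit_of_mul_isUnit_left
      (hmul i hi hik ▸ (hunit (i + 1) hik).mul (h.isUnit i hi hik))
  · have hcoeff := congrArg (coeff (p i)) (hmul i hi hik)
    rw [coeff_mul_C, coeff_C_mul] at hcoeff
    exact isUnit_of_mul_isUnit_left
      (hcoeff ▸ (IsUnit.mk0 _ (hc (i + 1) hik).1).mul (h.isUnit_coeff i hi hik))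

end Rescaling

section FibreFamily

variable {R : Type*} [CommRing R] [Algebra ℂ R] {Pt : Type*} {M : Type*} [AddCommGroup M]
  [Module R⟦X⟧ M] [ABAction R M] {N : Pt → Type*} [∀ x, AddCommGroup (N x)]
  [∀ x, Module ℂ⟦X⟧ (N x)] [∀ x, ABAction ℂ (N x)]

/-- `R` is a ring of functions on `Pt` in which the nowhere vanishing functions are invertible,
`M` is a free `R[[b]]`-module with basis `f`, and the maps `val x` make `N x` its fibre at `x`.
This is what is left of a sheaf and its fibres after restriction to a small open set. -/
structure IsFibreFamily (ev : Pt → R →ₐ[ℂ] ℂ) (val : ∀ x, M →+ N x) {k : ℕ}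
    (f : Module.Basis (Fin k) R⟦X⟧ M) : Prop where
  sep : ∀ r, (∀ x, ev x r = 0) → r = 0
  unit : ∀ r, (∀ x, ev x r ≠ 0) → IsUnit r
  val_smul : ∀ x (S : R⟦X⟧) m, val x (S • m) = PowerSeries.map (ev x).toRingHom S • val x m
  val_a : ∀ x m, val x (aOp R m) = aOp ℂ (val x m)
  ind : ∀ x, LinearIndependent ℂ⟦X⟧ (val x ∘ f)
  span : ∀ x, Submodule.span ℂ⟦X⟧ (Set.range (val x ∘ f)) = ⊤

variable {ev : Pt → R →ₐ[ℂ] ℂ} {val : ∀ x, M →+ N x} {k : ℕ} {f : Module.Basis (Fin k) R⟦X⟧ M}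

theorem IsFibreFamily.series_eq_zero (hf : IsFibreFamily ev val f) {S : R⟦X⟧}
    (h : ∀ x, PowerSeries.map (ev x).toRingHom S = 0) : S = 0 :=
  PowerSeries.ext fun n => hf.sep _ fun x => by simpa using congrArg (coeff n) (h x)

theorem IsFibreFamily.isUnit_series (hf : IsFibreFamily ev val f) {S : R⟦X⟧}
    (h : ∀ x, IsUnit (PowerSeries.map (ev x).toRingHom S)) : IsUnit S := by
  rw [isUnit_iff_isUnit_coeff_zero]
  refine hf.unit _ fun x => ?_
  have := (isUnit_iff_isUnit_coeff_zero.1 (h x)).ne_zero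
  rwa [coeff_map] at this

theorem IsFibreFamily.val_iterate (hf : IsFibreFamily ev val f) (x : Pt) (l : ℕ) (m : M) :
    val x ((aOp R)^[l] m) = (aOp ℂ)^[l] (val x m) :=
  Function.Semiconj.iterate_right (f := val x) (hf.val_a x) l m

theorem IsFibreFamily.val_sum (hf : IsFibreFamily ev val f) (x : Pt) {ι : Type*} (s : Finset ι)
    (c : ι → R⟦X⟧) (m : ι → M) : val x (∑ i ∈ s, c i • m i) =
      ∑ i ∈ s, PowerSeries.map (ev x).toRingHom (c i) • val x (m i) := by
  simp only [map_sum, hf.val_smul]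

theorem IsFibreFamily.val_mem_span (hf : IsFibreFamily ev val f) (x : Pt) {ι : Type*} {v : ι → M}
    {m : M} (hm : m ∈ Submodule.span R⟦X⟧ (Set.range v)) :
    val x m ∈ Submodule.span ℂ⟦X⟧ (Set.range (val x ∘ v)) := by
  induction hm using Submodule.span_induction with
  | mem m hm => obtain ⟨i, rfl⟩ := hm; exact Submodule.subset_span ⟨i, rfl⟩
  | zero => rw [map_zero]; exact zero_mem _
  | add m m' _ _ hm hm' => rw [map_add]; exact add_mem hm hm'
  | smul T m _ hm => rw [hf.val_smul]; exact Submodule.smul_mem _ _ hm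

/-- The basis of the fibre given by the values of the basis `f`. -/
def IsFibreFamily.basis (hf : IsFibreFamily ev val f) (x : Pt) :
    Module.Basis (Fin k) ℂ⟦X⟧ (N x) := Module.Basis.mk (hf.ind x) (hf.span x).ge

theorem IsFibreFamily.basis_repr (hf : IsFibreFamily ev val f) (x : Pt) (m : M) (i : Fin k) :
    (hf.basis x).repr (val x m) i = PowerSeries.map (ev x).toRingHom (f.repr m i) := by
  have h : val x m = ∑ i, PowerSeries.map (ev x).toRingHom (f.repr m i) • hf.basis x i := by
    conv_lhs => rw [← f.sum_repr m]
    rw [hf.val_sum]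
    refine Finset.sum_congr rfl fun i _ => ?_
    rw [IsFibreFamily.basis, Module.Basis.mk_apply, Function.comp_apply]
  rw [h, Module.Basis.repr_sum_self]

theorem IsFibreFamily.map_det (hf : IsFibreFamily ev val f) (m : Fin k → M) (x : Pt) :
    PowerSeries.map (ev x).toRingHom (f.det m) = (hf.basis x).det (val x ∘ m) := by
  rw [Module.Basis.det_apply, Module.Basis.det_apply, RingHom.map_det]
  congr 1
  ext1 i j
  rw [RingHom.mapMatrix_apply, Matrix.map_apply, Module.Basis.toMatrix_apply,
    Module.Basis.toMatrix_apply, Function.comp_apply, hf.basis_repr]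

theorem IsFibreFamily.basis_of_fibre (hf : IsFibreFamily ev val f) (m : Fin k → M)
    (h : ∀ x, LinearIndependent ℂ⟦X⟧ (val x ∘ m) ∧
      Submodule.span ℂ⟦X⟧ (Set.range (val x ∘ m)) = ⊤) :
    LinearIndependent R⟦X⟧ m ∧ Submodule.span R⟦X⟧ (Set.range m) = ⊤ := by
  rw [Module.Basis.is_basis_iff_det f]
  refine hf.isUnit_series fun x => ?_
  rw [hf.map_det, ← Module.Basis.is_basis_iff_det (hf.basis x)]
  exact h x

variable {lam₁ : ℚ} {p : ℕ → ℕ} {Sb : Pt → ℕ → ℂ⟦X⟧} {eb : ∀ x, ℕ → N x} {j : ℕ} {u : M}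
  {w : Pt → ℂ⟦X⟧}

theorem IsFibreFamily.exists_normalisation (hf : IsFibreFamily ev val f)
    (hb : ∀ x, IsThemeFrame lam₁ p k (Sb x) (eb x)) (hj : 1 ≤ j) (hjk : j ≤ k)
    (hw : ∀ x, IsUnit (w x)) (hu : ∀ x, val x u = w x • eb x j)
    (ha : (aOp R)^[j] u ∈ orbitSpan R u j) :
    ∃ T : R⟦X⟧, IsUnit T ∧ ∀ x, w x = C (coeff 0 (w x)) * PowerSeries.map (ev x).toRingHom T := by
  obtain ⟨d, hd⟩ := (Submodule.mem_span_range_iff_exists_fun _).1 ha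
  have hdx (x : Pt) : ∑ i, PowerSeries.map (ev x).toRingHom (d i) • (aOp ℂ)^[i] (w x • eb x j) =
      (aOp ℂ)^[j] (w x • eb x j) := by
    simpa only [hf.val_sum, hf.val_iterate, hu] using congrArg (val x) hd
  have hmap (x : Pt) (T : R⟦X⟧) :
      PowerSeries.map (ev x).toRingHom (recOp (algebraMap ℂ R (lamInv lam₁ p j)) d T) =
        recOp (lamInv lam₁ p j : ℂ) (fun i => PowerSeries.map (ev x).toRingHom (d i))
          (PowerSeries.map (ev x).toRingHom T) :=
    (map_recOp (ev x).toRingHom _ d T).trans (by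
      rw [show (ev x).toRingHom (algebraMap ℂ R (lamInv lam₁ p j)) = lamInv lam₁ p j from
        (ev x).commutes _])
  have hw0 (x : Pt) : coeff 0 (w x) ≠ 0 := (isUnit_iff_isUnit_coeff_zero.1 (hw x)).ne_zero
  have hT0 (x : Pt) : coeff 0 ((coeff 0 (w x))⁻¹ • w x) = 1 := by
    rw [coeff_smul, smul_eq_mul, inv_mul_cancel₀ (hw0 x)]
  obtain ⟨T, hT⟩ := exists_map_eq_of_recursion (ev := fun x => (ev x).toRingHom) hmap
    (fun x _ _ hT => (hb x).X_pow_dvd_recOp hj hjk (hw x) (hdx x) hT)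
    (fun n hn => hf.unit _ fun x => by
      have hne := (hb x).coeff_recOp_X_pow_ne_zero hj hjk (hw x) (hdx x) hn
      rwa [← map_X (ev x).toRingHom, ← map_pow, ← hmap, coeff_map] at hne)
    (T := fun x => (coeff 0 (w x))⁻¹ • w x)
    (fun x => by rw [map_smul, (hb x).recOp_self hj hjk (hw x) (hdx x), smul_zero]) hT0
  refine ⟨T, hf.isUnit_series fun x => ?_, fun x => ?_⟩
  · rw [hT, isUnit_iff_isUnit_coeff_zero, hT0]
    exact isUnit_one
  · rw [hT, ← smul_eq_C_mul, smul_smul, mul_inv_cancel₀ (hw0 x), one_smul]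

theorem IsFibreFamily.val_eq_of_aOp_eq (hf : IsFibreFamily ev val f) {x : Pt}
    (hb : IsThemeFrame lam₁ p k (Sb x) (eb x)) (hjk : j < k) {e : M}
    (hae : aOp R e = (C (algebraMap ℂ R (lamInv lam₁ p (j + 1) : ℚ)) * X : R⟦X⟧) • e + u) {z : ℂ}
    (he : val x e = C z • eb x (j + 1)) : val x u = (C z * Sb x j) • eb x j := by
  have hev : (ev x).toRingHom (algebraMap ℂ R (lamInv lam₁ p (j + 1) : ℚ)) =
    (lamInv lam₁ p (j + 1) : ℚ) := (ev x).commutes _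
  rw [eq_sub_of_add_eq' hae.symm, map_sub, hf.val_a, hf.val_smul, map_mul, map_X, map_C, hev, he,
    hb.frame.aOp_smul hjk, euler_C, smul_smul, map_mul, mul_right_comm,
    Algebra.algebraMap_self_apply, add_sub_cancel_left]

/-- Dividing out `e_{j+1}`: the relation between the iterates of a multiple of `e` at order `j + 1`
gives one between the iterates of `a e - c e` at order `j`. -/
theorem IsFibreFamily.iterate_mem_orbitSpan_of_succ (hf : IsFibreFamily ev val f)
    (hb : ∀ x, IsThemeFrame lam₁ p k (Sb x) (eb x)) (hjk : j < k) {c T : R⟦X⟧} (hT : IsUnit T)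
    {e : M} (hae : aOp R e = c • e + u)
    (ha : (aOp R)^[j + 1] (T • e) ∈ orbitSpan R (T • e) (j + 1))
    (he : ∀ x, ∃ z : ℂ, z ≠ 0 ∧ val x e = C z • eb x (j + 1)) (hu : ∀ x, val x u = w x • eb x j) :
    (aOp R)^[j] u ∈ orbitSpan R u j := by
  have hemem : e ∈ orbitSpan R (T • e) (j + 1) :=
    (Submodule.smul_mem_iff_of_isUnit _ hT).1 (iterate_mem_orbitSpan (l := 0) j.succ_pos)
  have humem : (aOp R)^[j] u ∈ orbitSpan R (T • e) (j + 1) := by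
    have hmaps : Set.MapsTo (aOp R) (orbitSpan R (T • e) (j + 1) : Set M)
      (orbitSpan R (T • e) (j + 1)) := fun m hm => aOp_mem_orbitSpan ha hm
    refine hmaps.iterate j ?_
    rw [← sub_eq_iff_eq_add'.2 hae]
    exact sub_mem (aOp_mem_orbitSpan ha hemem) (Submodule.smul_mem _ _ hemem)
  have hle : orbitSpan R (T • e) (j + 1) ≤ Submodule.span R⟦X⟧ {e} ⊔ orbitSpan R u j := by
    refine orbitSpan_le_iff.2 fun l hl => ?_
    obtain ⟨s, hs⟩ := exists_iterate_sub_smul_mem_orbitSpan hae T l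
    exact Submodule.mem_sup.2 ⟨s • e, Submodule.smul_mem _ _ (Submodule.mem_span_singleton_self e),
      _, orbitSpan_mono (Nat.lt_succ_iff.1 hl) hs, add_sub_cancel _ _⟩
  obtain ⟨_, hs, v, hv, hsv⟩ := Submodule.mem_sup.1 (hle humem)
  obtain ⟨s, rfl⟩ := Submodule.mem_span_singleton.1 hs
  suffices hs0 : s = 0 by rwa [← hsv, hs0, zero_smul, zero_add]
  refine hf.series_eq_zero fun x => ?_
  obtain ⟨z, hz, hze⟩ := he x
  have horbit : (ABSubmodule.gen (R := ℂ) (val x u)).toSubmodule ≤ flag ℂ⟦X⟧ (eb x) j := by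
    rw [hu]
    exact ((hb x).frame.mono hjk.le).gen_le_flag (w x)
  have hvmem : val x v ∈ flag ℂ⟦X⟧ (eb x) j := by
    have hvx := hf.val_mem_span x hv
    simp only [Function.comp_def, hf.val_iterate] at hvx
    exact horbit (orbitSpan_le_gen hvx)
  have hsmem : PowerSeries.map (ev x).toRingHom s • val x e ∈ flag ℂ⟦X⟧ (eb x) j := by
    rw [← hf.val_smul, eq_sub_of_add_eq hsv, map_sub, hf.val_iterate]
    exact sub_mem (horbit (Submodule.subset_span ⟨j, rfl⟩)) hvmem
  rw [hze, smul_smul] at hsmem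
  have hsz := eq_zero_of_smul_mem_flag (hb x).ind hjk hsmem
  exact (mul_eq_zero.1 hsz).resolve_right (((IsUnit.mk0 z hz).map C).ne_zero)

theorem IsFibreFamily.exists_frame_of_iterate_mem (hf : IsFibreFamily ev val f)
    (hb : ∀ x, IsThemeFrame lam₁ p k (Sb x) (eb x)) (hjk : j ≤ k)
    (hw : 1 ≤ j → ∀ x, IsUnit (w x)) (hu : ∀ x, val x u = w x • eb x j)
    (ha : (aOp R)^[j] u ∈ orbitSpan R u j) :
    ∃ (S : ℕ → R⟦X⟧) (e : ℕ → M), IsFrame (fun i => (lamInv lam₁ p i : ℂ)) S j e ∧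
      (∃ T : R⟦X⟧, u = T • e j) ∧
      ∀ x, ∃ c : ℕ → ℂ, ∀ i ≤ j, c i ≠ 0 ∧ val x (e i) = C (c i) • eb x i := by
  induction j generalizing u w with
  | zero =>
    have hu0 : u = 0 := by simpa [orbitSpan] using ha
    refine ⟨0, 0, ⟨rfl, by simp⟩, ⟨0, by rw [hu0, zero_smul]⟩, fun x => ⟨1, fun i hi => ?_⟩⟩
    rw [Nat.le_zero.1 hi, (hb x).frame.zero, smul_zero]
    exact ⟨one_ne_zero, map_zero _⟩
  | succ j ih =>
    have hw' := hw j.succ_pos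
    obtain ⟨_, ⟨T, rfl⟩, hwT⟩ := hf.exists_normalisation hb j.succ_pos hjk hw' hu ha
    set c : Pt → ℂ := fun x => coeff 0 (w x)
    have hc (x : Pt) : c x ≠ 0 := (isUnit_iff_isUnit_coeff_zero.1 (hw' x)).ne_zero
    obtain ⟨e', rfl⟩ : ∃ e', u = (T : R⟦X⟧) • e' := ⟨(↑T⁻¹ : R⟦X⟧) • u, by simp [smul_smul]⟩
    have he' (x : Pt) : val x e' = (C (c x) : ℂ⟦X⟧) • eb x (j + 1) := by
      have hTx := hu x
      rw [hf.val_smul, hwT, mul_comm, mul_smul] at hTx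
      exact (T.isUnit.map (PowerSeries.map (ev x).toRingHom)).smul_left_cancel.1 hTx
    obtain ⟨u', hau⟩ : ∃ u', aOp R e' =
        (C (algebraMap ℂ R (lamInv lam₁ p (j + 1) : ℚ)) * X : R⟦X⟧) • e' + u' :=
      ⟨_, (add_sub_cancel _ _).symm⟩
    have hu' (x : Pt) := hf.val_eq_of_aOp_eq (hb x) hjk hau (he' x)
    obtain ⟨S, e, hfr, ⟨T', rfl⟩, hval⟩ := ih (w := fun x => C (c x) * Sb x j) (by omega)
      (fun hj x => ((IsUnit.mk0 _ (hc x)).map C).mul ((hb x).isUnit j hj hjk)) hu'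
      (hf.iterate_mem_orbitSpan_of_succ hb hjk T.isUnit hau ha (fun x => ⟨_, hc x, he' x⟩) hu')
    refine ⟨_, _, hfr.update hau, ⟨T, by rw [Function.update_self]⟩, fun x => ?_⟩
    obtain ⟨d, hd⟩ := hval x
    refine ⟨Function.update d (j + 1) (c x), fun i hi => ?_⟩
    rcases Nat.le_succ_iff.1 hi with hi | rfl
    · simpa only [Function.update_of_ne (Nat.lt_succ_of_le hi).ne] using hd i hi
    · simpa only [Function.update_self] using ⟨hc x, he' x⟩

theorem IsFibreFamily.exists_themeFrame (hf : IsFibreFamily ev val f)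
    (hb : ∀ x, IsThemeFrame lam₁ p k (Sb x) (eb x)) {g : M}
    (hg : ∀ x, ∃ w : ℂ⟦X⟧, IsUnit w ∧ val x g = w • eb x k) :
    ∃ (S : ℕ → R⟦X⟧) (e : ℕ → M), IsThemeFrame lam₁ p k S e ∧
      ∀ x, IsThemeFrame lam₁ p k (fun i => PowerSeries.map (ev x).toRingHom (S i))
        (fun i => val x (e i)) := by
  choose w hw hgw using hg
  have horbit : orbitSpan R g k = ⊤ := by
    refine (hf.basis_of_fibre (fun i : Fin k => (aOp R)^[i] g) fun x => ?_).2
    simp only [Function.comp_def, hf.val_iterate, hgw]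
    exact ⟨(hb x).frame.linearIndependent_iterate (hb x).isUnit (hw x) (hb x).ind,
      ((hb x).frame.orbitSpan_eq_flag (hb x).isUnit (hw x)).trans (hb x).span⟩
  obtain ⟨S, e, hfr, -, hval⟩ := hf.exists_frame_of_iterate_mem hb le_rfl (fun _ => hw) hgw
    (horbit ▸ Submodule.mem_top)
  have hx (x : Pt) : IsThemeFrame lam₁ p k (fun i => PowerSeries.map (ev x).toRingHom (S i))
      (fun i => val x (e i)) := by
    obtain ⟨c, hc⟩ := hval x
    exact (hb x).of_eq_C_smul (hfr.map (ev x) (val x) (hf.val_smul x) (hf.val_a x)) hc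
  have hbasis := hf.basis_of_fibre (fun i : Fin k => e (i + 1)) fun x => ⟨(hx x).ind, (hx x).span⟩
  refine ⟨S, e, ⟨hfr, fun i hi hik => hf.isUnit_series fun x => (hx x).isUnit i hi hik,
    fun i hi hik => hf.unit _ fun x => ?_, hbasis.2, hbasis.1⟩, hx⟩
  have hcoeff := ((hx x).isUnit_coeff i hi hik).ne_zero
  rwa [coeff_map] at hcoeff

end FibreFamily

/-! ### Frames of `Ξ` -/

section XiFrame

variable {R : Type*} [CommRing R]

theorem exists_mul_add_succ_eq {c : R} (hc : IsUnit c) {ρ : ℕ → R} {j : ℕ}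
    (hρ : ∀ l ≥ j, ρ l = 0) :
    ∃ y : ℕ → R, (∀ l, c * y l + y (l + 1) = ρ l) ∧ ∀ l, (∀ i ≥ l, ρ i = 0) → y l = 0 := by
  obtain ⟨d, hcd⟩ := hc.exists_right_inv
  refine ⟨fun l => ∑ t ∈ Finset.range j, (-d) ^ t * d * ρ (l + t), fun l => ?_, fun l hl => ?_⟩
  · have htelescope (t : ℕ) : c * ((-d) ^ t * d * ρ (l + t)) + (-d) ^ t * d * ρ (l + 1 + t) =
        (-d) ^ t * ρ (l + t) - (-d) ^ (t + 1) * ρ (l + (t + 1)) := by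
      rw [show l + 1 + t = l + (t + 1) by omega]
      linear_combination (-d) ^ t * ρ (l + t) * hcd
    rw [Finset.mul_sum, ← Finset.sum_add_distrib, Finset.sum_congr rfl fun t _ => htelescope t,
      Finset.sum_range_sub', hρ (l + j) (Nat.le_add_left j l), mul_zero, sub_zero, pow_zero,
      one_mul, add_zero]
  · exact Finset.sum_eq_zero fun t _ => by rw [hl _ (Nat.le_add_right l t), mul_zero]

variable {lam : ℚ} {N k : ℕ}

theorem Xi.exists_comp_eq {w : ℕ → R⟦X⟧} (hw : ∀ l > N, w l = 0) :
    ∃ v : Xi R {lam} N, ∀ l, Xi.comp l v = w l := by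
  let v : Xi R {lam} N := fun _ i => w i
  refine ⟨v, fun l => ?_⟩
  by_cases hl : l < N + 1
  · exact Xi.comp_of_lt hl v
  · rw [Xi.comp_eq_zero v (by omega), hw l (by omega)]

/-- `v` involves only `e_{lam,0}, …, e_{lam,j}`, and its coefficient on `e_{lam,j}` is a unit times
a power of `b`. -/
def Xi.HasLeadingTerm (v : Xi R {lam} N) (j m : ℕ) : Prop :=
  (∀ l > j, Xi.comp l v = 0) ∧ ∃ c : R, IsUnit c ∧ Xi.comp j v = C c * X ^ m

/-- `v 1, …, v k` is triangular with respect to `e_{lam,0}, …, e_{lam,k-1}`, with units times powers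
of `b` on the diagonal. -/
def IsTriangular (k : ℕ) (v : ℕ → Xi R {lam} N) : Prop :=
  ∀ j < k, ∃ m, (v (j + 1)).HasLeadingTerm j m

theorem IsTriangular.linearIndependent {v : ℕ → Xi R {lam} N} (h : IsTriangular k v) :
    LinearIndependent R⟦X⟧ fun i : Fin k => v (i + 1) := by
  induction k with
  | zero => exact linearIndependent_empty_type
  | succ k ih =>
    refine Fintype.linearIndependent_iff.2 fun g hg => ?_
    obtain ⟨m, -, c, hc, hlead⟩ := h k k.lt_succ_self
    have hlast : g (Fin.last k) = 0 := by
      have hcomp := congrArg (Xi.comp k) hg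
      rw [map_sum, Fin.sum_univ_castSucc, map_zero, Finset.sum_eq_zero, zero_add, map_smul,
        Fin.val_last, hlead, smul_eq_mul, ← mul_assoc] at hcomp
      · exact (hc.map C).mul_left_eq_zero.1 (mul_X_pow_cancel (hcomp.trans (zero_mul _).symm))
      · intro i _
        obtain ⟨-, hzero, -⟩ := h i (i.2.trans k.lt_succ_self)
        rw [map_smul, Fin.val_castSucc, hzero k i.2, smul_zero]
    rw [Fin.sum_univ_castSucc, hlast, zero_smul, add_zero] at hg
    have hg' := Fintype.linearIndependent_iff.1 (ih fun i hi => h i (by omega)) _ hg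
    exact Fin.lastCases hlast hg'

variable [Algebra ℂ R]

theorem exists_natCast_sub_mul_add_succ_eq {ρ : ℕ → R} {j : ℕ} (hρ : ∀ l > j, ρ l = 0) (n m : ℕ) :
    ∃ y : ℕ → R, (∀ l, ((n : R) - m) * y l + y (l + 1) = ρ l) ∧
      (∀ l, (∀ i, l ≤ i + 1 → ρ i = 0) → y l = 0) ∧ y (j + 1) = if n = m then ρ j else 0 := by
  rcases eq_or_ne n m with rfl | hnm
  · refine ⟨fun l => l.casesOn 0 ρ, fun l => ?_, fun l hl => ?_, (if_pos rfl).symm⟩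
    · rw [sub_self, zero_mul, zero_add]
    · cases l with
      | zero => rfl
      | succ l => exact hl l le_rfl
  · have hunit : IsUnit ((n : R) - m) := by
      have hne : (n : ℂ) - m ≠ 0 := sub_ne_zero.2 (Nat.cast_injective.ne hnm)
      simpa using (IsUnit.mk0 _ hne).map (algebraMap ℂ R)
    obtain ⟨y, hy, hzero⟩ := exists_mul_add_succ_eq hunit (j := j + 1) hρ
    refine ⟨y, hy, fun l hl => hzero l fun i hi => hl i (by omega), ?_⟩
    rw [if_neg hnm]
    exact hzero _ hρ

theorem exists_euler_add_X_mul_eq {r : ℕ → R⟦X⟧} {j D : ℕ} (hr : ∀ l > j, r l = 0)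
    (hD : ∀ l, X ^ (D + 1) ∣ r l) (m : ℕ) :
    ∃ w : ℕ → R⟦X⟧, (∀ l, euler (-(m : R)) (w l) + X * w (l + 1) = r l) ∧
      (∀ l > j + 1, w l = 0) ∧ (∀ l, X ^ D ∣ w l) ∧
      w (j + 1) = C (coeff (m + 1) (r j)) * X ^ m := by
  choose y hy hzero hlead using fun n => exists_natCast_sub_mul_add_succ_eq
    (ρ := fun l => coeff (n + 1) (r l)) (fun l hl => by rw [hr l hl, map_zero]) n m
  refine ⟨fun l => PowerSeries.mk fun n => y n l, fun l => PowerSeries.ext fun n => ?_,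
    fun l hl => PowerSeries.ext fun n => ?_, fun l => X_pow_dvd_iff.2 fun n hn => ?_,
    PowerSeries.ext fun n => ?_⟩
  · cases n with
    | zero =>
      rw [map_add, coeff_zero_euler, coeff_zero_X_mul, add_zero,
        X_pow_dvd_iff.1 (hD l) 0 D.succ_pos]
    | succ n => rw [map_add, coeff_succ_euler, coeff_succ_X_mul, coeff_mk, coeff_mk,
        ← sub_eq_add_neg, hy]
  · rw [coeff_mk, map_zero, hzero n l fun i hi => by rw [hr i (by omega), map_zero]]
  · rw [coeff_mk, hzero n l fun i _ => X_pow_dvd_iff.1 (hD i) _ (by omega)]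
  · rw [coeff_mk, hlead, coeff_C_mul, coeff_X_pow, mul_ite, mul_one, mul_zero]
    split_ifs with h
    · rw [h]
    · rfl

variable {mu lam₁ : ℚ} {p : ℕ → ℕ} {S : ℕ → R⟦X⟧}

theorem Xi.exists_aOp_eq {u : Xi R {lam} N} {j D m : ℕ} (hjN : j + 1 ≤ N)
    (hu : ∀ l > j, Xi.comp l u = 0) (hD : ∀ l, X ^ (D + 1) ∣ Xi.comp l u) (hm : mu = lam + m) :
    ∃ v : Xi R {lam} N, aOp R v = (C (algebraMap ℂ R mu) * X : R⟦X⟧) • v + u ∧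
      (∀ l > j + 1, Xi.comp l v = 0) ∧ (∀ l, X ^ D ∣ Xi.comp l v) ∧
      Xi.comp (j + 1) v = C (coeff (m + 1) (Xi.comp j u)) * X ^ m := by
  obtain ⟨w, hw, hzero, hdvd, hlead⟩ := exists_euler_add_X_mul_eq hu hD m
  obtain ⟨v, hv⟩ := Xi.exists_comp_eq (lam := lam) fun l (hl : l > N) => hzero l (by omega)
  simp only [← hv] at hw hzero hdvd hlead
  refine ⟨v, Xi.comp_ext fun l _ => ?_, hzero, hdvd, hlead⟩
  have hmu : -(m : R) = algebraMap ℂ R (lam : ℚ) - algebraMap ℂ R mu := by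
    rw [hm, Rat.cast_add, Rat.cast_natCast, map_add, map_natCast, sub_add_cancel_left]
  rw [Xi.comp_aOp, map_add, map_smul, smul_eq_mul, ← hw l, hmu, euler_sub]
  ring

theorem Xi.exists_aOp_eq_X_pow {m : ℕ} (hm : mu = lam + m) :
    ∃ v : Xi R {lam} N, aOp R v = (C (algebraMap ℂ R mu) * X : R⟦X⟧) • v ∧
      v.HasLeadingTerm 0 m ∧ ∀ l, X ^ m ∣ Xi.comp l v := by
  obtain ⟨v, hv⟩ := Xi.exists_comp_eq (R := R) (lam := lam) (N := N)
    (w := fun l => if l = 0 then X ^ m else 0) fun l hl => if_neg (by omega)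
  have hzero (l : ℕ) (hl : l > 0) : Xi.comp l v = 0 := by rw [hv, if_neg hl.ne']
  have hlead : Xi.comp 0 v = X ^ m := by rw [hv, if_pos rfl]
  refine ⟨v, Xi.comp_ext fun l _ => ?_, ⟨hzero, 1, isUnit_one, ?_⟩, fun l => ?_⟩
  · rw [Xi.comp_aOp, hzero (l + 1) l.succ_pos, mul_zero, add_zero, map_smul, smul_eq_mul]
    rcases Nat.eq_zero_or_pos l with rfl | hl
    · rw [hlead, euler_X_pow, hm, Rat.cast_add, Rat.cast_natCast, map_add (algebraMap ℂ R),
        map_natCast, add_comm (m : R), pow_succ', mul_assoc]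
    · rw [hzero l hl, map_zero, mul_zero]
  · rw [hlead, map_one, one_mul]
  · rw [hv]
    split_ifs
    · rfl
    · exact dvd_zero _

theorem Xi.comp_map {R' : Type*} [CommRing R'] [Algebra ℂ R'] (f : R →ₐ[ℂ] R') (i : ℕ)
    (s : Xi R {lam} N) : Xi.comp i (Xi.map f s) = PowerSeries.map f.toRingHom (Xi.comp i s) := by
  by_cases hi : i < N + 1
  · rw [Xi.comp_of_lt hi, Xi.comp_of_lt hi]
    rfl
  · rw [Xi.comp_eq_zero _ (by omega), Xi.comp_eq_zero _ (by omega), map_zero]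

theorem IsTriangular.map {R' : Type*} [CommRing R'] [Algebra ℂ R'] (f : R →ₐ[ℂ] R')
    {v : ℕ → Xi R {lam} N} (h : IsTriangular k v) : IsTriangular k fun i => Xi.map f (v i) := by
  intro j hj
  obtain ⟨m, hzero, c, hc, hlead⟩ := h j hj
  refine ⟨m, fun l hl => by rw [Xi.comp_map, hzero l hl, map_zero], f c, hc.map f, ?_⟩
  rw [Xi.comp_map, hlead, map_mul, map_pow, map_X, map_C]
  rfl

theorem Xi.map_add {R' : Type*} [CommRing R'] [Algebra ℂ R'] (f : R →ₐ[ℂ] R') {Λ : Finset ℚ}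
    (s t : Xi R Λ N) : Xi.map f (s + t) = Xi.map f s + Xi.map f t := by
  funext l j
  exact _root_.map_add (PowerSeries.map f.toRingHom) (s l j) (t l j)

theorem Xi.map_smul {R' : Type*} [CommRing R'] [Algebra ℂ R'] (f : R →ₐ[ℂ] R') {Λ : Finset ℚ}
    (S : R⟦X⟧) (s : Xi R Λ N) :
    Xi.map f (S • s) = PowerSeries.map f.toRingHom S • Xi.map f s := by
  funext l j
  exact map_mul (PowerSeries.map f.toRingHom) S (s l j)

theorem Xi.map_sum_smul {R' : Type*} [CommRing R'] [Algebra ℂ R'] (f : R →ₐ[ℂ] R') {Λ : Finset ℚ}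
    {n : ℕ} (c : Fin n → R⟦X⟧) (s : Fin n → Xi R Λ N) :
    Xi.map f (∑ i, c i • s i) = ∑ i, PowerSeries.map f.toRingHom (c i) • Xi.map f (s i) :=
  (map_sum (AddMonoidHom.mk' (Xi.map f) (Xi.map_add f)) _ _).trans
    (Finset.sum_congr rfl fun i _ => Xi.map_smul f (c i) (s i))

/-- Each vector of a frame is obtained from the previous one by solving an equation in `Ξ`, which
costs one power of `b`: hence the divisibility, and the lower bound on `lam₁`. -/
theorem exists_xi_frame (hS : ∀ i, 1 ≤ i → i < k → IsUnit (coeff (p i) (S i))) {m₁ : ℕ}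
    (hm₁ : lam₁ = lam + m₁) (hkm : k - 1 ≤ m₁) {j : ℕ} (hj : j ≤ k) :
    ∃ v : ℕ → Xi R {lam} (k - 1), IsFrame (fun i => (lamInv lam₁ p i : ℂ)) S j v ∧
      ∀ i < j, ∃ m : ℕ, lamInv lam₁ p (i + 1) = lam + m ∧ k - (i + 1) ≤ m ∧
        (v (i + 1)).HasLeadingTerm i m ∧ ∀ l, X ^ (k - (i + 1)) ∣ Xi.comp l (v (i + 1)) := by
  induction j with
  | zero => exact ⟨0, ⟨rfl, by simp⟩, by simp⟩
  | succ j ih =>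
    obtain ⟨v, hfr, hv⟩ := ih (by omega)
    suffices hnext : ∃ w : Xi R {lam} (k - 1),
        aOp R w = (C (algebraMap ℂ R (lamInv lam₁ p (j + 1) : ℚ)) * X : R⟦X⟧) • w + S j • v j ∧
        ∃ m : ℕ, lamInv lam₁ p (j + 1) = lam + m ∧ k - (j + 1) ≤ m ∧ w.HasLeadingTerm j m ∧
          ∀ l, X ^ (k - (j + 1)) ∣ Xi.comp l w by
      obtain ⟨w, hw, hlead⟩ := hnext
      have hfr' := hfr.update hw
      rw [Function.update_eq_self] at hfr'
      refine ⟨_, hfr', fun i hi => ?_⟩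
      rcases Nat.lt_succ_iff_lt_or_eq.1 hi with hi | rfl
      · simpa only [Function.update_of_ne (Nat.succ_lt_succ hi).ne] using hv i hi
      · simpa only [Function.update_self] using hlead
    rcases j with _ | i
    · have hm : lamInv lam₁ p (0 + 1) = lam + m₁ := by rw [lamInv_one, hm₁]
      obtain ⟨w, hw, hlead, hdvd⟩ := Xi.exists_aOp_eq_X_pow (R := R) hm
      exact ⟨w, by rw [hw, hfr.zero, smul_zero, add_zero], m₁, hm, by omega, hlead,
        fun l => (pow_dvd_pow _ (by omega)).trans (hdvd l)⟩
    · obtain ⟨m, hm, hkm', ⟨hzero, c, hc, hlead⟩, hdvd⟩ := hv i i.lt_succ_self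
      have hm' : lamInv lam₁ p (i + 1 + 1) = lam + (m + p (i + 1) - 1 : ℕ) := by
        rw [lamInv_succ lam₁ p (by omega), hm, Nat.cast_sub (by omega)]
        push_cast; ring
      obtain ⟨w, hw, hzero', hdvd', hlead'⟩ := Xi.exists_aOp_eq (u := S (i + 1) • v (i + 1))
        (j := i) (D := k - (i + 1 + 1)) (by omega)
        (fun l hl => by rw [map_smul, hzero l hl, smul_zero])
        (fun l => by
          rw [map_smul, show k - (i + 1 + 1) + 1 = k - (i + 1) by omega]
          exact Dvd.dvd.mul_left (hdvd l) _) hm'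
      refine ⟨w, hw, _, hm', by omega, ⟨hzero', _, ?_, hlead'⟩, hdvd'⟩
      rw [show m + p (i + 1) - 1 + 1 = p (i + 1) + m by omega, map_smul, smul_eq_mul, hlead,
        mul_left_comm, coeff_C_mul, coeff_mul_X_pow]
      exact hc.mul (hS (i + 1) (by omega) (by omega))

end XiFrame

/-! ### Values of sections -/

section HolFunctions

variable {X : Type u} [TopologicalSpace X] [ReducedComplexSpace X] {U V : Opens X} {x : X}

theorem exists_local_embedding (hx : x ∈ U) :
    ∃ V : Opens X, V ≤ U ∧ x ∈ V ∧ ∃ (n : ℕ) (ε : V → Fin n → ℂ), Continuous ε ∧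
      ∀ f : V → ℂ, f ∈ ReducedComplexSpace.hol V ↔
        ∀ y : V, ∃ (B : Set (Fin n → ℂ)) (g : (Fin n → ℂ) → ℂ), IsOpen B ∧ ε y ∈ B ∧
          DifferentiableOn ℂ g B ∧ ∀ y' : V, ε y' ∈ B → f y' = g (ε y') := by
  obtain ⟨W, hxW, n, D, A, -, e, he⟩ := ReducedComplexSpace.local_model x
  refine ⟨U ⊓ W, inf_le_left, ⟨hx, hxW⟩, n, fun y => e ⟨y.1, y.2.2⟩, ?_,
    fun f => he (U ⊓ W) inf_le_right f⟩
  exact continuous_subtype_val.comp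
    (e.continuous.comp (continuous_subtype_val.subtype_mk fun y : (U ⊓ W : Opens X) => y.2.2))

theorem HolFun.isUnit (f : HolFun U) (hf : ∀ (x : X) (hx : x ∈ U), HolFun.eval hx f ≠ 0) :
    IsUnit f := by
  have hinv : (fun y : U => (f.1 y)⁻¹) ∈ ReducedComplexSpace.hol U := by
    refine ReducedComplexSpace.hol_glue U _ fun x hx => ?_
    obtain ⟨V, hVU, hxV, n, ε, -, hol⟩ := exists_local_embedding hx
    refine ⟨V, hVU, hxV, (hol _).2 fun y => ?_⟩
    obtain ⟨B, g, hB, hyB, hg, hfg⟩ := (hol _).1 (ReducedComplexSpace.hol_res hVU f.1 f.2) y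
    have hgy : g (ε y) ≠ 0 := hfg y hyB ▸ hf y.1 (hVU y.2)
    exact ⟨B ∩ g ⁻¹' {0}ᶜ, fun z => (g z)⁻¹,
      hg.continuousOn.isOpen_inter_preimage hB isOpen_compl_singleton, ⟨hyB, hgy⟩,
      (hg.mono Set.inter_subset_left).inv fun z hz => hz.2,
      fun y' hy' => congrArg (·⁻¹) (hfg y' hy'.1)⟩
  exact IsUnit.of_mul_eq_one ⟨_, hinv⟩
    (Subtype.ext (funext fun y => mul_inv_cancel₀ (hf y.1 y.2)))

theorem HolFun.isOpen_ne (f : HolFun U) :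
    IsOpen {x : X | ∃ hx : x ∈ U, HolFun.eval hx f ≠ 0} := by
  rw [isOpen_iff_forall_mem_open]
  rintro x ⟨hx, hfx⟩
  obtain ⟨V, hVU, hxV, n, ε, hε, hol⟩ := exists_local_embedding hx
  obtain ⟨B, g, hB, hxB, hg, hfg⟩ := (hol _).1 (ReducedComplexSpace.hol_res hVU f.1 f.2) ⟨x, hxV⟩
  have hopen : IsOpen (B ∩ g ⁻¹' {0}ᶜ) :=
    hg.continuousOn.isOpen_inter_preimage hB isOpen_compl_singleton
  have hgx : g (ε ⟨x, hxV⟩) ≠ 0 := hfg ⟨x, hxV⟩ hxB ▸ hfx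
  refine ⟨Subtype.val '' (ε ⁻¹' (B ∩ g ⁻¹' {0}ᶜ)), ?_,
    V.isOpen.isOpenMap_subtype_val _ (hopen.preimage hε), ⟨⟨x, hxV⟩, ⟨hxB, hgx⟩, rfl⟩⟩
  rintro _ ⟨y, ⟨hyB, hgy⟩, rfl⟩
  exact ⟨hVU y.2, fun hfy => hgy ((hfg y hyB).symm.trans hfy)⟩

theorem HolFun.eq_zero_of_eval (f : HolFun U) (hf : ∀ x : U, HolFun.eval x.2 f = 0) : f = 0 :=
  Subtype.ext (funext hf)

/-- The value at `x` of a power series with holomorphic coefficients. -/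
def evalSeries (hx : x ∈ U) : (HolFun U)⟦X⟧ →+* ℂ⟦X⟧ :=
  PowerSeries.map (HolFun.eval hx).toRingHom

theorem evalSeries_res (h : V ≤ U) (hx : x ∈ V) (S : (HolFun U)⟦X⟧) :
    evalSeries hx (PowerSeries.map (HolFun.res h).toRingHom S) = evalSeries (h hx) S := by
  ext n
  simp only [evalSeries, coeff_map]
  rfl

theorem evalSeries_const (hx : x ∈ U) (S : ℂ⟦X⟧) :
    evalSeries hx (ABSheaf.constSeries U S) = S := by
  ext n
  simp only [evalSeries, ABSheaf.constSeries, coeff_map]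
  rfl

end HolFunctions

namespace ABSheaf

variable {X : Type u} [TopologicalSpace X] [ReducedComplexSpace X] (E : ABSheaf.{u, v} X)
  {U V : Opens X} {x : X}

theorem germ_res (h : V ≤ U) (hx : x ∈ V) (s : E.sec U) :
    E.germ hx (E.res h s) = E.germ (h hx) s :=
  (DirectLimit.eq_of_le (f := E.nhdRes x) (⟨⟨U, h hx⟩, s⟩ : Σ A : Nhd x, E.nhdSec x A)
    (⟨V, hx⟩ : Nhd x) h).symm

theorem value_res (h : V ≤ U) (hx : x ∈ V) (s : E.sec U) :
    E.value hx (E.res h s) = E.value (h hx) s := by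
  rw [value, germ_res]; rfl

/-- The value at `x` as an additive map on the sections over `U`. -/
def valueHom (hx : x ∈ U) : E.sec U →+ E.Fibre x :=
  AddMonoidHom.mk' (E.value hx) fun s t => by
    rw [value, germ_add]; rfl

theorem valueHom_apply (hx : x ∈ U) (s : E.sec U) : E.valueHom hx s = E.value hx s := rfl

theorem value_smul_const (hx : x ∈ U) (S : ℂ⟦X⟧) (s : E.sec U) :
    E.value hx (S • s) = S • E.value hx s := rfl

theorem value_smul (hx : x ∈ U) (S : (HolFun U)⟦X⟧) (s : E.sec U) :
    E.value hx (S • s) = evalSeries hx S • E.value hx s := by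
  rw [← value_smul_const]
  refine (Submodule.Quotient.eq _).2 (Submodule.subset_span ⟨U, hx,
    S - constSeries U (evalSeries hx S), s, fun n => ?_, ?_⟩)
  · rw [map_sub, map_sub, sub_eq_zero]
    exact (congrArg (coeff n) (evalSeries_const hx (evalSeries hx S))).symm
  · rw [sub_smul, ← modC_smul, sub_eq_iff_eq_add, ← germ_add, sub_add_cancel]

theorem value_a (hx : x ∈ U) (s : E.sec U) :
    E.value hx (aOp (HolFun U) s) = aOp ℂ (E.value hx s) := rfl

theorem exists_value (z : E.Fibre x) :
    ∃ (U : Opens X) (hx : x ∈ U) (s : E.sec U), z = E.value hx s := by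
  obtain ⟨z, rfl⟩ := Submodule.Quotient.mk_surjective _ z
  obtain ⟨U, hx, s, rfl⟩ := E.exists_germ z
  exact ⟨U, hx, s, rfl⟩

variable {E} {W : Opens X} {n : ℕ} {e : Fin n → E.sec U}

/-- The sections `e` over `U` trivialise `E`: over each `V ≤ U` their restrictions form a basis
of `E(V)`. It is stated elementwise, as in the local freeness field of `ABSheaf`. -/
def IsLocalBasis (E : ABSheaf.{u, v} X) {U : Opens X} {n : ℕ} (e : Fin n → E.sec U) : Prop :=
  ∀ (V : Opens X) (h : V ≤ U) (s : E.sec V), ∃! c : Fin n → (HolFun V)⟦X⟧,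
    s = ∑ i, c i • E.res h (e i)

/-- The basis of `E(V)` given by a local basis over `U ≥ V`. -/
def IsLocalBasis.basis (he : E.IsLocalBasis e) (h : V ≤ U) :
    Module.Basis (Fin n) (HolFun V)⟦X⟧ (E.sec V) :=
  Module.Basis.mk (v := fun i => E.res h (e i))
    (by
      rw [Fintype.linearIndependent_iff]
      intro g hg i
      obtain ⟨c, -, hc⟩ := he V h 0
      rw [hc g hg.symm, ← hc 0 (by simp)]; rfl)
    (by
      rintro s -
      obtain ⟨c, hc, -⟩ := he V h s
      rw [hc]
      exact Submodule.sum_mem _ fun i _ => Submodule.smul_mem _ _ (Submodule.subset_span ⟨i, rfl⟩))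

theorem IsLocalBasis.basis_apply (he : E.IsLocalBasis e) (h : V ≤ U) (i : Fin n) :
    he.basis h i = E.res h (e i) := Module.Basis.mk_apply _ _ _

theorem IsLocalBasis.of_basis (h : ∀ (V : Opens X) (h : V ≤ U),
    LinearIndependent (HolFun V)⟦X⟧ (fun i => E.res h (e i)) ∧
    Submodule.span (HolFun V)⟦X⟧ (Set.range fun i => E.res h (e i)) = ⊤) : E.IsLocalBasis e := by
  intro V hV s
  let b := Module.Basis.mk (h V hV).1 (h V hV).2.ge
  have hb : ∀ i, b i = E.res hV (e i) := Module.Basis.mk_apply _ _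
  refine ⟨b.repr s, ?_, fun c hc => ?_⟩
  · simpa only [hb] using (b.sum_repr s).symm
  · simp only [← hb] at hc
    rw [hc, Module.Basis.repr_sum_self]

theorem IsLocalBasis.repr_res (he : E.IsLocalBasis e) (h : V ≤ U) (h' : W ≤ V) (s : E.sec V)
    (i : Fin n) : (he.basis (h'.trans h)).repr (E.res h' s) i =
      PowerSeries.map (HolFun.res h').toRingHom ((he.basis h).repr s i) := by
  have hsum : E.res h' s = ∑ i, PowerSeries.map (HolFun.res h').toRingHom
      ((he.basis h).repr s i) • he.basis (h'.trans h) i := by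
    conv_lhs => rw [← (he.basis h).sum_repr s]
    rw [map_sum]
    refine Finset.sum_congr rfl fun i _ => ?_
    rw [E.res_smul, basis_apply, basis_apply, E.res_res]
  rw [hsum, Module.Basis.repr_sum_self]

/-- The coordinates at `x` of a section over a neighbourhood `A` of `x`, computed over `A ⊓ U`. -/
def IsLocalBasis.coordAt (he : E.IsLocalBasis e) (hx : x ∈ U) (A : Nhd x) (s : E.sec A.U)
    (i : Fin n) : ℂ⟦X⟧ :=
  evalSeries (⟨A.mem, hx⟩ : x ∈ A.U ⊓ U)
    ((he.basis (inf_le_right : A.U ⊓ U ≤ U)).repr (E.res inf_le_left s) i)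

theorem IsLocalBasis.coordAt_eq (he : E.IsLocalBasis e) (hx : x ∈ U) (A : Nhd x)
    (s : E.sec A.U) (i : Fin n) (hxW : x ∈ W) (hA : W ≤ A.U) (hU : W ≤ U) :
    he.coordAt hx A s i = evalSeries hxW ((he.basis hU).repr (E.res hA s) i) := by
  rw [coordAt, ← evalSeries_res (le_inf hA hU) hxW, ← he.repr_res, E.res_res]

theorem IsLocalBasis.coordAt_smul (he : E.IsLocalBasis e) (hx : x ∈ U) (A : Nhd x)
    (S : (HolFun A.U)⟦X⟧) (s : E.sec A.U) (i : Fin n) :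
    he.coordAt hx A (S • s) i = evalSeries A.mem S * he.coordAt hx A s i := by
  have hxAU : x ∈ A.U ⊓ U := ⟨A.mem, hx⟩
  change evalSeries hxAU _ = evalSeries A.mem S * evalSeries hxAU _
  rw [E.res_smul, map_smul, Finsupp.smul_apply, smul_eq_mul, map_mul, evalSeries_res]

/-- The coordinates of a germ at `x`, with their coefficients evaluated at `x`. This map
descends to the fibre and shows that the values of a local basis are independent. -/
def IsLocalBasis.stalkCoord (he : E.IsLocalBasis e) (hx : x ∈ U) :
    E.Stalk x →ₗ[ℂ⟦X⟧] (Fin n → ℂ⟦X⟧) where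
  toFun := DirectLimit.lift (E.nhdRes x) (fun A s => he.coordAt hx A s) fun A B h s => by
    funext i
    have hBA : B.U ≤ A.U := h
    rw [he.coordAt_eq hx A s i (W := B.U ⊓ U) ⟨B.mem, hx⟩ (inf_le_left.trans hBA) inf_le_right,
      he.coordAt_eq hx B _ i (W := B.U ⊓ U) ⟨B.mem, hx⟩ inf_le_left inf_le_right]
    congr 3
    exact (E.res_res hBA inf_le_left s).symm
  map_add' z z' := by
    obtain ⟨V, hxV, s, s', rfl, rfl⟩ := E.exists_germ₂ z z'
    rw [← germ_add]
    funext i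
    change evalSeries _ _ = evalSeries _ _ + evalSeries _ _
    rw [map_add, map_add, Finsupp.add_apply, map_add]
  map_smul' S z := by
    obtain ⟨V, hxV, s, rfl⟩ := E.exists_germ z
    rw [← germ_smul]
    funext i
    change he.coordAt hx ⟨V, hxV⟩ (S • s) i = S * he.coordAt hx ⟨V, hxV⟩ s i
    rw [modC_smul, coordAt_smul, evalSeries_const]

theorem IsLocalBasis.stalkCoord_germ (he : E.IsLocalBasis e) (hx : x ∈ V) (h : V ≤ U)
    (s : E.sec V) (i : Fin n) :
    he.stalkCoord (h hx) (E.germ hx s) i = evalSeries hx ((he.basis h).repr s i) := by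
  change he.coordAt (h hx) ⟨V, hx⟩ s i = _
  rw [he.coordAt_eq (h hx) ⟨V, hx⟩ s i hx le_rfl h]
  congr 3
  exact E.res_self s

theorem IsLocalBasis.maxIdealMul_le (he : E.IsLocalBasis e) (hx : x ∈ U) :
    (E.maxIdealMul x).toSubmodule ≤ LinearMap.ker (he.stalkCoord hx) := by
  refine Submodule.span_le.2 ?_
  rintro _ ⟨V, hxV, S, s, hS, rfl⟩
  have hS_zero : evalSeries hxV S = 0 := by
    ext n
    rw [evalSeries, coeff_map]
    exact hS n
  rw [SetLike.mem_coe, LinearMap.mem_ker]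
  funext i
  change he.coordAt hx ⟨V, hxV⟩ (S • s) i = 0
  rw [coordAt_smul, hS_zero, zero_mul]

theorem IsLocalBasis.linearIndependent_value (he : E.IsLocalBasis e) (hx : x ∈ U) :
    LinearIndependent ℂ⟦X⟧ fun i => E.value hx (e i) := by
  let coord := (E.maxIdealMul x).toSubmodule.liftQ (he.stalkCoord hx) (he.maxIdealMul_le hx)
  have hcoord : (fun i => coord (E.value hx (e i))) = fun i => Pi.single i (1 : ℂ⟦X⟧) := by
    funext i j
    change he.stalkCoord hx (E.germ hx (e i)) j = _
    have he_i : e i = he.basis le_rfl i := by rw [basis_apply, E.res_self]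
    rw [he.stalkCoord_germ hx le_rfl, he_i, Module.Basis.repr_self, Finsupp.single_apply,
      Pi.single_apply, apply_ite (evalSeries hx), map_one, map_zero]
    simp only [eq_comm]
  refine LinearIndependent.of_comp coord ?_
  rw [Function.comp_def, hcoord]
  exact Pi.linearIndependent_single_one _ _

theorem IsLocalBasis.value_eq (he : E.IsLocalBasis e) (hx : x ∈ V) (h : V ≤ U) (s : E.sec V) :
    E.value hx s = ∑ i, evalSeries hx ((he.basis h).repr s i) • E.value (h hx) (e i) := by
  conv_lhs => rw [← (he.basis h).sum_repr s, ← valueHom_apply, map_sum]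
  refine Finset.sum_congr rfl fun i _ => ?_
  rw [valueHom_apply, value_smul, basis_apply, value_res]

theorem IsLocalBasis.span_value (he : E.IsLocalBasis e) (hx : x ∈ U) :
    Submodule.span ℂ⟦X⟧ (Set.range fun i => E.value hx (e i)) = ⊤ := by
  rw [eq_top_iff]
  rintro z -
  obtain ⟨V, hxV, s, rfl⟩ := E.exists_value z
  have hxVU : x ∈ V ⊓ U := ⟨hxV, hx⟩
  rw [← E.value_res (inf_le_left : V ⊓ U ≤ V) hxVU, he.value_eq hxVU inf_le_right]
  exact Submodule.sum_mem _ fun i _ => Submodule.smul_mem _ _ (Submodule.subset_span ⟨i, rfl⟩)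

theorem IsLocalBasis.finrank_fibre (he : E.IsLocalBasis e) (hx : x ∈ U) :
    Module.finrank ℂ⟦X⟧ (E.Fibre x) = n := by
  rw [Module.finrank_eq_card_basis
    (Module.Basis.mk (he.linearIndependent_value hx) (he.span_value hx).ge), Fintype.card_fin]

theorem IsLocalBasis.isFibreFamily (he : E.IsLocalBasis e) (h : V ≤ U) :
    IsFibreFamily (Pt := V) (fun x => HolFun.eval x.2) (N := fun x => E.Fibre x.1)
      (fun x => E.valueHom x.2) (he.basis h) := by
  have hval (x : V) : (E.valueHom x.2 ∘ he.basis h : Fin n → E.Fibre x.1) =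
      fun i => E.value (h x.2) (e i) := funext fun i => by
    rw [Function.comp_apply, basis_apply, valueHom_apply, value_res]
  exact {
    sep := HolFun.eq_zero_of_eval
    unit := fun r hr => HolFun.isUnit r fun x hx => hr ⟨x, hx⟩
    val_smul := fun x => E.value_smul x.2
    val_a := fun x => E.value_a x.2
    ind := fun x => by rw [hval x]; exact he.linearIndependent_value (h x.2)
    span := fun x => by rw [hval x]; exact he.span_value (h x.2) }

end ABSheaf

/-! ### Thematic maps given by frames of `Ξ` -/

section SheafGen

variable {X : Type u} [TopologicalSpace X] [ReducedComplexSpace X] {U V W : Opens X}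

theorem exists_evalSeries_eq {d : U → ℂ⟦X⟧}
    (hd : ∀ x ∈ U, ∃ (W : Opens X) (h : W ≤ U), x ∈ W ∧
      ∃ c : (HolFun W)⟦X⟧, ∀ y : W, d ⟨y, h y.2⟩ = evalSeries y.2 c) :
    ∃ S : (HolFun U)⟦X⟧, ∀ y : U, evalSeries y.2 S = d y := by
  have hhol (n : ℕ) : (fun y : U => coeff n (d y)) ∈ ReducedComplexSpace.hol U := by
    refine ReducedComplexSpace.hol_glue U _ fun x hx => ?_
    obtain ⟨W, h, hxW, c, hc⟩ := hd x hx
    refine ⟨W, h, hxW, ?_⟩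
    convert (coeff n c).2 using 1
    funext y
    rw [hc y, evalSeries, coeff_map]
    rfl
  refine ⟨PowerSeries.mk fun n => ⟨_, hhol n⟩, fun y => ?_⟩
  ext n
  rw [evalSeries, coeff_map, coeff_mk]
  rfl

theorem evalSeries_injective {S T : (HolFun U)⟦X⟧}
    (h : ∀ x : U, evalSeries x.2 S = evalSeries x.2 T) : S = T := by
  ext n : 1
  refine sub_eq_zero.1 (HolFun.eq_zero_of_eval _ fun x => ?_)
  have hcoeff := congrArg (coeff n) (h x)
  rw [evalSeries, coeff_map, coeff_map] at hcoeff
  rw [map_sub, sub_eq_zero]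
  exact hcoeff

theorem Xi.map_eval_res {Λ : Finset ℚ} {N : ℕ} (h : V ≤ U) {x : X} (hx : x ∈ V)
    (s : Xi (HolFun U) Λ N) :
    Xi.map (HolFun.eval hx) (Xi.res h s) = Xi.map (HolFun.eval (h hx)) s := by
  funext l j
  exact evalSeries_res h hx (s l j)

theorem Xi.ext_eval {Λ : Finset ℚ} {N : ℕ} {s t : Xi (HolFun U) Λ N}
    (h : ∀ x : U, Xi.map (HolFun.eval x.2) s = Xi.map (HolFun.eval x.2) t) : s = t := by
  funext l j
  exact evalSeries_injective fun x => congrFun (congrFun (h x) l) j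

variable {lam : ℚ} {N k : ℕ} {v : ℕ → Xi (HolFun U) {lam} N}

theorem IsTriangular.exists_glue (hv : IsTriangular k v) (s : Xi (HolFun U) {lam} N)
    (hs : ∀ x ∈ U, ∃ (W : Opens X) (h : W ≤ U), x ∈ W ∧ ∃ c : Fin k → (HolFun W)⟦X⟧,
      Xi.res h s = ∑ i, c i • Xi.res h (v (i + 1))) :
    ∃ c : Fin k → (HolFun U)⟦X⟧, s = ∑ i, c i • v (i + 1) := by
  have heval {W : Opens X} {h : W ≤ U} {c : Fin k → (HolFun W)⟦X⟧}
      (hc : Xi.res h s = ∑ i, c i • Xi.res h (v (i + 1))) (y : W) :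
      Xi.map (HolFun.eval (h y.2)) s =
        ∑ i, evalSeries y.2 (c i) • Xi.map (HolFun.eval (h y.2)) (v (i + 1)) := by
    rw [← Xi.map_eval_res h y.2, hc, Xi.map_sum_smul]
    simp only [Xi.map_eval_res]
    rfl
  have hpt (x : U) : ∃ d : Fin k → ℂ⟦X⟧, Xi.map (HolFun.eval x.2) s =
      ∑ i, d i • Xi.map (HolFun.eval x.2) (v (i + 1)) := by
    obtain ⟨W, h, hxW, c, hc⟩ := hs x x.2
    exact ⟨_, heval hc ⟨x, hxW⟩⟩
  choose d hd using hpt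
  have hloc (i : Fin k) : ∃ S : (HolFun U)⟦X⟧, ∀ y : U, evalSeries y.2 S = d y i := by
    refine exists_evalSeries_eq fun x hx => ?_
    obtain ⟨W, h, hxW, c, hc⟩ := hs x hx
    refine ⟨W, h, hxW, c i, fun y => ?_⟩
    exact Fintype.linearIndependent_iffₛ.1
      (hv.map (HolFun.eval (h y.2))).linearIndependent _ _
      ((hd ⟨y, h y.2⟩).symm.trans (heval hc y)) i
  choose c hc using hloc
  refine ⟨c, Xi.ext_eval fun x => ?_⟩
  rw [Xi.map_sum_smul, hd x]
  exact Finset.sum_congr rfl fun i _ => congrArg (· • _) (hc i x).symm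

variable {mu : ℕ → ℂ} {S : ℕ → (HolFun U)⟦X⟧}

theorem IsFrame.xi_res (h : IsFrame mu S k v) (hV : V ≤ U) :
    IsFrame mu (fun i => PowerSeries.map (HolFun.res hV).toRingHom (S i)) k
      fun i => Xi.res hV (v i) :=
  h.map (HolFun.res hV) (AddMonoidHom.mk' (Xi.res hV) (Xi.res_add hV)) (Xi.res_smul hV)
    (Xi.res_a hV)

theorem IsFrame.gen_xi_res_eq_flag (h : IsFrame mu S k v)
    (hS : ∀ i, 1 ≤ i → i < k → IsUnit (S i)) (hV : V ≤ U) :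
    (ABSubmodule.gen (R := HolFun V) (Xi.res hV (v k))).toSubmodule =
      flag (HolFun V)⟦X⟧ (fun i => Xi.res hV (v i)) k := by
  rw [← (h.xi_res hV).gen_eq_flag (fun i hi hik => (hS i hi hik).map _) isUnit_one, one_smul]

theorem Xi.res_self {Λ : Finset ℚ} (s : Xi (HolFun U) Λ N) : Xi.res le_rfl s = s :=
  Xi.ext_eval fun x => Xi.map_eval_res le_rfl x.2 s

theorem IsFrame.sheafGen_eq_flag (h : IsFrame mu S k v)
    (hS : ∀ i, 1 ≤ i → i < k → IsUnit (S i)) (hv : IsTriangular k v) (hV : V ≤ U) :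
    sheafGen (v k) hV = flag (HolFun V)⟦X⟧ (fun i => Xi.res hV (v i)) k := by
  apply le_antisymm
  · intro s hs
    obtain ⟨c, hc⟩ := (hv.map (HolFun.res hV)).exists_glue s fun x hx => by
      obtain ⟨W, hW, hxW, hsW⟩ := hs x hx
      rw [h.gen_xi_res_eq_flag hS] at hsW
      obtain ⟨c, hc⟩ := mem_flag_iff_exists_sum.1 hsW
      refine ⟨W, hW, hxW, c, hc.symm.trans (Finset.sum_congr rfl fun i _ => ?_)⟩
      exact congrArg (c i • ·) (Xi.res_res hV hW _).symm
    exact mem_flag_iff_exists_sum.2 ⟨c, hc.symm⟩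
  · intro s hs x hx
    refine ⟨V, le_rfl, hx, ?_⟩
    rwa [h.gen_xi_res_eq_flag hS hV, Xi.res_self]

theorem IsFrame.isThematic (h : IsFrame mu S k v) (hS : ∀ i, 1 ≤ i → i < k → IsUnit (S i))
    (hv : IsTriangular k v) : IsThematic k (v k) := by
  intro V hV
  have hSV : ∀ i, 1 ≤ i → i < k → IsUnit (PowerSeries.map (HolFun.res hV).toRingHom (S i)) :=
    fun i hi hik => (hS i hi hik).map _
  have hind := (h.xi_res hV).linearIndependent_iterate hSV isUnit_one
    (hv.map (HolFun.res hV)).linearIndependent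
  have hspan := (h.xi_res hV).orbitSpan_eq_flag hSV isUnit_one
  rw [orbitSpan, ← h.sheafGen_eq_flag hS hv hV] at hspan
  simp only [one_smul] at hind hspan
  exact ⟨hind, hspan⟩

/-- The basis `v 1, …, v k` of the sections of `𝔼_φ` over `V`, for `φ = v k` the last vector of
a triangular frame of `Ξ`. -/
def IsFrame.sheafGenBasis (h : IsFrame mu S k v) (hS : ∀ i, 1 ≤ i → i < k → IsUnit (S i))
    (hv : IsTriangular k v) (hV : V ≤ U) :
    Module.Basis (Fin k) (HolFun V)⟦X⟧ (sheafGen (v k) hV) :=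
  (Module.Basis.span (hv.map (HolFun.res hV)).linearIndependent).map
    (LinearEquiv.ofEq _ _ (h.sheafGen_eq_flag hS hv hV).symm)

theorem IsFrame.coe_sheafGenBasis (h : IsFrame mu S k v)
    (hS : ∀ i, 1 ≤ i → i < k → IsUnit (S i)) (hv : IsTriangular k v) (hV : V ≤ U) (i : Fin k) :
    (h.sheafGenBasis hS hv hV i).1 = Xi.res hV (v (i + 1)) :=
  congrArg Subtype.val (Module.Basis.span_apply (hv.map (HolFun.res hV)).linearIndependent i)

theorem ABSheaf.IsLocalBasis.isoSheafGen {E : ABSheaf.{u, w} X} {e : ℕ → E.sec U}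
    (hb : E.IsLocalBasis fun i : Fin k => e (i + 1)) (he : IsFrame mu S k e)
    (h : IsFrame mu S k v) (hS : ∀ i, 1 ≤ i → i < k → IsUnit (S i)) (hv : IsTriangular k v) :
    IsoSheafGen E (v k) := by
  let θ (V : Opens X) (hV : V ≤ U) : E.sec V ≃ₗ[(HolFun V)⟦X⟧] sheafGen (v k) hV :=
    (hb.basis hV).equiv (h.sheafGenBasis hS hv hV) (Equiv.refl _)
  have hθ_basis {V : Opens X} (hV : V ≤ U) (i : Fin k) :
      (θ V hV (hb.basis hV i)).1 = Xi.res hV (v (i + 1)) := by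
    rw [Module.Basis.equiv_apply, Equiv.refl_apply, h.coe_sheafGenBasis]
  have hθ {V : Opens X} (hV : V ≤ U) (s : E.sec V) :
      (θ V hV s).1 = ∑ i, (hb.basis hV).repr s i • Xi.res hV (v (i + 1)) := by
    conv_lhs => rw [← (hb.basis hV).sum_repr s]
    rw [map_sum, Submodule.coe_sum]
    exact Finset.sum_congr rfl fun i _ => by rw [map_smul, Submodule.coe_smul, hθ_basis]
  refine ⟨θ, fun V hV s => ?_, fun V W hV hW s => ?_⟩
  · have hbasis (i : Fin k) : hb.basis hV i = E.res hV (e (i + 1)) := hb.basis_apply hV i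
    refine (he.map (HolFun.res hV) (E.res hV) (E.res_smul hV) (E.res_a hV)).map_aOp
      (h.xi_res hV) ?_ ((sheafGen (v k) hV).subtype ∘ₗ (θ V hV).toLinearMap) (fun i hi => ?_) s
    · rw [flag, ← (hb.basis hV).span_eq]
      simp only [← hbasis]
    · rw [← hbasis ⟨i, hi⟩]
      exact hθ_basis hV ⟨i, hi⟩
  · rw [hθ, hθ]
    refine (Finset.sum_congr rfl fun i _ => ?_).trans (Xi.map_sum_smul (HolFun.res hW) _ _).symm
    rw [hb.repr_res hV hW s i]
    exact congrArg _ (Xi.res_res hV hW _).symm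

end SheafGen

/-! ### Families with constant invariants -/

theorem mem_flag_iff_repr_eq_zero {A M : Type*} [CommRing A] [AddCommGroup M] [Module A M]
    {k j : ℕ} (b : Module.Basis (Fin k) A M) {e : ℕ → M} (hb : ∀ i, b i = e (i + 1)) (hj : j ≤ k)
    {m : M} : m ∈ flag A e j ↔ ∀ i : Fin k, j ≤ i → b.repr m i = 0 := by
  have hflag : flag A e j = Submodule.span A (b '' {i | (i : ℕ) < j}) := by
    refine congrArg (Submodule.span A) (Set.ext fun m => ⟨?_, ?_⟩)
    · rintro ⟨i, rfl⟩
      exact ⟨i.castLE hj, i.2, hb _⟩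
    · rintro ⟨i, hi, rfl⟩
      exact ⟨⟨i, hi⟩, (hb i).symm⟩
  rw [hflag, Module.Basis.mem_span_image]
  refine forall_congr' fun i => ?_
  rw [Finset.mem_coe, Finsupp.mem_support_iff, ← not_lt]
  exact not_imp_comm

namespace ABSheaf

section LocalFrames

variable {X : Type u} [TopologicalSpace X] [ReducedComplexSpace X] {E : ABSheaf.{u, w} X}
  {lam lam₁ : ℚ} {p : ℕ → ℕ} {k j n : ℕ} {U V : Opens X} {x : X}

theorem IsLocalBasis.exists_value_eq {b : Fin n → E.sec U} (hb : E.IsLocalBasis b) (hx : x ∈ U)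
    (z : E.Fibre x) : ∃ s : E.sec U, E.value hx s = z := by
  have hz : z ∈ Submodule.span ℂ⟦X⟧ (Set.range fun i => E.value hx (b i)) :=
    hb.span_value hx ▸ Submodule.mem_top
  obtain ⟨c, rfl⟩ := (Submodule.mem_span_range_iff_exists_fun _).1 hz
  exact ⟨∑ i, c i • b i, map_sum (E.valueHom hx) _ _⟩

theorem IsLocalBasis.isOpen_basis_value {b : Fin n → E.sec U} (hb : E.IsLocalBasis b)
    (m : Fin n → E.sec U) :
    IsOpen {x | ∃ hx : x ∈ U, LinearIndependent ℂ⟦X⟧ (fun i => E.value hx (m i)) ∧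
      Submodule.span ℂ⟦X⟧ (Set.range fun i => E.value hx (m i)) = ⊤} := by
  convert HolFun.isOpen_ne (coeff 0 ((hb.basis le_rfl).det m)) using 1
  refine Set.ext fun x => exists_congr fun hx => ?_
  have hf := hb.isFibreFamily (le_refl U)
  have hdet := hf.map_det m ⟨x, hx⟩
  refine (Module.Basis.is_basis_iff_det (hf.basis ⟨x, hx⟩)).trans ?_
  refine (iff_of_eq (congrArg IsUnit hdet)).symm.trans ?_
  rw [isUnit_iff_isUnit_coeff_zero, coeff_map, isUnit_iff_ne_zero]
  rfl

theorem IsLocalBasis.mem_flag_iff {e : ℕ → E.sec U}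
    (he : E.IsLocalBasis fun i : Fin k => e (i + 1)) (hj : j ≤ k) (hV : V ≤ U) (s : E.sec V) :
    s ∈ flag (HolFun V)⟦X⟧ (fun i => E.res hV (e i)) j ↔
      ∀ (x : X) (hx : x ∈ V), E.value hx s ∈ flag ℂ⟦X⟧ (fun i => E.value (hV hx) (e i)) j := by
  have hf := he.isFibreFamily hV
  have hvalue (x : V) : E.value x.2 s ∈ flag ℂ⟦X⟧ (fun i => E.value (hV x.2) (e i)) j ↔
      ∀ i : Fin k, j ≤ i → evalSeries x.2 ((he.basis hV).repr s i) = 0 := by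
    rw [mem_flag_iff_repr_eq_zero (hf.basis x) (fun i => ?_) hj]
    · exact forall_congr' fun i => iff_of_eq (congrArg (j ≤ i → · = 0) (hf.basis_repr x s i))
    · rw [IsFibreFamily.basis, Module.Basis.mk_apply, Function.comp_apply, he.basis_apply]
      exact E.value_res hV x.2 _
  rw [mem_flag_iff_repr_eq_zero (he.basis hV) (he.basis_apply hV) hj]
  refine ⟨fun h x hx => (hvalue ⟨x, hx⟩).2 fun i hi => by rw [h i hi, map_zero], fun h i hi => ?_⟩
  exact hf.series_eq_zero fun x => (hvalue x).1 (h x x.2) i hi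

/-- Sections `e 1, …, e k` over `U` which form a basis of `E` over each `V ≤ U` and satisfy
`a e_{j+1} = λ_{j+1} b e_{j+1} + S_j e_j`, where the holomorphic functions `coeff 0 (S_j)` and
`coeff (p_j) (S_j)` have no zero. This is the version over `U` of `IsThemeFrame`. -/
structure IsLocalThemeFrame (E : ABSheaf.{u, w} X) (lam₁ : ℚ) (p : ℕ → ℕ) (k : ℕ) {U : Opens X}
    (S : ℕ → (HolFun U)⟦X⟧) (e : ℕ → E.sec U) : Prop where
  frame : IsFrame (fun j => (lamInv lam₁ p j : ℂ)) S k e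
  isUnit : ∀ i, 1 ≤ i → i < k → IsUnit (S i)
  isUnit_coeff : ∀ i, 1 ≤ i → i < k → IsUnit (coeff (p i) (S i))
  isLocalBasis : E.IsLocalBasis fun i : Fin k => e (i + 1)

/-- Local theme frames exist around every point of `X`. -/
def HasLocalThemeFrames (E : ABSheaf.{u, w} X) (lam₁ : ℚ) (p : ℕ → ℕ) (k : ℕ) : Prop :=
  ∀ x, ∃ U : Opens X, x ∈ U ∧ ∃ (S : ℕ → (HolFun U)⟦X⟧) (e : ℕ → E.sec U),
    E.IsLocalThemeFrame lam₁ p k S e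

variable {S : ℕ → (HolFun U)⟦X⟧} {e : ℕ → E.sec U}

theorem IsLocalThemeFrame.value (h : E.IsLocalThemeFrame lam₁ p k S e) (hx : x ∈ U) :
    IsThemeFrame lam₁ p k (fun i => evalSeries hx (S i)) fun i => E.value hx (e i) where
  frame := h.frame.map (HolFun.eval hx) (E.valueHom hx) (E.value_smul hx) (E.value_a hx)
  isUnit i hi hik := (h.isUnit i hi hik).map _
  isUnit_coeff i hi hik := by
    rw [evalSeries, coeff_map]
    exact (h.isUnit_coeff i hi hik).map _
  span := h.isLocalBasis.span_value hx
  ind := h.isLocalBasis.linearIndependent_value hx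

theorem IsLocalThemeFrame.exists_isThematic (h : E.IsLocalThemeFrame lam₁ p k S e) {m : ℕ}
    (hm : lam₁ = lam + m) (hkm : k - 1 ≤ m) :
    ∃ φ : Xi (HolFun U) {lam} (k - 1), IsThematic k φ ∧ IsoSheafGen E φ := by
  obtain ⟨v, hv, hlead⟩ := exists_xi_frame h.isUnit_coeff hm hkm le_rfl
  have htriangular : IsTriangular k v := fun i hi =>
    let ⟨m, _, _, hvi, _⟩ := hlead i hi
    ⟨m, hvi⟩
  exact ⟨v k, hv.isThematic h.isUnit htriangular,
    h.isLocalBasis.isoSheafGen h.frame hv h.isUnit htriangular⟩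

theorem IsLocalBasis.exists_isLocalThemeFrame {b : Fin k → E.sec U} (hb : E.IsLocalBasis b)
    (hk : 1 ≤ k)
    (hE : ∀ x : X, IsPrimitiveTheme (E.Fibre x) lam k ∧ HasInvariants (E.Fibre x) k lam₁ p)
    (hV : V ≤ U) {g : E.sec V}
    (hg : ∀ x : V, (ABSubmodule.gen (R := ℂ) (E.value x.2 g)).toSubmodule = ⊤) :
    ∃ (S : ℕ → (HolFun V)⟦X⟧) (e : ℕ → E.sec V), E.IsLocalThemeFrame lam₁ p k S e := by
  have hfibre (x : V) := (exists_themeFrame hk (hE x).1 (hE x).2 (hg x)).2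
  choose Sb eb hframe hgen using hfibre
  obtain ⟨S, e, he, hval⟩ := (hb.isFibreFamily hV).exists_themeFrame hframe hgen
  refine ⟨S, e, he.frame, he.isUnit, he.isUnit_coeff, IsLocalBasis.of_basis fun W hW => ?_⟩
  refine (hb.isFibreFamily (hW.trans hV)).basis_of_fibre _ fun x => ?_
  have hres : (E.valueHom x.2 ∘ fun i : Fin k => E.res hW (e (i + 1))) =
      fun i : Fin k => E.value (hW x.2) (e (i + 1)) := funext fun i => E.value_res hW x.2 _
  rw [hres]
  exact ⟨(hval ⟨x, hW x.2⟩).ind, (hval ⟨x, hW x.2⟩).span⟩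

theorem value_iterate (hx : x ∈ U) (s : E.sec U) (l : ℕ) :
    E.value hx ((aOp (HolFun U))^[l] s) = (aOp ℂ)^[l] (E.value hx s) := by
  have h : Function.Semiconj (E.value hx) (aOp (HolFun U)) (aOp ℂ) := E.value_a hx
  exact h.iterate_right l s

theorem hasLocalThemeFrames (hk : 1 ≤ k)
    (hE : ∀ x : X, IsPrimitiveTheme (E.Fibre x) lam k ∧ HasInvariants (E.Fibre x) k lam₁ p)
    : E.HasLocalThemeFrames lam₁ p k := by
  intro x₀
  obtain ⟨U, hx₀, n, b, hb : E.IsLocalBasis b⟩ := E.locally_free x₀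
  obtain rfl : n = k := (hb.finrank_fibre hx₀).symm.trans (hE x₀).1.1
  obtain ⟨z, hz⟩ := (hE x₀).1.exists_generator
  obtain ⟨g, rfl⟩ := hb.exists_value_eq hx₀ z
  let V : Opens X := ⟨_, hb.isOpen_basis_value fun l => (aOp (HolFun U))^[l] g⟩
  have hVU : V ≤ U := fun x hx => hx.1
  have hx₀V : x₀ ∈ V := by
    obtain ⟨-, S, e, he, w, hw, hgw⟩ := exists_themeFrame hk (hE x₀).1 (hE x₀).2 hz
    refine ⟨hx₀, ?_⟩
    simp only [value_iterate, hgw]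
    exact ⟨he.frame.linearIndependent_iterate he.isUnit hw he.ind,
      (he.frame.orbitSpan_eq_flag he.isUnit hw).trans he.span⟩
  refine ⟨V, hx₀V, hb.exists_isLocalThemeFrame hk hE hVU (g := E.res hVU g) fun x => ?_⟩
  obtain ⟨hxU, -, hspan⟩ := x.2
  simp only [value_iterate] at hspan
  rw [E.value_res]
  exact eq_top_iff.2 (hspan.ge.trans orbitSpan_le_gen)

end LocalFrames

section Sub

variable {X : Type u} [TopologicalSpace X] [ReducedComplexSpace X] {E : ABSheaf.{u, w} X}
  {n : ℕ} {U V : Opens X} {x : X}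

theorem Sub.coe_sum_smul (F : E.Sub) (c : Fin n → (HolFun V)⟦X⟧)
    (s : Fin n → F.toABSheaf.sec V) :
    (∑ i, c i • s i : F.toABSheaf.sec V).1 = ∑ i, c i • (s i).1 :=
  map_sum (F.carrier V).toSubmodule.subtype (fun i => c i • s i) Finset.univ

theorem Sub.isLocalBasis {F : E.Sub} {e : Fin n → F.toABSheaf.sec U}
    (h : ∀ (V : Opens X) (h : V ≤ U), ∀ s ∈ (F.carrier V).toSubmodule,
      ∃! c : Fin n → (HolFun V)⟦X⟧, s = ∑ i, c i • E.res h (e i).1) :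
    F.toABSheaf.IsLocalBasis e := by
  intro V hV s
  have hcoe (c : Fin n → (HolFun V)⟦X⟧) : (∑ i, c i • F.toABSheaf.res hV (e i)).1 =
      ∑ i, c i • E.res hV (e i).1 := F.coe_sum_smul c _
  obtain ⟨c, hc, hunique⟩ := h V hV s.1 s.2
  exact ⟨c, Subtype.ext (hc.trans (hcoe c).symm),
    fun c' hc' => hunique c' ((congrArg Subtype.val hc').trans (hcoe c'))⟩

theorem Sub.exists_value_eq_sum {F : E.Sub} {e : Fin n → F.toABSheaf.sec U}
    (he : F.toABSheaf.IsLocalBasis e) (hx : x ∈ U) (hxV : x ∈ V) (s : F.toABSheaf.sec V) :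
    ∃ c : Fin n → ℂ⟦X⟧, F.toABSheaf.value hxV s = ∑ i, c i • F.toABSheaf.value hx (e i) ∧
      E.value hxV s.1 = ∑ i, c i • E.value hx (e i).1 := by
  have hxVU : x ∈ V ⊓ U := ⟨hxV, hx⟩
  let t := F.toABSheaf.res (inf_le_left : V ⊓ U ≤ V) s
  refine ⟨fun i => evalSeries hxVU ((he.basis inf_le_right).repr t i), ?_, ?_⟩
  · rw [← F.toABSheaf.value_res inf_le_left hxVU]
    exact he.value_eq hxVU inf_le_right t
  · have ht : t.1 = ∑ i, (he.basis inf_le_right).repr t i • E.res inf_le_right (e i).1 := by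
      conv_lhs => rw [← (he.basis inf_le_right).sum_repr t]
      rw [F.coe_sum_smul]
      exact Finset.sum_congr rfl fun i _ => by rw [he.basis_apply]; rfl
    rw [← E.value_res inf_le_left hxVU, show E.res inf_le_left s.1 = t.1 from rfl, ht,
      ← valueHom_apply, map_sum]
    refine Finset.sum_congr rfl fun i _ => ?_
    rw [valueHom_apply, value_smul, value_res]

theorem Sub.takesValue_of_isLocalBasis {F : E.Sub} {e : Fin n → F.toABSheaf.sec U}
    (he : F.toABSheaf.IsLocalBasis e) (hx : x ∈ U) {G : ABSubmodule ℂ (E.Fibre x)}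
    (hind : LinearIndependent ℂ⟦X⟧ fun i => E.value hx (e i).1)
    (hspan : G.toSubmodule = Submodule.span ℂ⟦X⟧ (Set.range fun i => E.value hx (e i).1)) :
    F.TakesValue x G := by
  refine ⟨fun V hxV s hs => ?_, fun z => ?_⟩
  · obtain ⟨c, hcF, hcE⟩ := Sub.exists_value_eq_sum he hx hxV s
    have hc := Fintype.linearIndependent_iff.1 hind c (hcE.symm.trans hs)
    rw [hcF]
    exact Finset.sum_eq_zero fun i _ => by rw [hc i, zero_smul]
  · rw [hspan, Submodule.mem_span_range_iff_exists_fun]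
    constructor
    · rintro ⟨c, rfl⟩
      refine ⟨U, hx, ∑ i, constSeries U (c i) • e i, ?_⟩
      rw [F.coe_sum_smul]
      exact map_sum (E.valueHom hx) _ _
    · rintro ⟨V, hxV, s, rfl⟩
      obtain ⟨c, -, hcE⟩ := Sub.exists_value_eq_sum he hx hxV s
      exact ⟨c, hcE.symm⟩

/-- The sections over `V` whose values belong to given submodules `G x` of the fibres. -/
def sectionsIn (E : ABSheaf.{u, w} X) (G : ∀ x, ABSubmodule ℂ (E.Fibre x)) (V : Opens X) :
    ABSubmodule (HolFun V) (E.sec V) where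
  carrier := {s | ∀ (x : X) (hx : x ∈ V), E.value hx s ∈ (G x).toSubmodule}
  zero_mem' x hx := by
    rw [← valueHom_apply, map_zero]
    exact zero_mem _
  add_mem' {s t} hs ht x hx := by
    rw [← valueHom_apply, map_add]
    exact add_mem (hs x hx) (ht x hx)
  smul_mem' S s hs x hx := by
    rw [value_smul]
    exact Submodule.smul_mem _ _ (hs x hx)
  a_mem s hs x hx := (G x).a_mem _ (hs x hx)

variable {lam₁ : ℚ} {p : ℕ → ℕ} {k j : ℕ} {S : ℕ → (HolFun U)⟦X⟧} {e : ℕ → E.sec U}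
  {G : ∀ x, ABSubmodule ℂ (E.Fibre x)}

theorem IsLocalThemeFrame.mem_sectionsIn (h : E.IsLocalThemeFrame lam₁ p k S e)
    (hG : ∀ x, (G x).IsNormalOfRank j) {i : ℕ} (hij : i ≤ j) :
    e i ∈ (E.sectionsIn G U).toSubmodule := by
  intro x hx
  rcases Nat.eq_zero_or_pos i with rfl | hi
  · rw [h.frame.zero, ← valueHom_apply, map_zero]
    exact zero_mem _
  · rw [(h.value hx).eq_flag (hG x)]
    exact mem_flag (e := fun i => E.value hx (e i)) hi hij

theorem IsLocalThemeFrame.existsUnique_of_mem_sectionsIn (h : E.IsLocalThemeFrame lam₁ p k S e)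
    (hj : j ≤ k) (hG : ∀ x, (G x).IsNormalOfRank j) (hV : V ≤ U) {s : E.sec V}
    (hs : s ∈ (E.sectionsIn G V).toSubmodule) :
    ∃! c : Fin j → (HolFun V)⟦X⟧, s = ∑ i, c i • E.res hV (e (i + 1)) := by
  have hflag := (h.isLocalBasis.mem_flag_iff hj hV s).2 fun x hx =>
    (h.value (hV hx)).eq_flag (hG x) ▸ hs x hx
  obtain ⟨c, rfl⟩ := mem_flag_iff_exists_sum.1 hflag
  have hind : LinearIndependent (HolFun V)⟦X⟧ fun i : Fin j => E.res hV (e (i + 1)) := by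
    have := (h.isLocalBasis.basis hV).linearIndependent.comp _ (Fin.castLE_injective hj)
    simpa only [Function.comp_def, IsLocalBasis.basis_apply, Fin.val_castLE] using this
  exact ⟨c, rfl, fun c' hc' =>
    funext fun i => (Fintype.linearIndependent_iffₛ.1 hind c c' hc' i).symm⟩

/-- The sheaf of sections with values in the normal submodules `G x` of rank `j`, for a sheaf `E`
which has local theme frames: it is locally free because `e 1, …, e j` form a basis of it. -/
def normalSub (hE : E.HasLocalThemeFrames lam₁ p k) (hj : j ≤ k)
    (hG : ∀ x, (G x).IsNormalOfRank j) : E.Sub where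
  carrier := E.sectionsIn G
  res_mem h s hs x hx := by
    rw [value_res]
    exact hs x (h hx)
  mem_of_local s hs x hx := by
    obtain ⟨V, h, hxV, hV⟩ := hs x hx
    rw [← E.value_res h hxV]
    exact hV x hxV
  locally_free x := by
    obtain ⟨U, hx, S, e, h⟩ := hE x
    exact ⟨U, hx, j, fun i => ⟨e (i + 1), h.mem_sectionsIn hG i.2⟩,
      fun V hV s hs => h.existsUnique_of_mem_sectionsIn hj hG hV hs⟩

/-- The vectors of a local theme frame, cut off after `e j`, as sections of `normalSub`. -/
def IsLocalThemeFrame.normalVec (h : E.IsLocalThemeFrame lam₁ p k S e)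
    (hE : E.HasLocalThemeFrames lam₁ p k) (hj : j ≤ k) (hG : ∀ x, (G x).IsNormalOfRank j) (i : ℕ) :
    (normalSub hE hj hG).toABSheaf.sec U :=
  ⟨e (min i j), h.mem_sectionsIn hG (min_le_right i j)⟩

theorem IsLocalThemeFrame.coe_normalVec (h : E.IsLocalThemeFrame lam₁ p k S e)
    (hE : E.HasLocalThemeFrames lam₁ p k) (hj : j ≤ k) (hG : ∀ x, (G x).IsNormalOfRank j) {i : ℕ}
    (hi : i ≤ j) : (h.normalVec hE hj hG i).1 = e i :=
  congrArg e (min_eq_left hi)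

theorem IsLocalThemeFrame.isLocalThemeFrame_normalVec (h : E.IsLocalThemeFrame lam₁ p k S e)
    (hE : E.HasLocalThemeFrames lam₁ p k) (hj : j ≤ k) (hG : ∀ x, (G x).IsNormalOfRank j) :
    (normalSub hE hj hG).toABSheaf.IsLocalThemeFrame lam₁ p j S (h.normalVec hE hj hG) where
  frame := by
    refine ⟨Subtype.ext ?_, fun i hi => Subtype.ext ?_⟩
    · exact (h.coe_normalVec hE hj hG j.zero_le).trans h.frame.zero
    · have hstep := h.frame.step i (hi.trans_le hj)
      rw [← h.coe_normalVec hE hj hG hi, ← h.coe_normalVec hE hj hG hi.le] at hstep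
      exact hstep
  isUnit i hi hij := h.isUnit i hi (hij.trans_le hj)
  isUnit_coeff i hi hij := h.isUnit_coeff i hi (hij.trans_le hj)
  isLocalBasis := by
    refine Sub.isLocalBasis fun V hV s hs => ?_
    simp only [fun i : Fin j => h.coe_normalVec hE hj hG i.2]
    exact h.existsUnique_of_mem_sectionsIn hj hG hV hs

theorem IsLocalThemeFrame.takesValue_normalSub (h : E.IsLocalThemeFrame lam₁ p k S e)
    (hE : E.HasLocalThemeFrames lam₁ p k) (hj : j ≤ k) (hG : ∀ x, (G x).IsNormalOfRank j)
    (hx : x ∈ U) : (normalSub hE hj hG).TakesValue x (G x) := by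
  have hvec : (fun i : Fin j => E.value hx (e (i + 1))) =
      fun i : Fin j => E.value hx (h.normalVec hE hj hG (i + 1)).1 :=
    funext fun i => congrArg (E.value hx) (h.coe_normalVec hE hj hG i.2).symm
  have hind : LinearIndependent ℂ⟦X⟧ fun i : Fin j => E.value hx (e (i + 1)) := by
    have := (h.value hx).ind.comp (Fin.castLE hj) (Fin.castLE_injective hj)
    simpa only [Function.comp_def, Fin.val_castLE] using this
  have hspan : (G x).toSubmodule =
      Submodule.span ℂ⟦X⟧ (Set.range fun i : Fin j => E.value hx (e (i + 1))) :=
    (h.value hx).eq_flag (hG x)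
  rw [hvec] at hind hspan
  exact Sub.takesValue_of_isLocalBasis
    (h.isLocalThemeFrame_normalVec hE hj hG).isLocalBasis hx hind hspan

end Sub

end ABSheaf

section Families

variable {X : Type u} [TopologicalSpace X] [ReducedComplexSpace X] {E : ABSheaf.{u, w} X}
  {lam lam₁ : ℚ} {p : ℕ → ℕ} {k j : ℕ}

theorem IsHolomorphicFamily.of_isLocalThemeFrame (hlam : 0 < lam ∧ lam ≤ 1)
    (hshift : X → ∃ m : ℕ, lam₁ = lam + m ∧ k - 1 ≤ m)
    (hE : E.HasLocalThemeFrames lam₁ p k) : IsHolomorphicFamily E k := by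
  intro x
  obtain ⟨m, hm, hkm⟩ := hshift x
  obtain ⟨U, hx, S, e, h⟩ := hE x
  exact ⟨U, hx, {lam}, fun l hl => Finset.mem_singleton.1 hl ▸ hlam, h.exists_isThematic hm hkm⟩

theorem exists_shift_of_fibres (hk : 1 ≤ k)
    (hE : ∀ x : X, IsPrimitiveTheme (E.Fibre x) lam k ∧ HasInvariants (E.Fibre x) k lam₁ p)
    (x : X) : ∃ m : ℕ, lam₁ = lam + m ∧ k - 1 ≤ m := by
  obtain ⟨g, hg⟩ := (hE x).1.exists_generator
  exact (exists_themeFrame hk (hE x).1 (hE x).2 hg).1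

theorem isHolomorphicFamily_of_fibres (hlam : 0 < lam ∧ lam ≤ 1) (hk : 1 ≤ k)
    (hE : ∀ x : X, IsPrimitiveTheme (E.Fibre x) lam k ∧ HasInvariants (E.Fibre x) k lam₁ p) :
    IsHolomorphicFamily E k :=
  .of_isLocalThemeFrame hlam (exists_shift_of_fibres hk hE) (ABSheaf.hasLocalThemeFrames hk hE)

theorem holomorphicNormalSub_of_fibres (hlam : 0 < lam ∧ lam ≤ 1) (hj : 1 ≤ j) (hjk : j ≤ k)
    (hE : ∀ x : X, IsPrimitiveTheme (E.Fibre x) lam k ∧ HasInvariants (E.Fibre x) k lam₁ p) :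
    HolomorphicNormalSub E j := by
  have hk := hj.trans hjk
  have hnormal (x : X) : ∃ G : ABSubmodule ℂ (E.Fibre x), G.IsNormalOfRank j :=
    let ⟨F, hF, _⟩ := (hE x).2
    ⟨F j, hF j hjk⟩
  choose G hG using hnormal
  have hframe := ABSheaf.hasLocalThemeFrames hk hE
  refine ⟨ABSheaf.normalSub hframe hjk hG,
    .of_isLocalThemeFrame (lam₁ := lam₁) (p := p) hlam (fun x => ?_) fun x => ?_,
    fun x => ?_⟩
  · obtain ⟨m, hm, hkm⟩ := exists_shift_of_fibres hk hE x
    exact ⟨m, hm, by omega⟩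
  · obtain ⟨U, hx, S, e, h⟩ := hframe x
    exact ⟨U, hx, S, _, h.isLocalThemeFrame_normalVec hframe hjk hG⟩
  · obtain ⟨U, hx, S, e, h⟩ := hframe x
    exact ⟨G x, hG x, h.takesValue_normalSub hframe hjk hG hx⟩

theorem ABSheaf.IsLocalThemeFrame.exists_parameter {U : Opens X} {S : ℕ → (HolFun U)⟦X⟧}
    {e : ℕ → E.sec U} (h : E.IsLocalThemeFrame lam₁ p (k + 2) S e) (hp : 1 ≤ p (k + 1)) :
    ∃ a : HolFun U, ∀ (x : X) (hx : x ∈ U) (F : ABSubmodule ℂ (E.Fibre x)), F.IsNormalOfRank k →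
      ∀ β : ℂ, IsParameter (E.Fibre x ⧸ F.toSubmodule) (lamInv lam₁ p (k + 1)) (p (k + 1)) β ↔
        β = HolFun.eval hx a := by
  obtain ⟨c, hc⟩ := isUnit_iff_isUnit_coeff_zero.1 (h.isUnit (k + 1) (by omega) (by omega))
  refine ⟨coeff (p (k + 1)) (S (k + 1)) * ↑c⁻¹, fun x hx F hF β => ?_⟩
  have hparam := ((h.value hx).quotient ((h.value hx).eq_flag hF)).isParameter_iff hp β
  rw [evalSeries, coeff_map, coeff_map, ← hc, div_eq_mul_inv] at hparam
  rw [map_mul, map_units_inv]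
  exact hparam

theorem exists_holomorphic_parameter (hk : 2 ≤ k) (hp : 1 ≤ p (k - 1))
    (hE : ∀ x : X, IsPrimitiveTheme (E.Fibre x) lam k ∧ HasInvariants (E.Fibre x) k lam₁ p) :
    ∃ α : X → ℂ, (∀ (x : X) (F : ABSubmodule ℂ (E.Fibre x)), F.IsNormalOfRank (k - 2) →
      ∀ β : ℂ, IsParameter (E.Fibre x ⧸ F.toSubmodule) (lamInv lam₁ p (k - 1)) (p (k - 1)) β ↔
        β = α x) ∧ IsHolomorphicFun α := by
  obtain ⟨k, rfl⟩ := Nat.exists_eq_add_of_le' hk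
  choose U hxU S e h using ABSheaf.hasLocalThemeFrames (by omega : 1 ≤ k + 2) hE
  choose a ha using fun x => (h x).exists_parameter hp
  refine ⟨fun x => HolFun.eval (hxU x) (a x), fun x => ha x x (hxU x),
    ReducedComplexSpace.hol_glue _ _ fun x _ => ⟨U x, le_top, hxU x, ?_⟩⟩
  convert (a x).2 using 1
  funext y
  obtain ⟨F, hF, -⟩ := (hE y).2
  have hFk := hF k (by omega)
  exact (ha x y y.2 (F k) hFk _).1 ((ha y y (hxU y) (F k) hFk _).2 rfl)

end Families

end

theorem theorem1p4p2_general {X : Type u} [TopologicalSpace X] [ReducedComplexSpace X]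
    (E : ABSheaf.{u, v} X) (lam : ℚ) (hlam : 0 < lam ∧ lam ≤ 1) (k : ℕ) (hk : 2 ≤ k)
    (lam₁ : ℚ) (p : ℕ → ℕ)
    (hE : ∀ x : X, IsPrimitiveTheme (E.Fibre x) lam k ∧ HasInvariants (E.Fibre x) k lam₁ p) :
    IsHolomorphicFamily E k ∧ (∀ j, 1 ≤ j → j ≤ k → HolomorphicNormalSub E j) ∧
      (1 ≤ p (k - 1) → ∃ α : X → ℂ,
        (∀ (x : X) (F : ABSubmodule ℂ (E.Fibre x)), F.IsNormalOfRank (k - 2) →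
          ∀ β : ℂ, IsParameter (E.Fibre x ⧸ F.toSubmodule) (lamInv lam₁ p (k - 1)) (p (k - 1)) β ↔
            β = α x) ∧ IsHolomorphicFun α) :=
  ⟨isHolomorphicFamily_of_fibres hlam (one_le_two.trans hk) hE,
    fun _ hj hjk => holomorphicNormalSub_of_fibres hlam hj hjk hE,
    fun hp => exists_holomorphic_parameter hk hp hE⟩

theorem theorem1p4p2 {X : Type u} [TopologicalSpace X] [T2Space X] [ReducedComplexSpace X]
    (E : ABSheaf.{u, v} X) (lam : ℚ) (hlam : 0 < lam ∧ lam ≤ 1) (k : ℕ) (hk : 2 ≤ k)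
    (lam₁ : ℚ) (p : ℕ → ℕ)
    (hE : ∀ x : X, IsPrimitiveTheme (E.Fibre x) lam k ∧ HasInvariants (E.Fibre x) k lam₁ p) :
    (1 ≤ p (k - 1) → ∃ α : X → ℂ,
      (∀ (x : X) (F : ABSubmodule ℂ (E.Fibre x)), F.IsNormalOfRank (k - 2) →
        ∀ β : ℂ, IsParameter (E.Fibre x ⧸ F.toSubmodule) (lamInv lam₁ p (k - 1)) (p (k - 1)) β ↔
          β = α x) ∧
      (IsHolomorphicFamily E k ↔ HolomorphicNormalSub E (k - 1) ∧ IsHolomorphicFun α)) ∧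
    (p (k - 1) = 0 → (IsHolomorphicFamily E k ↔ HolomorphicNormalSub E (k - 1))) := by
  obtain ⟨hfamily, hsub, hparameter⟩ := theorem1p4p2_general E lam hlam k hk lam₁ p hE
  have hnormal : HolomorphicNormalSub E (k - 1) := hsub (k - 1) (by omega) (Nat.sub_le k 1)
  refine ⟨fun hp => ?_, fun _ => iff_of_true hfamily hnormal⟩
  obtain ⟨α, hα, hhol⟩ := hparameter hp
  exact ⟨α, hα, iff_of_true hfamily ⟨hnormal, hhol⟩⟩
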